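/- **Setting.** Let $r\ge 1$, let $A$ be a finite set, and let $M_1,\dots,M_r$ be matrices indexed by $A\times A$. For $m\in\mathbb Z_+^r$ let $W_m$ be the set of maps $w:[0,m]\to A$ (words of shape $m$) such that $M_j(w(l+e_j),w(l))=1$ whenever $l,l+e_j\in[0,m]$; put $o(w)=w(0)$, $t(w)=w(m)$, $W=\bigcup_m W_m$, and identify $W_0$ with $A$. Assume: (H0) each $M_j$ is a nonzero $\{0,1\}$-matrix; (H1) if $u\in W_m$, $v\in W_n$ and $t(u)=o(v)$, there is a unique $w=uv\in W_{m+n}$ with $w|_{[0,m]}=u$ and $w|_{[m,m+n]}=v$; (H2) the directed graph on $A$ with an edge $a\to b$ for each $i$ with $M_i(b,a)=1$ is irreducible; (H3) for every $0\ne p\in\mathbb Z^r$ some word $w$ (of some shape $m$) is not $p$-periodic, i.e. $w(x-p)\neq w(x)$ for some $x\in[0,m]\cap[p,p+m]$. For a nonempty countable (possibly finite) set $D$ and a map $\delta:D\to A$, let $\overline W=\{(d,w)\in D\times W: o(w)=\delta(d)\}$ be the set of decorated words (with the shape and terminus of $w$, and $(d,u)v=(d,uv)$). Let $\mathcal A_D$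 be the universal $C^*$-algebra generated by elements $s_{u,v}$ ($u,v\in\overline W$, $t(u)=t(v)$) subject to $s_{u,v}^*=s_{v,u}$; $s_{u,v}s_{v,w}=s_{u,w}$; $s_{u,v}=\sum s_{uw,vw}$ for $1\le j\le r$, the sum being over $w\in W_{e_j}$ with $o(w)=t(u)$; and $s_{u,u}s_{v,v}=0$ for distinct $u,v$ of shape $0$. Let $\mathcal F_m\subset\mathcal A_D$ be the $C^*$-subalgebra generated by the $s_{u,v}$ with $u,v$ of shape $m$, and let $\mathcal F=\overline{\bigcup_m\mathcal F_m}$ (the AF core). Write $\mathcal A_{A\times\mathbb N}$ for the case $D=A\times\mathbb N$, $\delta(a,i)=a$. Let $\mathcal A'$ be the universal $C^*$-algebra generated by elements $s'_{u,v}$ ($u,v\in W$, $o(u)=o(v)$) subject to $s_{u,v}'^*=s'_{v,u}$; $s'_{u,v}s'_{v,w}=s'_{u,w}$; $s'_{u,v}=\sum s'_{wu,wv}$ for $1\le j\le r$, the sum being over $w\in W_{e_j}$ with $t(w)=o(u)$; and $s'_{a,a}s'_{b,b}=0$ for distinct $a,b\in A$. For a nondegenerate representation $\psi$ of $\mathcal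 A'$ on a nonzero separable Hilbert space $\mathcal H$, let $\mathcal H_a=\psi(s'_{a,a})\mathcal H$, let $\mathcal C=\bigoplus_{a\in A}\mathcal K(\mathcal H_a)\subset\mathcal K(\mathcal H)$, and for $l\in\mathbb Z^r_+$ let $\alpha_l:\mathcal C\to\mathcal C$ be the $*$-homomorphism $\alpha_l(x)=\sum_{w\in W_l}\psi(s'_{w,o(w)})\,x\,\psi(s'_{o(w),w})$. Let $\mathcal E=\varinjlim_{m\in\mathbb Z^r}\mathcal C^{(m)}$ be the direct limit of copies $\mathcal C^{(m)}=\{x^{(m)}:x\in\mathcal C\}$ of $\mathcal C$ along the maps $x^{(m)}\mapsto(\alpha_l x)^{(m+l)}$, and let $\mathbb Z^r$ act on $\mathcal E$ by $\rho(l)(x^{(m)})=x^{(m+l)}$. **Theorem.** Such representations $\psi$ of $\mathcal A'$ exist. For each of them: 1. $\mathcal E$ is an AF algebra; 2. there is a $*$-isomorphism $\phi:\mathcal A_{A\times\mathbb N}\to\mathcal E\rtimes_\rho\mathbb Z^r$ with $\phi(\mathcal F)=\mathcal E$, where $\mathcal F$ is the AF core of $\mathcal A_{A\times\mathbb N}$;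 3. for every nonempty countable set $D$ and every $\delta:D\to A$ one has $\mathcal A_D\otimes\mathcal K\cong\mathcal E\rtimes_\rho\mathbb Z^r$, where $\mathcal K$ is the algebra of compact operators on $\ell^2(\mathbb N)$. -/

import Mathlib

universe u

noncomputable section

/-! ## Universal C⋆-algebras -/

/-- Non-commutative ⋆-polynomials without constant term in the letters `X`, as formal terms. -/
inductive StarPoly (X : Type u) : Type u
  | gen : X → StarPoly X
  | zero : StarPoly X
  | add : StarPoly X → StarPoly X → StarPoly X
  | neg : StarPoly X → StarPoly X
  | smul : ℂ → StarPoly X → StarPoly X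
  | mul : StarPoly X → StarPoly X → StarPoly X
  | star : StarPoly X → StarPoly X

/-- Evaluation of a ⋆-polynomial at a family of elements of a C⋆-algebra. -/
def StarPoly.eval {X B : Type u} [NonUnitalCStarAlgebra B] (S : X → B) : StarPoly X → B
  | .gen x => S x
  | .zero => 0
  | .add p q => p.eval S + q.eval S
  | .neg p => -(p.eval S)
  | .smul c p => c • p.eval S
  | .mul p q => p.eval S * q.eval S
  | .star p => Star.star (p.eval S)

/-- A set of relations on the generators `X`, given by the class of the families
`(S x)_{x ∈ X}` in C⋆-algebras that satisfy them.  The relations have to bound the norm of each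
generator. -/
structure CStarRelations (X : Type u) where
  Holds : ∀ (B : Type u) [NonUnitalCStarAlgebra B], (X → B) → Prop
  bounded : ∀ x : X, ∃ K : ℝ, ∀ (B : Type u) [NonUnitalCStarAlgebra B] (S : X → B),
    Holds B S → ‖S x‖ ≤ K

namespace CStarRelations

variable {X : Type u} (R : CStarRelations X)

/-- Two ⋆-polynomials are identified if they agree in every realization of the relations. -/
def polySetoid : Setoid (StarPoly X) where
  r p q := ∀ (B : Type u) [NonUnitalCStarAlgebra B] (S : X → B), R.Holds B S → p.eval S = q.eval S
  iseqv := ⟨fun _ _ _ _ _ => rfl, fun h B _ S hS => (h B S hS).symm,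
    fun h h' B _ S hS => (h B S hS).trans (h' B S hS)⟩

/-- The ⋆-algebra of ⋆-polynomials in the generators, modulo the relations. -/
def Poly : Type u := Quotient R.polySetoid

/-- The class of a ⋆-polynomial. -/
def Poly.mk (p : StarPoly X) : R.Poly := Quotient.mk R.polySetoid p

/-- Evaluation on `R.Poly`. -/
def Poly.eval {R : CStarRelations X} {B : Type u} [NonUnitalCStarAlgebra B] {S : X → B}
    (hS : R.Holds B S) : R.Poly → B :=
  Quotient.lift (fun p => StarPoly.eval S p) (fun _ _ h => h B S hS)

variable {R}

theorem Poly.ext' {p q : R.Poly} (h : ∀ (B : Type u) [NonUnitalCStarAlgebra B] (S : X → B)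
    (hS : R.Holds B S), p.eval hS = q.eval hS) : p = q := by
  induction p using Quotient.inductionOn with | _ p => ?_
  induction q using Quotient.inductionOn with | _ q => ?_
  exact Quotient.sound fun B _ S hS => h B S hS

instance : Zero R.Poly := ⟨Quotient.mk _ .zero⟩
instance : Add R.Poly := ⟨Quotient.map₂ .add fun _ _ h _ _ h' B _ S hS => by
  simp only [StarPoly.eval, h B S hS, h' B S hS]⟩
instance : Neg R.Poly := ⟨Quotient.map .neg fun _ _ h B _ S hS => by
  simp only [StarPoly.eval, h B S hS]⟩
instance : SMul ℂ R.Poly := ⟨fun c => Quotient.map (.smul c) fun _ _ h B _ S hS => by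
  simp only [StarPoly.eval, h B S hS]⟩
instance : Mul R.Poly := ⟨Quotient.map₂ .mul fun _ _ h _ _ h' B _ S hS => by
  simp only [StarPoly.eval, h B S hS, h' B S hS]⟩
instance : Star R.Poly := ⟨Quotient.map .star fun _ _ h B _ S hS => by
  simp only [StarPoly.eval, h B S hS]⟩

section eval
variable {B : Type u} [NonUnitalCStarAlgebra B] {S : X → B} (hS : R.Holds B S)

@[simp] theorem Poly.eval_zero : Poly.eval hS 0 = 0 := rfl
@[simp] theorem Poly.eval_add (p q : R.Poly) :
    Poly.eval hS (p + q) = p.eval hS + q.eval hS := by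
  induction p using Quotient.inductionOn; induction q using Quotient.inductionOn; rfl
@[simp] theorem Poly.eval_neg (p : R.Poly) : Poly.eval hS (-p) = -p.eval hS := by
  induction p using Quotient.inductionOn; rfl
@[simp] theorem Poly.eval_smul (c : ℂ) (p : R.Poly) :
    Poly.eval hS (c • p) = c • p.eval hS := by
  induction p using Quotient.inductionOn; rfl
@[simp] theorem Poly.eval_mul (p q : R.Poly) :
    Poly.eval hS (p * q) = p.eval hS * q.eval hS := by
  induction p using Quotient.inductionOn; induction q using Quotient.inductionOn; rfl
@[simp] theorem Poly.eval_star (p : R.Poly) : Poly.eval hS (star p) = star (p.eval hS) := by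
  induction p using Quotient.inductionOn; rfl

end eval

theorem Poly.exists_bound (p : R.Poly) : ∃ K : ℝ, ∀ (B : Type u) [NonUnitalCStarAlgebra B]
    (S : X → B) (hS : R.Holds B S), ‖p.eval hS‖ ≤ K := by
  induction p using Quotient.inductionOn with | _ p => ?_
  change ∃ K : ℝ, ∀ (B : Type u) [NonUnitalCStarAlgebra B] (S : X → B) (_ : R.Holds B S),
    ‖p.eval S‖ ≤ K
  induction p with
  | gen x => exact R.bounded x
  | zero => exact ⟨0, fun B _ S _ => by simp [StarPoly.eval]⟩
  | add p q hp hq =>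
    obtain ⟨K, hK⟩ := hp; obtain ⟨L, hL⟩ := hq
    exact ⟨K + L, fun B _ S hS => (norm_add_le _ _).trans (add_le_add (hK B S hS) (hL B S hS))⟩
  | neg p hp =>
    obtain ⟨K, hK⟩ := hp
    exact ⟨K, fun B _ S hS => by simpa [StarPoly.eval] using hK B S hS⟩
  | smul c p hp =>
    obtain ⟨K, hK⟩ := hp
    exact ⟨‖c‖ * K, fun B _ S hS => by
      simpa [StarPoly.eval, norm_smul] using mul_le_mul_of_nonneg_left (hK B S hS) (norm_nonneg c)⟩
  | mul p q hp hq =>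
    obtain ⟨K, hK⟩ := hp; obtain ⟨L, hL⟩ := hq
    exact ⟨K * L, fun B _ S hS => (norm_mul_le _ _).trans
      (mul_le_mul (hK B S hS) (hL B S hS) (norm_nonneg _) ((norm_nonneg _).trans (hK B S hS)))⟩
  | star p hp =>
    obtain ⟨K, hK⟩ := hp
    exact ⟨K, fun B _ S hS => by simpa [StarPoly.eval] using hK B S hS⟩

/-- The norm of a ⋆-polynomial is the supremum of its norms in all realizations of the relations. -/
instance : Norm R.Poly where
  norm p := sSup {c : ℝ | ∃ (B : Type u) (_ : NonUnitalCStarAlgebra B) (S : X → B)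
    (hS : R.Holds B S), ‖p.eval hS‖ = c}

theorem Poly.eval_le {B : Type u} [NonUnitalCStarAlgebra B] {S : X → B} (hS : R.Holds B S)
    (p : R.Poly) : ‖p.eval hS‖ ≤ ‖p‖ := by
  obtain ⟨K, hK⟩ := p.exists_bound
  refine le_csSup ⟨K, ?_⟩ ⟨B, _, S, hS, rfl⟩
  rintro _ ⟨B, _, S, hS, rfl⟩
  exact hK B S hS

theorem Poly.norm_nonneg' (p : R.Poly) : 0 ≤ ‖p‖ := by
  refine Real.sSup_nonneg ?_
  rintro _ ⟨B, _, S, hS, rfl⟩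
  exact norm_nonneg _

theorem Poly.norm_le {p : R.Poly} {K : ℝ} (hK : 0 ≤ K)
    (h : ∀ (B : Type u) [NonUnitalCStarAlgebra B] (S : X → B) (hS : R.Holds B S),
      ‖p.eval hS‖ ≤ K) : ‖p‖ ≤ K := by
  refine Real.sSup_le ?_ hK
  rintro _ ⟨B, _, S, hS, rfl⟩
  exact h B S hS

instance : AddCommGroup R.Poly where
  add_assoc _ _ _ := Poly.ext' fun B _ S hS => by simp [add_assoc]
  zero_add _ := Poly.ext' fun B _ S hS => by simp
  add_zero _ := Poly.ext' fun B _ S hS => by simp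
  add_comm _ _ := Poly.ext' fun B _ S hS => by simp [add_comm]
  neg_add_cancel _ := Poly.ext' fun B _ S hS => by simp
  nsmul := nsmulRec
  zsmul := zsmulRec

instance : NonUnitalRing R.Poly where
  left_distrib _ _ _ := Poly.ext' fun B _ S hS => by simp [mul_add]
  right_distrib _ _ _ := Poly.ext' fun B _ S hS => by simp [add_mul]
  zero_mul _ := Poly.ext' fun B _ S hS => by simp
  mul_zero _ := Poly.ext' fun B _ S hS => by simp
  mul_assoc _ _ _ := Poly.ext' fun B _ S hS => by simp [mul_assoc]

instance : NormedAddCommGroup R.Poly :=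
  AddGroupNorm.toNormedAddCommGroup
    { toFun := fun p => ‖p‖
      map_zero' := le_antisymm (Poly.norm_le le_rfl fun B _ S hS => by simp) (Poly.norm_nonneg' _)
      add_le' := fun p q => Poly.norm_le (add_nonneg p.norm_nonneg' q.norm_nonneg')
        fun B _ S hS => by
          simpa using (norm_add_le _ _).trans (add_le_add (Poly.eval_le hS p) (Poly.eval_le hS q))
      neg' := fun p => le_antisymm
        (Poly.norm_le p.norm_nonneg' fun B _ S hS => by simpa using Poly.eval_le hS p)
        (Poly.norm_le (-p).norm_nonneg' fun B _ S hS => by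
          simpa using Poly.eval_le hS (-p))
      eq_zero_of_map_eq_zero' := fun p hp => Poly.ext' fun B _ S hS => by
        have := (Poly.eval_le hS p).trans hp.le
        simpa using this }

instance : NonUnitalNormedRing R.Poly where
  __ : NormedAddCommGroup R.Poly := inferInstance
  __ : NonUnitalRing R.Poly := inferInstance
  norm_mul_le p q := Poly.norm_le (mul_nonneg p.norm_nonneg' q.norm_nonneg') fun B _ S hS => by
    simpa using (norm_mul_le _ _).trans
      (mul_le_mul (Poly.eval_le hS p) (Poly.eval_le hS q) (norm_nonneg _) p.norm_nonneg')

instance : StarRing R.Poly where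
  star_involutive _ := Poly.ext' fun B _ S hS => by simp
  star_mul _ _ := Poly.ext' fun B _ S hS => by simp
  star_add _ _ := Poly.ext' fun B _ S hS => by simp

instance : CStarRing R.Poly where
  norm_mul_self_le p := by
    have h : ‖p‖ ≤ Real.sqrt ‖star p * p‖ := by
      refine Poly.norm_le (Real.sqrt_nonneg _) fun B _ S hS => Real.le_sqrt_of_sq_le ?_
      have := Poly.eval_le hS (star p * p)
      rwa [Poly.eval_mul, Poly.eval_star, CStarRing.norm_star_mul_self, ← sq] at this
    calc ‖p‖ * ‖p‖ ≤ Real.sqrt ‖star p * p‖ * Real.sqrt ‖star p * p‖ :=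
          mul_self_le_mul_self p.norm_nonneg' h
      _ = ‖star p * p‖ := Real.mul_self_sqrt (Poly.norm_nonneg' _)

instance : NormedSpace ℂ R.Poly where
  one_smul _ := Poly.ext' fun B _ S hS => by simp
  mul_smul _ _ _ := Poly.ext' fun B _ S hS => by simp [mul_smul]
  smul_zero _ := Poly.ext' fun B _ S hS => by simp
  smul_add _ _ _ := Poly.ext' fun B _ S hS => by simp
  add_smul _ _ _ := Poly.ext' fun B _ S hS => by simp [add_smul]
  zero_smul _ := Poly.ext' fun B _ S hS => by simp
  norm_smul_le c p := Poly.norm_le (mul_nonneg (norm_nonneg _) p.norm_nonneg') fun B _ S hS => by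
    rw [Poly.eval_smul, norm_smul]
    exact mul_le_mul_of_nonneg_left (Poly.eval_le hS p) (norm_nonneg c)

instance : IsScalarTower ℂ R.Poly R.Poly :=
  ⟨fun _ _ _ => Poly.ext' fun B _ S hS => by simp [smul_mul_assoc]⟩
instance : SMulCommClass ℂ R.Poly R.Poly :=
  ⟨fun _ _ _ => Poly.ext' fun B _ S hS => by simp [mul_smul_comm]⟩
instance : StarModule ℂ R.Poly :=
  ⟨fun _ _ => Poly.ext' fun B _ S hS => by simp⟩

variable (R)

/-- The universal C⋆-algebra generated by `X` subject to the relations `R`: the completion of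
the ⋆-algebra of ⋆-polynomials in the largest C⋆-norm. -/
def Univ : Type u := UniformSpace.Completion R.Poly

namespace Univ

open UniformSpace UniformSpace.Completion

instance : NormedAddCommGroup R.Univ := inferInstanceAs (NormedAddCommGroup (Completion R.Poly))
instance : NormedSpace ℂ R.Univ := inferInstanceAs (NormedSpace ℂ (Completion R.Poly))
instance : CompleteSpace R.Univ := inferInstanceAs (CompleteSpace (Completion R.Poly))

variable {R}

/-- The class of a ⋆-polynomial in the universal C⋆-algebra. -/
def ofPoly (p : R.Poly) : R.Univ := (p : Completion R.Poly)

theorem ofPoly_isDenseInducing : IsDenseInducing (ofPoly : R.Poly → R.Univ) := isDenseInducing_coe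

theorem continuous_ofPoly : Continuous (ofPoly : R.Poly → R.Univ) := continuous_coe _

@[simp] theorem norm_ofPoly (p : R.Poly) : ‖ofPoly p‖ = ‖p‖ := norm_coe p

theorem ofPoly_add (p q : R.Poly) : ofPoly (p + q) = ofPoly p + ofPoly q := coe_add p q

theorem ofPoly_zero : ofPoly (0 : R.Poly) = 0 := coe_zero

theorem ofPoly_smul (c : ℂ) (p : R.Poly) : ofPoly (c • p) = c • ofPoly p := coe_smul c p

@[elab_as_elim]
theorem induction₁ {P : R.Univ → Prop} (x : R.Univ) (hc : IsClosed {x | P x})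
    (h : ∀ p, P (ofPoly p)) : P x := Completion.induction_on x hc h

@[elab_as_elim]
theorem induction₂ {P : R.Univ → R.Univ → Prop} (x y : R.Univ)
    (hc : IsClosed {x : R.Univ × R.Univ | P x.1 x.2})
    (h : ∀ p q, P (ofPoly p) (ofPoly q)) : P x y := Completion.induction_on₂ x y hc h

@[elab_as_elim]
theorem induction₃ {P : R.Univ → R.Univ → R.Univ → Prop} (x y z : R.Univ)
    (hc : IsClosed {x : R.Univ × R.Univ × R.Univ | P x.1 x.2.1 x.2.2})
    (h : ∀ p q s, P (ofPoly p) (ofPoly q) (ofPoly s)) : P x y z :=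
  Completion.induction_on₃ x y z hc h

/-- Multiplication, extended by continuity. -/
instance : Mul R.Univ :=
  ⟨Function.curry <| (ofPoly_isDenseInducing.prodMap ofPoly_isDenseInducing).extend
    (ofPoly ∘ Function.uncurry (· * ·))⟩

theorem ofPoly_mul (p q : R.Poly) : ofPoly (p * q) = ofPoly p * ofPoly q :=
  ((ofPoly_isDenseInducing.prodMap ofPoly_isDenseInducing).extend_eq
      (continuous_ofPoly.comp (@continuous_mul R.Poly _ _ _)) (p, q)).symm

instance : ContinuousMul R.Univ where
  continuous_mul := by
    let m := (AddMonoidHom.mul : R.Poly →+ R.Poly →+ R.Poly).compr₂ toCompl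
    have : Continuous fun p : R.Poly × R.Poly => m p.1 p.2 := (continuous_coe _).comp continuous_mul
    have di : IsDenseInducing (toCompl : R.Poly → Completion R.Poly) := isDenseInducing_coe
    exact (di.extend_Z_bilin di this :)

/-- The involution, extended by continuity. -/
instance : Star R.Univ := ⟨Completion.map (star : R.Poly → R.Poly)⟩

theorem ofPoly_star (p : R.Poly) : ofPoly (star p) = star (ofPoly p) :=
  (Completion.map_coe (starₗᵢ ℂ : R.Poly ≃ₗᵢ⋆[ℂ] R.Poly).isometry.uniformContinuous p).symm

instance : ContinuousStar R.Univ := ⟨Completion.continuous_map⟩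

instance : NonUnitalNormedRing R.Univ where
  __ : NormedAddCommGroup R.Univ := inferInstance
  __ : Mul R.Univ := inferInstance
  zero_mul a := induction₁ a (isClosed_eq (by fun_prop) continuous_const)
    fun a => by rw [← ofPoly_zero, ← ofPoly_mul, zero_mul]
  mul_zero a := induction₁ a (isClosed_eq (by fun_prop) continuous_const)
    fun a => by rw [← ofPoly_zero, ← ofPoly_mul, mul_zero]
  mul_assoc a b c := induction₃ a b c (isClosed_eq (by fun_prop) (by fun_prop))
    fun a b c => by simp only [← ofPoly_mul, mul_assoc]
  left_distrib a b c := induction₃ a b c (isClosed_eq (by fun_prop) (by fun_prop))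
    fun a b c => by simp only [← ofPoly_mul, ← ofPoly_add, mul_add]
  right_distrib a b c := induction₃ a b c (isClosed_eq (by fun_prop) (by fun_prop))
    fun a b c => by simp only [← ofPoly_mul, ← ofPoly_add, add_mul]
  norm_mul_le a b := induction₂ a b (isClosed_le (by fun_prop) (by fun_prop))
    fun a b => by simpa only [← ofPoly_mul, norm_ofPoly] using norm_mul_le a b

instance : StarRing R.Univ where
  star_involutive a := induction₁ a (isClosed_eq (by fun_prop) (by fun_prop))
    fun a => by simp only [← ofPoly_star, star_star]
  star_mul a b := induction₂ a b (isClosed_eq (by fun_prop) (by fun_prop))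
    fun a b => by simp only [← ofPoly_star, ← ofPoly_mul, star_mul]
  star_add a b := induction₂ a b (isClosed_eq (by fun_prop) (by fun_prop))
    fun a b => by simp only [← ofPoly_star, ← ofPoly_add, star_add]

theorem smul_mul_aux (c : ℂ) (a b : R.Univ) : (c • a) * b = c • (a * b) := by
  induction a, b using induction₂ with
  | hc =>
    exact isClosed_eq ((continuous_fst.const_smul c).mul continuous_snd)
      ((continuous_fst.mul continuous_snd).const_smul c)
  | h a b => rw [← ofPoly_smul, ← ofPoly_mul, ← ofPoly_mul, ← ofPoly_smul, smul_mul_assoc]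

theorem mul_smul_aux (c : ℂ) (a b : R.Univ) : a * (c • b) = c • (a * b) := by
  induction a, b using induction₂ with
  | hc =>
    exact isClosed_eq (continuous_fst.mul (continuous_snd.const_smul c))
      ((continuous_fst.mul continuous_snd).const_smul c)
  | h a b => rw [← ofPoly_smul, ← ofPoly_mul, ← ofPoly_mul, ← ofPoly_smul, mul_smul_comm]

theorem star_smul_aux (c : ℂ) (a : R.Univ) : star (c • a) = star c • star a := by
  induction a using induction₁ with
  | hc =>
    exact isClosed_eq (continuous_id.const_smul c).star (continuous_id.star.const_smul (star c))
  | h a => rw [← ofPoly_smul, ← ofPoly_star, ← ofPoly_star, ← ofPoly_smul, star_smul]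

theorem norm_mul_self_aux (a : R.Univ) : ‖a‖ * ‖a‖ ≤ ‖star a * a‖ := by
  induction a using induction₁ with
  | hc =>
    exact isClosed_le (continuous_norm.mul continuous_norm)
      (continuous_id.star.mul continuous_id).norm
  | h a =>
    rw [← ofPoly_star, ← ofPoly_mul, norm_ofPoly, norm_ofPoly]
    exact CStarRing.norm_mul_self_le a

instance : NonUnitalCStarAlgebra R.Univ where
  __ : NormedSpace ℂ R.Univ := inferInstance
  complete := (inferInstance : CompleteSpace R.Univ).complete
  norm_mul_self_le := norm_mul_self_aux
  smul_assoc := smul_mul_aux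
  smul_comm c a b := (mul_smul_aux c a b).symm
  star_smul := star_smul_aux

/-- The generators of the universal C⋆-algebra. -/
def gen (x : X) : R.Univ := ofPoly (Poly.mk R (.gen x))

theorem uniformContinuous_eval {B : Type u} [NonUnitalCStarAlgebra B] {S : X → B}
    (hS : R.Holds B S) : UniformContinuous (Poly.eval hS) :=
  (LipschitzWith.of_dist_le_mul (K := 1) fun p q => by
    rw [dist_eq_norm, dist_eq_norm, NNReal.coe_one, one_mul, sub_eq_add_neg, sub_eq_add_neg,
      ← Poly.eval_neg, ← Poly.eval_add]
    exact Poly.eval_le hS _).uniformContinuous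

/-- Evaluation, extended by continuity to the universal C⋆-algebra. -/
def extend {B : Type u} [NonUnitalCStarAlgebra B] {S : X → B} (hS : R.Holds B S) : R.Univ → B :=
  Completion.extension (Poly.eval hS)

@[fun_prop]
theorem continuous_extend {B : Type u} [NonUnitalCStarAlgebra B] {S : X → B} (hS : R.Holds B S) :
    Continuous (extend hS) := Completion.continuous_extension

@[simp] theorem extend_ofPoly {B : Type u} [NonUnitalCStarAlgebra B] {S : X → B}
    (hS : R.Holds B S) (p : R.Poly) : extend hS (ofPoly p) = p.eval hS :=
  Completion.extension_coe (uniformContinuous_eval hS) p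

/-- The universal property: a family that satisfies the relations defines a ⋆-homomorphism. -/
def lift {B : Type u} [NonUnitalCStarAlgebra B] {S : X → B} (hS : R.Holds B S) :
    R.Univ →⋆ₙₐ[ℂ] B where
  toFun := extend hS
  map_zero' := by rw [← ofPoly_zero, extend_ofPoly, Poly.eval_zero]
  map_add' a b := by
    induction a, b using induction₂ with
    | hc =>
      exact isClosed_eq ((continuous_extend hS).comp (continuous_fst.add continuous_snd))
        (((continuous_extend hS).comp continuous_fst).add
          ((continuous_extend hS).comp continuous_snd))
    | h a b => rw [← ofPoly_add, extend_ofPoly, extend_ofPoly, extend_ofPoly, Poly.eval_add]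
  map_mul' a b := by
    induction a, b using induction₂ with
    | hc =>
      exact isClosed_eq ((continuous_extend hS).comp (continuous_fst.mul continuous_snd))
        (((continuous_extend hS).comp continuous_fst).mul
          ((continuous_extend hS).comp continuous_snd))
    | h a b => rw [← ofPoly_mul, extend_ofPoly, extend_ofPoly, extend_ofPoly, Poly.eval_mul]
  map_smul' c a := by
    induction a using induction₁ with
    | hc =>
      exact isClosed_eq ((continuous_extend hS).comp (continuous_id.const_smul c))
        ((continuous_extend hS).const_smul c)
    | h a => rw [← ofPoly_smul, extend_ofPoly, extend_ofPoly, Poly.eval_smul, MonoidHom.id_apply]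
  map_star' a := by
    induction a using induction₁ with
    | hc =>
      exact isClosed_eq ((continuous_extend hS).comp continuous_id.star)
        (continuous_extend hS).star
    | h a => rw [← ofPoly_star, extend_ofPoly, extend_ofPoly, Poly.eval_star]

@[simp] theorem lift_gen {B : Type u} [NonUnitalCStarAlgebra B] {S : X → B}
    (hS : R.Holds B S) (x : X) : lift hS (gen x) = S x := extend_ofPoly hS _

theorem hom_ext {B : Type u} [NonUnitalCStarAlgebra B] {f g : R.Univ →⋆ₙₐ[ℂ] B}
    (h : ∀ x, f (gen x) = g (gen x)) : f = g := by
  have hf : Continuous f :=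
    (NonUnitalStarAlgHom.instContinuousLinearMapClassComplex (F := R.Univ →⋆ₙₐ[ℂ] B)).map_continuous f
  have hg : Continuous g :=
    (NonUnitalStarAlgHom.instContinuousLinearMapClassComplex (F := R.Univ →⋆ₙₐ[ℂ] B)).map_continuous g
  have key : ∀ p : StarPoly X, f (ofPoly (Poly.mk R p)) = g (ofPoly (Poly.mk R p)) := by
    intro p
    induction p with
    | gen x => exact h x
    | zero => exact (map_zero f).trans (map_zero g).symm
    | add p q hp hq =>
      have e : Poly.mk R (p.add q) = Poly.mk R p + Poly.mk R q := rfl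
      rw [e, ofPoly_add, map_add, map_add, hp, hq]
    | neg p hp =>
      have e : Poly.mk R p.neg = (-1 : ℂ) • Poly.mk R p := by
        rw [neg_one_smul]; rfl
      rw [e, ofPoly_smul, map_smul, map_smul, hp]
    | smul c p hp =>
      have e : Poly.mk R (StarPoly.smul c p) = c • Poly.mk R p := rfl
      rw [e, ofPoly_smul, map_smul, map_smul, hp]
    | mul p q hp hq =>
      have e : Poly.mk R (p.mul q) = Poly.mk R p * Poly.mk R q := rfl
      rw [e, ofPoly_mul, map_mul, map_mul, hp, hq]
    | star p hp =>
      have e : Poly.mk R p.star = Star.star (Poly.mk R p) := rfl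
      rw [e, ofPoly_star, map_star, map_star, hp]
  refine NonUnitalStarAlgHom.ext fun a => ?_
  induction a using induction₁ with
  | hc => exact isClosed_eq hf hg
  | h p => exact Quotient.inductionOn p key

end Univ

end CStarRelations

theorem CStarRelations.Univ.eq_of_lift_eq {X : Type u} {R : CStarRelations X} {x y : R.Univ}
    (h : ∀ (B : Type u) [NonUnitalCStarAlgebra B] (S : X → B) (hS : R.Holds B S),
      lift hS x = lift hS y) : x = y := by
  rw [← sub_eq_zero, ← norm_le_zero_iff]
  refine le_of_forall_pos_le_add fun ε hε => ?_
  obtain ⟨p, hp⟩ := ofPoly_isDenseInducing.dense.exists_dist_lt (x - y) (half_pos hε)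
  rw [dist_eq_norm] at hp
  have h2 : ‖p‖ ≤ ε / 2 := Poly.norm_le (half_pos hε).le fun B _ S hS => by
    have e : p.eval hS = -lift hS (x - y - ofPoly p) := by
      rw [map_sub, map_sub, h B S hS, sub_self, zero_sub, neg_neg]
      exact (extend_ofPoly hS p).symm
    rw [e, norm_neg]
    exact (NonUnitalStarAlgHom.norm_apply_le (lift hS) _).trans hp.le
  calc ‖x - y‖ = ‖(x - y - ofPoly p) + ofPoly p‖ := by rw [sub_add_cancel]
    _ ≤ ‖x - y - ofPoly p‖ + ‖ofPoly p‖ := norm_add_le _ _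
    _ ≤ ε / 2 + ε / 2 := add_le_add hp.le (by rwa [norm_ofPoly])
    _ = 0 + ε := by ring

/-! ## Direct limits, crossed products and tensor products of C⋆-algebras -/

/-- The relations of the direct limit (colimit) of a system of C⋆-algebras: compatible families of
⋆-homomorphisms. -/
def directLimitRelations {ι : Type} [Preorder ι] (C : ι → Type u)
    [∀ i, NonUnitalCStarAlgebra (C i)] (f : ∀ i j, i ≤ j → (C i →⋆ₙₐ[ℂ] C j)) :
    CStarRelations (Σ i, C i) where
  Holds B _ S := ∃ φ : ∀ i, C i →⋆ₙₐ[ℂ] B, (∀ i x, S ⟨i, x⟩ = φ i x) ∧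
    ∀ i j (h : i ≤ j) (x : C i), φ j (f i j h x) = φ i x
  bounded := fun ⟨i, x⟩ => ⟨‖x‖, fun B _ S ⟨φ, hφ, _⟩ => by
    rw [hφ]; exact NonUnitalStarAlgHom.norm_apply_le (φ i) x⟩

/-- The direct limit of a system of C⋆-algebras, in the category of C⋆-algebras. -/
abbrev CStarDirectLimit {ι : Type} [Preorder ι] (C : ι → Type u)
    [∀ i, NonUnitalCStarAlgebra (C i)] (f : ∀ i j, i ≤ j → (C i →⋆ₙₐ[ℂ] C j)) : Type u :=
  (directLimitRelations C f).Univ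

open CStarRelations in
/-- The canonical maps into the direct limit. -/
def CStarDirectLimit.of {ι : Type} [Preorder ι] (C : ι → Type u)
    [∀ i, NonUnitalCStarAlgebra (C i)] (f : ∀ i j, i ≤ j → (C i →⋆ₙₐ[ℂ] C j)) (i : ι) :
    C i →⋆ₙₐ[ℂ] CStarDirectLimit C f where
  toFun x := Univ.gen ⟨i, x⟩
  map_zero' := Univ.eq_of_lift_eq fun B _ S hS => by
    obtain ⟨φ, h, -⟩ := id hS
    rw [Univ.lift_gen, h, map_zero, map_zero]
  map_add' x y := Univ.eq_of_lift_eq fun B _ S hS => by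
    obtain ⟨φ, h, -⟩ := id hS
    simp only [map_add, Univ.lift_gen, h]
  map_mul' x y := Univ.eq_of_lift_eq fun B _ S hS => by
    obtain ⟨φ, h, -⟩ := id hS
    simp only [map_mul, Univ.lift_gen, h]
  map_smul' c x := Univ.eq_of_lift_eq fun B _ S hS => by
    obtain ⟨φ, h, -⟩ := id hS
    simp only [map_smul, Univ.lift_gen, h, MonoidHom.id_apply]
  map_star' x := Univ.eq_of_lift_eq fun B _ S hS => by
    obtain ⟨φ, h, -⟩ := id hS
    simp only [map_star, Univ.lift_gen, h]

open CStarRelations in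
theorem CStarDirectLimit.of_comp {ι : Type} [Preorder ι] {C : ι → Type u}
    [∀ i, NonUnitalCStarAlgebra (C i)] {f : ∀ i j, i ≤ j → (C i →⋆ₙₐ[ℂ] C j)} {i j : ι}
    (hij : i ≤ j) (x : C i) : of C f j (f i j hij x) = of C f i x :=
  Univ.eq_of_lift_eq fun B _ S hS => by
    obtain ⟨φ, h, h'⟩ := id hS
    change Univ.lift hS (Univ.gen ⟨j, f i j hij x⟩) = Univ.lift hS (Univ.gen ⟨i, x⟩)
    rw [Univ.lift_gen, Univ.lift_gen, h, h, h']

/-- An action of an (additive, discrete) group on a C⋆-algebra by ⋆-automorphisms. -/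
structure CStarAction (G : Type) [AddGroup G] (E : Type u) [NonUnitalCStarAlgebra E] where
  act : G → (E →⋆ₙₐ[ℂ] E)
  act_zero : ∀ x, act 0 x = x
  act_add : ∀ g h x, act (g + h) x = act g (act h x)

/-- A family `S (x, g)`, to be thought of as `x U^g`, is a ⋆-representation of the convolution
⋆-algebra of finitely supported functions `G → E`, for the twisted convolution
`(x U^g)(y U^h) = x (ρ_g y) U^{g+h}` and involution `(x U^g)^* = ρ_{-g}(x^*) U^{-g}`. -/
structure IsCrossedFamily {G : Type} [AddGroup G] {E : Type u} [NonUnitalCStarAlgebra E]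
    (ρ : CStarAction G E) {B : Type u} [NonUnitalCStarAlgebra B] (S : E × G → B) : Prop where
  add : ∀ x y g, S (x + y, g) = S (x, g) + S (y, g)
  smul : ∀ (c : ℂ) x g, S (c • x, g) = c • S (x, g)
  mul_eq : ∀ x g y h, S (x, g) * S (y, h) = S (x * ρ.act g y, g + h)
  star_eq : ∀ x g, star (S (x, g)) = S (ρ.act (-g) (star x), -g)

theorem IsCrossedFamily.norm_le {G : Type} [AddGroup G] {E : Type u} [NonUnitalCStarAlgebra E]
    {ρ : CStarAction G E} {B : Type u} [NonUnitalCStarAlgebra B] {S : E × G → B}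
    (hS : IsCrossedFamily ρ S) (x : E) (g : G) : ‖S (x, g)‖ ≤ ‖x‖ := by
  let φ : E →⋆ₙₐ[ℂ] B :=
    { toFun := fun x => S (x, 0)
      map_zero' := by simpa using hS.smul 0 0 0
      map_add' := fun x y => hS.add x y 0
      map_smul' := fun c x => hS.smul c x 0
      map_mul' := fun x y => by rw [hS.mul_eq, ρ.act_zero, add_zero]
      map_star' := fun x => by rw [hS.star_eq, neg_zero, ρ.act_zero] }
  have h1 : S (x, g) * star (S (x, g)) = φ (x * star x) := by
    rw [hS.star_eq, hS.mul_eq, ← ρ.act_add, add_neg_cancel, ρ.act_zero]; rfl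
  have h2 : ‖S (x, g)‖ * ‖S (x, g)‖ ≤ ‖x‖ * ‖x‖ := by
    rw [← CStarRing.norm_self_mul_star, h1, ← CStarRing.norm_self_mul_star (x := x)]
    exact NonUnitalStarAlgHom.norm_apply_le φ _
  exact abs_le_of_sq_le_sq' (by simpa [sq] using h2) (norm_nonneg x) |>.2

/-- The relations of the crossed product. -/
def crossedRelations {G : Type} [AddGroup G] {E : Type u} [NonUnitalCStarAlgebra E]
    (ρ : CStarAction G E) : CStarRelations (E × G) where
  Holds _ _ S := IsCrossedFamily ρ S
  bounded := fun ⟨x, g⟩ => ⟨‖x‖, fun _ _ _ hS => hS.norm_le x g⟩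

/-- The (full) crossed product `E ⋊ G`: the enveloping C⋆-algebra of the convolution ⋆-algebra. -/
abbrev CrossedProduct {G : Type} [AddGroup G] {E : Type u} [NonUnitalCStarAlgebra E]
    (ρ : CStarAction G E) : Type u := (crossedRelations ρ).Univ

/-- The canonical map `E → E ⋊ G`. -/
def CrossedProduct.incl {G : Type} [AddGroup G] {E : Type u} [NonUnitalCStarAlgebra E]
    (ρ : CStarAction G E) (x : E) : CrossedProduct ρ := CStarRelations.Univ.gen (x, 0)

/-- A family `S (a, b)`, to be thought of as `a ⊗ b`, is a ⋆-representation of the algebraic tensor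
product of `E` and `F`.  (The norm bound is automatic for ⋆-representations in C⋆-algebras.) -/
structure IsTensorFamily {E F : Type u} [NonUnitalCStarAlgebra E] [NonUnitalCStarAlgebra F]
    {B : Type u} [NonUnitalCStarAlgebra B] (S : E × F → B) : Prop where
  add_left : ∀ a a' b, S (a + a', b) = S (a, b) + S (a', b)
  add_right : ∀ a b b', S (a, b + b') = S (a, b) + S (a, b')
  smul_left : ∀ (c : ℂ) a b, S (c • a, b) = c • S (a, b)
  smul_right : ∀ (c : ℂ) a b, S (a, c • b) = c • S (a, b)
  mul_eq : ∀ a b a' b', S (a, b) * S (a', b') = S (a * a', b * b')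
  star_eq : ∀ a b, star (S (a, b)) = S (star a, star b)
  norm_le : ∀ a b, ‖S (a, b)‖ ≤ ‖a‖ * ‖b‖

/-- The relations of the tensor product. -/
def tensorRelations (E F : Type u) [NonUnitalCStarAlgebra E] [NonUnitalCStarAlgebra F] :
    CStarRelations (E × F) where
  Holds _ _ S := IsTensorFamily S
  bounded := fun ⟨a, b⟩ => ⟨‖a‖ * ‖b‖, fun _ _ _ hS => hS.norm_le a b⟩

/-- The tensor product of C⋆-algebras: the completion of the algebraic tensor product in its largest
C⋆-norm, which is its only C⋆-norm when one of the factors is nuclear, such as the algebra of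
compact operators. -/
abbrev CStarTensor (E F : Type u) [NonUnitalCStarAlgebra E] [NonUnitalCStarAlgebra F] : Type u :=
  (tensorRelations E F).Univ

/-- A C⋆-algebra is AF if it is the closure of an increasing sequence of finite-dimensional
⋆-subalgebras. -/
def IsAF (E : Type u) [NonUnitalCStarAlgebra E] : Prop :=
  ∃ F : ℕ → NonUnitalStarSubalgebra ℂ E, Monotone F ∧ (∀ n, FiniteDimensional ℂ (F n)) ∧
    Dense (⋃ n, (F n : Set E))

/-! ## Compact operators -/

theorem IsCompactOperator.adjoint_aux {H : Type u} [NormedAddCommGroup H] [InnerProductSpace ℂ H]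
    [CompleteSpace H] {T : H →L[ℂ] H} (hT : IsCompactOperator T) :
    IsCompactOperator (star T : H →L[ℂ] H) := by
  have hTS : IsCompactOperator ((T ∘L star T : H →L[ℂ] H)) := hT.comp_clm (star T)
  have hK : TotallyBounded ((T ∘L star T : H →L[ℂ] H) '' Metric.closedBall 0 1) :=
    (IsCompactOperator.isCompact_closure_image_closedBall (f := (T ∘L star T : H →L[ℂ] H).toLinearMap)
      hTS 1).totallyBounded.subset subset_closure
  have key : ∀ x y : H, ‖x‖ ≤ 1 → ‖y‖ ≤ 1 →
      ‖(star T : H →L[ℂ] H) x - (star T : H →L[ℂ] H) y‖ ^ 2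
        ≤ 2 * ‖(T ∘L star T : H →L[ℂ] H) x - (T ∘L star T : H →L[ℂ] H) y‖ := by
    intro x y hx hy
    rw [← map_sub, ← map_sub]
    have h1 : ‖(star T : H →L[ℂ] H) (x - y)‖ ^ 2
        = RCLike.re (inner ℂ ((T ∘L star T : H →L[ℂ] H) (x - y)) (x - y)) := by
      rw [ContinuousLinearMap.comp_apply, ← ContinuousLinearMap.adjoint_inner_right,
        ← ContinuousLinearMap.star_eq_adjoint, inner_self_eq_norm_sq]
    rw [h1]
    refine (re_inner_le_norm _ _).trans ?_
    rw [mul_comm]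
    refine mul_le_mul_of_nonneg_right ?_ (norm_nonneg _)
    exact (norm_sub_le x y).trans (by linarith)
  have hb : TotallyBounded ((star T : H →L[ℂ] H) '' Metric.closedBall 0 1) := by
    rw [Metric.totallyBounded_iff]
    intro ε hε
    obtain ⟨t, hts, htf, htc⟩ := Metric.finite_approx_of_totallyBounded hK (ε ^ 2 / 2)
      (by positivity)
    obtain ⟨t', ht', htf', rfl⟩ := Set.exists_subset_image_finite_and.1 ⟨t, hts, htf, rfl⟩
    refine ⟨(star T : H →L[ℂ] H) '' t', htf'.image _, ?_⟩
    rintro _ ⟨x, hx, rfl⟩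
    obtain ⟨_, ⟨y, hy, rfl⟩, hxy⟩ := Set.mem_iUnion₂.1 (htc ⟨x, hx, rfl⟩)
    refine Set.mem_iUnion₂.2 ⟨_, ⟨y, hy, rfl⟩, ?_⟩
    rw [Metric.mem_ball, dist_eq_norm] at hxy ⊢
    have hk := key x y (by simpa using hx) (by simpa using ht' hy)
    exact lt_of_pow_lt_pow_left₀ 2 hε.le (by linarith)
  rw [← ContinuousLinearMap.coe_coe, isCompactOperator_iff_isCompact_closure_image_closedBall _
    zero_lt_one]
  exact hb.closure.isCompact_of_isClosed isClosed_closure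

/-- The C⋆-algebra `𝒦(H)` of compact operators on a Hilbert space `H`. -/
def compactOperators (H : Type u) [NormedAddCommGroup H] [InnerProductSpace ℂ H]
    [CompleteSpace H] : NonUnitalStarSubalgebra ℂ (H →L[ℂ] H) where
  carrier := {T | IsCompactOperator T}
  add_mem' hS hT := hS.add hT
  zero_mem' := isCompactOperator_zero
  mul_mem' {_ T} hS _ := hS.comp_clm T
  smul_mem' c _ hT := hT.smul c
  star_mem' hT := hT.adjoint_aux

instance (H : Type u) [NormedAddCommGroup H] [InnerProductSpace ℂ H] [CompleteSpace H] :
    IsClosed (compactOperators H : Set (H →L[ℂ] H)) := isClosed_setOfPred_isCompactOperator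

/-- The Hilbert space `ℓ²(ℕ)`, placed in the universe `u`. -/
abbrev EllTwo : Type u := lp (fun _ : ULift.{u} ℕ => ℂ) 2


/-! ## Words -/

section Words

variable {r : ℕ} {A : Type u}

/-- The standard basis vector `e_j` of `ℤ^r_+`. -/
def unitShape (j : Fin r) : Fin r → ℕ := Pi.single j 1

/-- The words of shape `m`: the maps `w : [0, m] → A` with `M_j (w (l + e_j), w l) = 1` whenever
`l, l + e_j ∈ [0, m]`. -/
def Wd (M : Fin r → Matrix A A ℕ) (m : Fin r → ℕ) : Type u :=
  {w : Set.Iic m → A // ∀ (l : Fin r → ℕ) (j : Fin r) (h : l + unitShape j ≤ m),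
    M j (w ⟨l + unitShape j, h⟩) (w ⟨l, le_self_add.trans h⟩) = 1}

namespace Wd

variable {M : Fin r → Matrix A A ℕ} {m n : Fin r → ℕ}

/-- The letter `w l`. -/
def at' (w : Wd M m) (l : Fin r → ℕ) (h : l ≤ m) : A := w.1 ⟨l, h⟩

theorem ext' {w w' : Wd M m} (h : ∀ l hl, w.at' l hl = w'.at' l hl) : w = w' :=
  Subtype.ext (funext fun l => h l.1 l.2)

/-- The origin `o(w) = w(0)`. -/
def o (w : Wd M m) : A := w.at' 0 (fun i => Nat.zero_le (m i))

/-- The terminus `t(w) = w(m)`. -/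
def t (w : Wd M m) : A := w.at' m le_rfl

/-- The letter `a`, as a word of shape `0`. -/
def letter (M : Fin r → Matrix A A ℕ) (a : A) : Wd M 0 :=
  ⟨fun _ => a, fun l j h => absurd (h j) (by simp [unitShape])⟩

/-- `w` is `p`-periodic if it agrees with its `p`-translate `x ↦ w (x - p)` on
`[0, m] ∩ [p, p + m]`. -/
def IsPeriodic (w : Wd M m) (p : Fin r → ℤ) : Prop :=
  ∀ (x y : Fin r → ℕ) (hx : x ≤ m) (hy : y ≤ m), (∀ i, (x i : ℤ) = y i + p i) →
    w.at' y hy = w.at' x hx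

/-- `w` is the concatenation of `u` and `v`: `w|_[0, m] = u` and `w|_[m, m + n] = v`. -/
def IsProd (w : Wd M (m + n)) (u : Wd M m) (v : Wd M n) : Prop :=
  (∀ l (h : l ≤ m), w.at' l (h.trans le_self_add) = u.at' l h) ∧
    ∀ l (h : l ≤ n), w.at' (m + l) (add_le_add_right h m) = v.at' l h

instance [Finite A] : Finite (Wd M m) := by
  unfold Wd
  have : Finite (Set.Iic m) := (Set.finite_Iic m).to_subtype
  infer_instance

instance [Finite A] : Fintype (Wd M m) := Fintype.ofFinite _

instance [Finite A] (p : Wd M m → Prop) : Fintype {w : Wd M m // p w} := Fintype.ofFinite _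

end Wd

/-- Transition matrices `M_1, …, M_r` over the alphabet `A` that satisfy the standing
assumptions on higher rank words. -/
structure TransitionSystem (r : ℕ) (A : Type u) where
  M : Fin r → Matrix A A ℕ
  /-- Each `M_j` is a nonzero `{0,1}`-matrix. -/
  zero_or_one : ∀ j b a, M j b a = 0 ∨ M j b a = 1
  ne_zero : ∀ j, M j ≠ 0
  /-- Words with matching ends have a unique product. -/
  existsUnique_prod : ∀ (m n : Fin r → ℕ) (u : Wd M m) (v : Wd M n), u.t = v.o →
    ∃! w : Wd M (m + n), w.IsProd u v
  /-- The directed graph with an edge from `a` to `b` for each `i` with `M_i(b, a) = 1` is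
  irreducible. -/
  irreducible : ∀ a b : A, Relation.ReflTransGen (fun a b => ∃ i, M i b a = 1) a b
  /-- For every `p ≠ 0` there is a word that is not `p`-periodic. -/
  nonperiodic : ∀ p : Fin r → ℤ, p ≠ 0 → ∃ (m : Fin r → ℕ) (w : Wd M m), ¬ w.IsPeriodic p

namespace TransitionSystem

variable (T : TransitionSystem r A)

/-- The set `W` of all words. -/
structure Word where
  shape : Fin r → ℕ
  wd : Wd T.M shape

variable {T}

namespace Word

/-- The origin of a word. -/
def o (u : T.Word) : A := u.wd.o

/-- The terminus of a word. -/
def t (u : T.Word) : A := u.wd.t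

/-- The product `uv` of words with `t(u) = o(v)`. -/
def mul (u v : T.Word) (h : u.t = v.o) : T.Word :=
  ⟨u.shape + v.shape, (T.existsUnique_prod u.shape v.shape u.wd v.wd h).choose⟩

theorem mul_isProd (u v : T.Word) (h : u.t = v.o) : (u.mul v h).wd.IsProd u.wd v.wd :=
  (T.existsUnique_prod u.shape v.shape u.wd v.wd h).choose_spec.1

theorem mul_o (u v : T.Word) (h : u.t = v.o) : (u.mul v h).o = u.o :=
  (mul_isProd u v h).1 0 _

theorem mul_t (u v : T.Word) (h : u.t = v.o) : (u.mul v h).t = v.t :=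
  (mul_isProd u v h).2 v.shape le_rfl

/-- The word of shape `0` given by a letter. -/
def letter (T : TransitionSystem r A) (a : A) : T.Word := ⟨0, Wd.letter T.M a⟩

@[simp] theorem letter_o (a : A) : (letter T a).o = a := rfl
@[simp] theorem letter_t (a : A) : (letter T a).t = a := rfl

end Word

variable (T)

/-- The words of shape `m`, as words. -/
def ofWd {m : Fin r → ℕ} (w : Wd T.M m) : T.Word := ⟨m, w⟩

/-- The set `W̄` of decorated words `(d, w)`, `o(w) = δ(d)`, for decorations `δ : D → A`. -/
structure DecoratedWord {D : Type u} (δ : D → A) where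
  deco : D
  word : T.Word
  o_eq : word.o = δ deco

variable {T}

namespace DecoratedWord

variable {D : Type u} {δ : D → A}

/-- The shape of a decorated word. -/
def shape (u : T.DecoratedWord δ) : Fin r → ℕ := u.word.shape

/-- The terminus of a decorated word. -/
def t (u : T.DecoratedWord δ) : A := u.word.t

/-- The product `ūv` of a decorated word and a word with `t(ū) = o(v)`. -/
def mul (u : T.DecoratedWord δ) (v : T.Word) (h : u.t = v.o) : T.DecoratedWord δ :=
  ⟨u.deco, u.word.mul v h, (Word.mul_o u.word v h).trans u.o_eq⟩

theorem mul_t (u : T.DecoratedWord δ) (v : T.Word) (h : u.t = v.o) : (u.mul v h).t = v.t :=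
  Word.mul_t u.word v h

end DecoratedWord

/-! ## The higher rank Cuntz-Krieger algebras -/

variable (T)

/-- The index set of the generators `s_{u,v}`: pairs of decorated words with `t(u) = t(v)`. -/
structure CKIndex {D : Type u} (δ : D → A) where
  fst : T.DecoratedWord δ
  snd : T.DecoratedWord δ
  t_eq : fst.t = snd.t

/-- The defining relations of the algebra `𝒜`. -/
structure IsCKFamily [Finite A] {D : Type u} (δ : D → A) {B : Type u} [NonUnitalCStarAlgebra B]
    (S : T.CKIndex δ → B) : Prop where
  star_eq : ∀ u v h, star (S ⟨u, v, h⟩) = S ⟨v, u, h.symm⟩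
  mul_eq : ∀ u v w h h', S ⟨u, v, h⟩ * S ⟨v, w, h'⟩ = S ⟨u, w, h.trans h'⟩
  sum_eq : ∀ u v h (j : Fin r),
    S ⟨u, v, h⟩ = ∑ w : {w : Wd T.M (unitShape j) // u.t = (T.ofWd w).o},
      S ⟨u.mul (T.ofWd w.1) w.2, v.mul (T.ofWd w.1) (h.symm.trans w.2), by
        rw [DecoratedWord.mul_t, DecoratedWord.mul_t]⟩
  orthogonal : ∀ u v : T.DecoratedWord δ, u.shape = 0 → v.shape = 0 → u ≠ v →
    S ⟨u, u, rfl⟩ * S ⟨v, v, rfl⟩ = 0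

theorem norm_le_one_of_relations {B : Type u} [NonUnitalCStarAlgebra B] {s p : B}
    (h1 : star s * s = p) (h2 : star p = p) (h3 : p * p = p) : ‖s‖ ≤ 1 := by
  have hp : ‖p‖ * ‖p‖ = ‖p‖ := by
    conv_rhs => rw [← h3]
    nth_rewrite 3 [← h2]
    exact CStarRing.norm_star_mul_self.symm
  have hs : ‖s‖ * ‖s‖ = ‖p‖ := by rw [← h1, CStarRing.norm_star_mul_self]
  by_contra! h
  have hp1 : 1 < ‖p‖ := by nlinarith
  nlinarith

/-- The defining relations of the algebra `𝒜`. -/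
def ckRelations [Finite A] {D : Type u} (δ : D → A) : CStarRelations (T.CKIndex δ) where
  Holds _ _ S := T.IsCKFamily δ S
  bounded := fun ⟨u, v, h⟩ => ⟨1, fun B _ S hS => norm_le_one_of_relations
    (p := S ⟨v, v, rfl⟩) (by rw [hS.star_eq, hS.mul_eq]) (hS.star_eq _ _ _) (hS.mul_eq _ _ _ _ _)⟩

/-- The C⋆-algebra `𝒜` for the decorations `δ : D → A`. -/
abbrev CKAlgebra [Finite A] {D : Type u} (δ : D → A) : Type u := (T.ckRelations δ).Univ

/-- The generator `s_{u,v}` of `𝒜`. -/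
def s [Finite A] {D : Type u} {δ : D → A} (u v : T.DecoratedWord δ) (h : u.t = v.t) :
    T.CKAlgebra δ := CStarRelations.Univ.gen ⟨u, v, h⟩

/-- The subalgebra `ℱ_m` of `𝒜`. -/
def coreStage [Finite A] {D : Type u} (δ : D → A) (m : Fin r → ℕ) :
    NonUnitalStarSubalgebra ℂ (T.CKAlgebra δ) :=
  (NonUnitalStarAlgebra.adjoin ℂ
    {x | ∃ u v h, u.shape = m ∧ v.shape = m ∧ x = T.s u v h}).topologicalClosure

/-- The AF core `ℱ` of `𝒜`: the closure of `⋃ ℱ_m`. -/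
def core [Finite A] {D : Type u} (δ : D → A) : Set (T.CKAlgebra δ) :=
  closure (⋃ m, (T.coreStage δ m : Set (T.CKAlgebra δ)))

/-- The decorations `A × ℕ → A`, `(a, i) ↦ a`. -/
def stdDecoration (A : Type u) : A × ℕ → A := Prod.fst

/-! ## The algebra `𝒜'`, in which words are extended from the beginning -/

/-- The index set of the generators `s'_{u,v}`: pairs of words with `o(u) = o(v)`. -/
structure RevIndex where
  fst : T.Word
  snd : T.Word
  o_eq : fst.o = snd.o

/-- The defining relations of the algebra `𝒜'`. -/
structure IsRevFamily [Finite A] {B : Type u} [NonUnitalCStarAlgebra B] (S : T.RevIndex → B) :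
    Prop where
  star_eq : ∀ u v h, star (S ⟨u, v, h⟩) = S ⟨v, u, h.symm⟩
  mul_eq : ∀ u v w h h', S ⟨u, v, h⟩ * S ⟨v, w, h'⟩ = S ⟨u, w, h.trans h'⟩
  sum_eq : ∀ u v h (j : Fin r),
    S ⟨u, v, h⟩ = ∑ w : {w : Wd T.M (unitShape j) // (T.ofWd w).t = u.o},
      S ⟨(T.ofWd w.1).mul u w.2, (T.ofWd w.1).mul v (w.2.trans h), by
        rw [Word.mul_o, Word.mul_o]⟩
  orthogonal : ∀ u v : T.Word, u.shape = 0 → v.shape = 0 → u ≠ v →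
    S ⟨u, u, rfl⟩ * S ⟨v, v, rfl⟩ = 0

/-- The defining relations of the algebra `𝒜'`. -/
def revRelations [Finite A] : CStarRelations T.RevIndex where
  Holds _ _ S := T.IsRevFamily S
  bounded := fun ⟨u, v, h⟩ => ⟨1, fun B _ S hS => norm_le_one_of_relations
    (p := S ⟨v, v, rfl⟩) (by rw [hS.star_eq, hS.mul_eq]) (hS.star_eq _ _ _) (hS.mul_eq _ _ _ _ _)⟩

/-- The C⋆-algebra `𝒜'`. -/
abbrev RevAlgebra [Finite A] : Type u := T.revRelations.Univ

/-- The generator `s'_{u,v}` of `𝒜'`. -/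
def s' [Finite A] (u v : T.Word) (h : u.o = v.o) : T.RevAlgebra :=
  CStarRelations.Univ.gen ⟨u, v, h⟩

open CStarRelations in
theorem isRevFamily_gen [Finite A] :
    T.IsRevFamily (Univ.gen : T.RevIndex → T.RevAlgebra) where
  star_eq u v h := Univ.eq_of_lift_eq fun B _ S hS => by
    rw [map_star, Univ.lift_gen, Univ.lift_gen]; exact IsRevFamily.star_eq hS u v h
  mul_eq u v w h h' := Univ.eq_of_lift_eq fun B _ S hS => by
    rw [map_mul, Univ.lift_gen, Univ.lift_gen, Univ.lift_gen]
    exact IsRevFamily.mul_eq hS u v w h h'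
  sum_eq u v h j := Univ.eq_of_lift_eq fun B _ S hS => by
    rw [map_sum, Univ.lift_gen]
    simp only [Univ.lift_gen]
    exact IsRevFamily.sum_eq hS u v h j
  orthogonal u v hu hv huv := Univ.eq_of_lift_eq fun B _ S hS => by
    rw [map_mul, Univ.lift_gen, Univ.lift_gen, map_zero]
    exact IsRevFamily.orthogonal hS u v hu hv huv

variable {T}

theorem IsRevFamily.map [Finite A] {B B' : Type u} [NonUnitalCStarAlgebra B]
    [NonUnitalCStarAlgebra B'] {S : T.RevIndex → B} (hS : T.IsRevFamily S) (φ : B →⋆ₙₐ[ℂ] B') :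
    T.IsRevFamily (fun i => φ (S i)) where
  star_eq u v h := by rw [← map_star, hS.star_eq]
  mul_eq u v w h h' := by rw [← map_mul, hS.mul_eq]
  sum_eq u v h j := by rw [← map_sum, ← hS.sum_eq]
  orthogonal u v hu hv huv := by rw [← map_mul, hS.orthogonal u v hu hv huv, map_zero]

/-- Finitely many projections whose sum is a projection are mutually orthogonal. -/
theorem projections_orthogonal {H : Type u} [NormedAddCommGroup H] [InnerProductSpace ℂ H]
    [CompleteSpace H] {κ : Type*} [Fintype κ] {p : κ → (H →L[ℂ] H)} {q : H →L[ℂ] H}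
    (hp : ∀ i, star (p i) = p i) (hp' : ∀ i, p i * p i = p i) (hq : star q = q) (hq' : q * q = q)
    (hs : q = ∑ i, p i) {i j : κ} (hij : i ≠ j) : p i * p j = 0 := by
  have norm_sq : ∀ (e : H →L[ℂ] H), star e = e → e * e = e → ∀ ξ,
      ‖e ξ‖ ^ 2 = RCLike.re (inner ℂ (e ξ) ξ) := by
    intro e h1 h2 ξ
    conv_rhs => rw [← h2]
    rw [mul_apply_eq_comp, ← ContinuousLinearMap.adjoint_inner_right,
      ← ContinuousLinearMap.star_eq_adjoint, h1, inner_self_eq_norm_sq]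
  have norm_le : ∀ ξ, ‖q ξ‖ ≤ ‖ξ‖ := by
    intro ξ
    have h1 := norm_sq q hq hq' ξ
    have h2 : RCLike.re (inner ℂ (q ξ) ξ) ≤ ‖q ξ‖ * ‖ξ‖ := re_inner_le_norm _ _
    by_contra! h
    nlinarith [norm_nonneg (q ξ), norm_nonneg ξ]
  ext ξ
  rw [mul_apply_eq_comp, zero_apply]
  set η := p j ξ with hη
  have hj : p j η = η := by rw [hη, ← mul_apply_eq_comp, hp']
  have h1 : ‖q η‖ ^ 2 = ∑ k, ‖p k η‖ ^ 2 := by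
    rw [norm_sq q hq hq', hs, sum_apply, sum_inner, map_sum]
    exact Finset.sum_congr rfl fun k _ => (norm_sq (p k) (hp k) (hp' k) η).symm
  have h2 : ‖p i η‖ ^ 2 + ‖p j η‖ ^ 2 ≤ ∑ k, ‖p k η‖ ^ 2 := by
    classical
    rw [← Finset.sum_pair (f := fun k => ‖p k η‖ ^ 2) hij]
    exact Finset.sum_le_sum_of_subset_of_nonneg (Finset.subset_univ _) fun _ _ _ => by positivity
  rw [← h1, hj] at h2
  have h3 : ‖p i η‖ ^ 2 ≤ 0 := by nlinarith [norm_le η, norm_nonneg (q η), norm_nonneg η]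
  exact norm_eq_zero.1 (pow_eq_zero_iff two_ne_zero |>.1 (le_antisymm h3 (by positivity)))

/-- A word of shape `m + n` is the product of its restrictions. -/
theorem exists_eq_mul {m n : Fin r → ℕ} (w : Wd T.M (m + n)) :
    ∃ (u : Wd T.M m) (v : Wd T.M n) (h : (T.ofWd u).t = (T.ofWd v).o),
      T.ofWd w = (T.ofWd u).mul (T.ofWd v) h := by
  let u : Wd T.M m := ⟨fun l => w.at' l.1 (l.2.trans le_self_add),
    fun l j h => w.2 l j (h.trans le_self_add)⟩
  let v : Wd T.M n := ⟨fun l => w.at' (m + l.1) (add_le_add_right l.2 m), fun l j h => by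
    have h' : m + l + unitShape j ≤ m + n := by
      rw [add_assoc]; exact add_le_add_right h m
    have := w.2 (m + l) j h'
    simpa only [Wd.at', add_assoc] using this⟩
  have h : (T.ofWd u).t = (T.ofWd v).o := by
    change w.at' m _ = w.at' (m + 0) _
    simp only [Wd.at', add_zero]
  refine ⟨u, v, h, ?_⟩
  have hw : w.IsProd u v := ⟨fun l hl => rfl, fun l hl => rfl⟩
  have := (T.existsUnique_prod m n u v h).unique hw
    (T.existsUnique_prod m n u v h).choose_spec.1
  change (⟨m + n, w⟩ : T.Word) = ⟨m + n, _⟩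
  rw [this]
  rfl

theorem ofWd_zero (w : Wd T.M 0) : T.ofWd w = Word.letter T (T.ofWd w).t := by
  change (⟨0, w⟩ : T.Word) = ⟨0, _⟩
  congr 1
  refine Wd.ext' fun l hl => ?_
  obtain rfl : l = 0 := le_antisymm hl fun i => Nat.zero_le _
  rfl

section family

variable [Finite A] {H : Type u} [NormedAddCommGroup H] [InnerProductSpace ℂ H] [CompleteSpace H]
  {S : T.RevIndex → (H →L[ℂ] H)}

theorem IsRevFamily.extension_aux (hS : T.IsRevFamily S) (u : T.Word) (j : Fin r) :
    (∀ (w : Wd T.M (unitShape j)) (h : (T.ofWd w).t = u.o),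
      S ⟨u, u, rfl⟩ * S ⟨(T.ofWd w).mul u h, (T.ofWd w).mul u h, rfl⟩
        = S ⟨(T.ofWd w).mul u h, (T.ofWd w).mul u h, rfl⟩) ∧
    ∀ (w w' : Wd T.M (unitShape j)) (h : (T.ofWd w).t = u.o) (h' : (T.ofWd w').t = u.o), w ≠ w' →
      S ⟨(T.ofWd w).mul u h, (T.ofWd w).mul u h, rfl⟩ *
        S ⟨(T.ofWd w').mul u h', (T.ofWd w').mul u h', rfl⟩ = 0 := by
  classical
  let p : {w : Wd T.M (unitShape j) // (T.ofWd w).t = u.o} → (H →L[ℂ] H) :=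
    fun w => S ⟨(T.ofWd w.1).mul u w.2, (T.ofWd w.1).mul u w.2, rfl⟩
  have hp : ∀ i, star (p i) = p i := fun i => hS.star_eq _ _ _
  have hp' : ∀ i, p i * p i = p i := fun i => hS.mul_eq _ _ _ _ _
  have hs : S ⟨u, u, rfl⟩ = ∑ i, p i := hS.sum_eq u u rfl j
  have ho : ∀ {i k}, i ≠ k → p i * p k = 0 := fun hik =>
    projections_orthogonal hp hp' (hS.star_eq u u rfl) (hS.mul_eq u u u rfl rfl) hs hik
  refine ⟨fun w h => ?_, fun w w' h h' hw => ?_⟩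
  · change S ⟨u, u, rfl⟩ * p ⟨w, h⟩ = p ⟨w, h⟩
    rw [hs, Finset.sum_mul, Finset.sum_eq_single ⟨w, h⟩ (fun i _ hi => ho hi) (by simp), hp']
  · exact ho (i := ⟨w, h⟩) (k := ⟨w', h'⟩) fun e => hw (congrArg Subtype.val e)

theorem IsRevFamily.main_aux (hS : T.IsRevFamily S) (N : ℕ) : ∀ m : Fin r → ℕ, ∑ i, m i = N →
    (∀ u v : Wd T.M m, u ≠ v →
      S ⟨T.ofWd u, T.ofWd u, rfl⟩ * S ⟨T.ofWd v, T.ofWd v, rfl⟩ = 0) ∧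
    ∀ u : Wd T.M m, S ⟨Word.letter T (T.ofWd u).t, Word.letter T (T.ofWd u).t, rfl⟩ *
      S ⟨T.ofWd u, T.ofWd u, rfl⟩ = S ⟨T.ofWd u, T.ofWd u, rfl⟩ := by
  induction N using Nat.strong_induction_on with | _ N ih => ?_
  intro m hm
  by_cases h0 : m = 0
  · subst h0
    refine ⟨fun u v huv => hS.orthogonal _ _ rfl rfl fun e => huv ?_, fun u => ?_⟩
    · have e' : (⟨0, u⟩ : T.Word) = ⟨0, v⟩ := e
      simpa using e'
    · rw [← ofWd_zero]
      exact hS.mul_eq _ _ _ _ _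
  · obtain ⟨j, hj⟩ : ∃ j, m j ≠ 0 := by
      by_contra! h
      exact h0 (funext h)
    obtain ⟨n, rfl⟩ : ∃ n, m = unitShape j + n := by
      refine ⟨m - unitShape j, (add_tsub_cancel_of_le fun i => ?_).symm⟩
      by_cases hi : i = j
      · subst hi; simpa [unitShape] using Nat.one_le_iff_ne_zero.2 hj
      · simp [unitShape, hi]
    have hn : ∑ i, n i < N := by
      rw [← hm]
      simp [unitShape, Finset.sum_add_distrib]
    obtain ⟨ih1, ih2⟩ := ih _ hn n rfl
    have hE := fun u : T.Word => hS.extension_aux u j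
    refine ⟨fun u' v' huv => ?_, fun u' => ?_⟩
    · obtain ⟨w, u, h, e⟩ := exists_eq_mul u'
      obtain ⟨x, v, h', e'⟩ := exists_eq_mul v'
      have hne : T.ofWd u' ≠ T.ofWd v' := fun e => huv (by
        have e' : (⟨_, u'⟩ : T.Word) = ⟨_, v'⟩ := e
        simpa using e')
      rw [e, e'] at hne
      have e1 : S ⟨T.ofWd u', T.ofWd u', rfl⟩ =
          S ⟨(T.ofWd w).mul (T.ofWd u) h, (T.ofWd w).mul (T.ofWd u) h, rfl⟩ := by simp only [e]
      have e2 : S ⟨T.ofWd v', T.ofWd v', rfl⟩ =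
          S ⟨(T.ofWd x).mul (T.ofWd v) h', (T.ofWd x).mul (T.ofWd v) h', rfl⟩ := by simp only [e']
      rw [e1, e2]
      by_cases huv' : u = v
      · subst huv'
        refine (hE (T.ofWd u)).2 w x h h' ?_
        rintro rfl
        exact hne rfl
      · have a1 := congrArg star ((hE (T.ofWd u)).1 w h)
        rw [star_mul, hS.star_eq, hS.star_eq] at a1
        rw [← a1, ← (hE (T.ofWd v)).1 x h', mul_assoc, ← mul_assoc (S ⟨T.ofWd u, T.ofWd u, rfl⟩),
          ih1 u v huv', zero_mul, mul_zero]
    · obtain ⟨w, u, h, e⟩ := exists_eq_mul u'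
      have e1 : S ⟨T.ofWd u', T.ofWd u', rfl⟩ =
          S ⟨(T.ofWd w).mul (T.ofWd u) h, (T.ofWd w).mul (T.ofWd u) h, rfl⟩ := by simp only [e]
      have et : (T.ofWd u').t = (T.ofWd u).t := by rw [e, Word.mul_t]
      rw [et, e1, ← (hE (T.ofWd u)).1 w h, ← mul_assoc, ih2 u]

theorem IsRevFamily.orthogonal' (hS : T.IsRevFamily S) {m : Fin r → ℕ} {u v : Wd T.M m}
    (huv : u ≠ v) : S ⟨T.ofWd u, T.ofWd u, rfl⟩ * S ⟨T.ofWd v, T.ofWd v, rfl⟩ = 0 :=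
  (hS.main_aux _ m rfl).1 u v huv

theorem IsRevFamily.letter_mul (hS : T.IsRevFamily S) {m : Fin r → ℕ} (u : Wd T.M m) :
    S ⟨Word.letter T (T.ofWd u).t, Word.letter T (T.ofWd u).t, rfl⟩ *
      S ⟨T.ofWd u, T.ofWd u, rfl⟩ = S ⟨T.ofWd u, T.ofWd u, rfl⟩ :=
  (hS.main_aux _ m rfl).2 u

end family

/-! ## The AF algebra `ℰ` -/

section AF

variable [Fintype A] {H : Type u} [NormedAddCommGroup H] [InnerProductSpace ℂ H] [CompleteSpace H]
  (ψ : T.RevAlgebra →⋆ₙₐ[ℂ] (H →L[ℂ] H))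

/-- The projection `ψ(s'_{a,a})` of `H` onto `H_a`. -/
def proj (a : A) : H →L[ℂ] H := ψ (T.s' (Word.letter T a) (Word.letter T a) rfl)

/-- The partial isometry `ψ(s'_{w,o(w)})`. -/
def shiftOp {m : Fin r → ℕ} (w : Wd T.M m) : H →L[ℂ] H :=
  ψ (T.s' (T.ofWd w) (Word.letter T w.o) rfl)

/-- The operator `ψ(s'_{o(w),w})`, the adjoint of `ψ(s'_{w,o(w)})`. -/
def shiftOpAdj {m : Fin r → ℕ} (w : Wd T.M m) : H →L[ℂ] H :=
  ψ (T.s' (Word.letter T w.o) (T.ofWd w) rfl)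

theorem isRevFamily_comp : T.IsRevFamily (fun i => ψ (CStarRelations.Univ.gen i)) :=
  T.isRevFamily_gen.map ψ

theorem star_proj (a : A) : star (proj ψ a) = proj ψ a :=
  (isRevFamily_comp ψ).star_eq _ _ _

theorem proj_mul_self (a : A) : proj ψ a * proj ψ a = proj ψ a :=
  (isRevFamily_comp ψ).mul_eq _ _ _ _ _

theorem proj_mul_of_ne {a b : A} (h : a ≠ b) : proj ψ a * proj ψ b = 0 :=
  (isRevFamily_comp ψ).orthogonal _ _ rfl rfl fun e => h (congrArg Word.t e)

theorem star_shiftOp {m : Fin r → ℕ} (w : Wd T.M m) : star (shiftOp ψ w) = shiftOpAdj ψ w :=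
  (isRevFamily_comp ψ).star_eq _ _ _

theorem shiftOp_mul_proj {m : Fin r → ℕ} (w : Wd T.M m) :
    shiftOp ψ w * proj ψ w.o = shiftOp ψ w :=
  (isRevFamily_comp ψ).mul_eq _ _ _ _ _

theorem proj_mul_shiftOp {m : Fin r → ℕ} (w : Wd T.M m) :
    proj ψ w.t * shiftOp ψ w = shiftOp ψ w := by
  have h := isRevFamily_comp ψ
  have e : ψ (CStarRelations.Univ.gen ⟨T.ofWd w, T.ofWd w, rfl⟩) * shiftOp ψ w = shiftOp ψ w :=
    h.mul_eq _ _ _ _ _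
  rw [← e, ← mul_assoc]
  congr 1
  exact h.letter_mul w

theorem shiftOpAdj_mul_self {m : Fin r → ℕ} (w : Wd T.M m) :
    shiftOpAdj ψ w * shiftOp ψ w = proj ψ w.o :=
  (isRevFamily_comp ψ).mul_eq _ _ _ _ _

theorem shiftOpAdj_mul_of_ne {m : Fin r → ℕ} {w w' : Wd T.M m} (hw : w ≠ w') :
    shiftOpAdj ψ w * shiftOp ψ w' = 0 := by
  have h := isRevFamily_comp ψ
  have e : ψ (CStarRelations.Univ.gen ⟨T.ofWd w', T.ofWd w', rfl⟩) * shiftOp ψ w'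
      = shiftOp ψ w' := h.mul_eq _ _ _ _ _
  have e' : shiftOpAdj ψ w * ψ (CStarRelations.Univ.gen ⟨T.ofWd w, T.ofWd w, rfl⟩)
      = shiftOpAdj ψ w := h.mul_eq _ _ _ _ _
  rw [← e, ← e', mul_assoc, ← mul_assoc (ψ _) (ψ _), h.orthogonal' hw, zero_mul, mul_zero]

theorem blockDiagonal_iff {x : H →L[ℂ] H} : ∑ a, proj ψ a * x * proj ψ a = x ↔
    (∀ a, proj ψ a * x = x * proj ψ a) ∧ ∑ a, x * proj ψ a = x := by
  classical
  constructor
  · intro hx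
    have h1 : ∀ a, proj ψ a * x = proj ψ a * x * proj ψ a := by
      intro a
      conv_lhs => rw [← hx]
      rw [Finset.mul_sum, Finset.sum_eq_single a]
      · rw [← mul_assoc, ← mul_assoc, proj_mul_self]
      · intro b _ hb
        rw [← mul_assoc, ← mul_assoc, proj_mul_of_ne ψ hb.symm, zero_mul, zero_mul]
      · simp
    have h2 : ∀ a, x * proj ψ a = proj ψ a * x * proj ψ a := by
      intro a
      conv_lhs => rw [← hx]
      rw [Finset.sum_mul, Finset.sum_eq_single a]
      · rw [mul_assoc, proj_mul_self]
      · intro b _ hb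
        rw [mul_assoc, proj_mul_of_ne ψ hb, mul_zero]
      · simp
    exact ⟨fun a => (h1 a).trans (h2 a).symm, by simp only [h2, hx]⟩
  · rintro ⟨h1, h2⟩
    calc ∑ a, proj ψ a * x * proj ψ a = ∑ a, x * proj ψ a :=
          Finset.sum_congr rfl fun a _ => by rw [h1, mul_assoc, proj_mul_self]
      _ = x := h2

/-- The C⋆-algebra `𝒞 = ⨁_a 𝒦(H_a)`, as the algebra of all compact operators `x` on `H` with
`x = ∑_a p_a x p_a`, where `p_a` is the projection onto `H_a`. -/
def blockCompacts : NonUnitalStarSubalgebra ℂ (H →L[ℂ] H) where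
  carrier := {x | x ∈ compactOperators H ∧ ∑ a, proj ψ a * x * proj ψ a = x}
  add_mem' {x y} hx hy := ⟨add_mem hx.1 hy.1, by
    simp only [mul_add, add_mul, Finset.sum_add_distrib, hx.2, hy.2]⟩
  zero_mem' := ⟨zero_mem _, by simp⟩
  mul_mem' {x y} hx hy := ⟨mul_mem hx.1 hy.1, by
    obtain ⟨hx1, -⟩ := (blockDiagonal_iff ψ).1 hx.2
    obtain ⟨hy1, hy2⟩ := (blockDiagonal_iff ψ).1 hy.2
    refine (blockDiagonal_iff ψ).2 ⟨fun a => ?_, ?_⟩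
    · rw [← mul_assoc, hx1, mul_assoc, hy1, mul_assoc]
    · simp only [mul_assoc]
      rw [← Finset.mul_sum, hy2]⟩
  smul_mem' c x hx := ⟨SMulMemClass.smul_mem c hx.1, by
    simp only [mul_smul_comm, smul_mul_assoc, ← Finset.smul_sum, hx.2]⟩
  star_mem' {x} hx := ⟨star_mem hx.1, by
    have := congrArg star hx.2
    simpa only [star_sum, star_mul, star_proj, mul_assoc] using this⟩

instance : IsClosed (blockCompacts ψ : Set (H →L[ℂ] H)) := by
  have h : IsClosed {x : H →L[ℂ] H | ∑ a, proj ψ a * x * proj ψ a = x} :=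
    isClosed_eq (by fun_prop) (by fun_prop)
  exact IsClosed.inter (inferInstance : IsClosed (compactOperators H : Set (H →L[ℂ] H))) h

/-- The ⋆-homomorphism `α_l : 𝒞 → 𝒞`, `α_l(x) = ∑_{w ∈ W_l} ψ(s'_{w,o(w)}) x ψ(s'_{o(w),w})`. -/
def alpha (l : Fin r → ℕ) : blockCompacts ψ →⋆ₙₐ[ℂ] blockCompacts ψ where
  toFun x := ⟨∑ w : Wd T.M l, shiftOp ψ w * x * shiftOpAdj ψ w, by
    classical
    refine ⟨sum_mem fun w _ => ?_, ?_⟩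
    · have hx : IsCompactOperator (x : H →L[ℂ] H) := x.2.1
      exact (hx.clm_comp (shiftOp ψ w)).comp_clm (shiftOpAdj ψ w)
    · simp only [Finset.mul_sum, Finset.sum_mul]
      rw [Finset.sum_comm]
      refine Finset.sum_congr rfl fun w _ => ?_
      have h1 : shiftOpAdj ψ w * proj ψ w.t = shiftOpAdj ψ w := by
        rw [← star_shiftOp, ← star_proj, ← star_mul, proj_mul_shiftOp]
      rw [Finset.sum_eq_single w.t]
      · simp only [← mul_assoc]
        rw [proj_mul_shiftOp, mul_assoc, h1]
      · intro b _ hb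
        rw [← proj_mul_shiftOp ψ w]
        simp only [← mul_assoc]
        rw [proj_mul_of_ne ψ hb]
        simp
      · simp⟩
  map_zero' := Subtype.ext (by simp)
  map_add' x y := Subtype.ext (by simp [mul_add, add_mul, Finset.sum_add_distrib])
  map_smul' c x := Subtype.ext (by simp [Finset.smul_sum])
  map_mul' x y := Subtype.ext (by
    classical
    simp only [MulMemClass.coe_mul, Finset.sum_mul,
      Finset.mul_sum]
    refine Finset.sum_congr rfl fun w _ => ?_
    obtain ⟨hx1, -⟩ := (blockDiagonal_iff ψ).1 x.2.2
    rw [Finset.sum_eq_single w]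
    · calc shiftOp ψ w * (x * y) * shiftOpAdj ψ w
          = shiftOp ψ w * proj ψ w.o * x * y * shiftOpAdj ψ w := by
            rw [shiftOp_mul_proj]; simp only [mul_assoc]
        _ = shiftOp ψ w * (proj ψ w.o * x) * y * shiftOpAdj ψ w := by simp only [mul_assoc]
        _ = shiftOp ψ w * x * (shiftOpAdj ψ w * shiftOp ψ w) * y * shiftOpAdj ψ w := by
            rw [hx1, shiftOpAdj_mul_self]; simp only [mul_assoc]
        _ = _ := by simp only [mul_assoc]
    · intro w' _ hw'
      rw [show shiftOp ψ w' * x * shiftOpAdj ψ w' * (shiftOp ψ w * y * shiftOpAdj ψ w)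
        = shiftOp ψ w' * x * (shiftOpAdj ψ w' * shiftOp ψ w) * (y * shiftOpAdj ψ w) by
          simp only [mul_assoc], shiftOpAdj_mul_of_ne ψ hw']
      simp
    · simp)
  map_star' x := Subtype.ext (by
    simp only [StarMemClass.coe_star, star_sum, star_mul]
    refine Finset.sum_congr rfl fun w _ => ?_
    rw [← star_shiftOp, star_star, mul_assoc])

/-- The connecting maps `α_{n-m} : 𝒞^{(m)} → 𝒞^{(n)}`, `m ≤ n` in `ℤ^r`. -/
def connecting (m n : Fin r → ℤ) (_ : m ≤ n) : blockCompacts ψ →⋆ₙₐ[ℂ] blockCompacts ψ :=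
  alpha ψ fun i => (n i - m i).toNat

/-- The C⋆-algebra `ℰ`: the direct limit, over `m ∈ ℤ^r`, of copies `𝒞^{(m)}` of `𝒞`. -/
abbrev LimitAlgebra : Type u :=
  CStarDirectLimit (fun _ : Fin r → ℤ => blockCompacts ψ) (connecting ψ)

/-- The map `𝒞 → ℰ`, `x ↦ x^{(m)}`. -/
def stage (m : Fin r → ℤ) : blockCompacts ψ →⋆ₙₐ[ℂ] LimitAlgebra ψ :=
  CStarDirectLimit.of (fun _ : Fin r → ℤ => blockCompacts ψ) (connecting ψ) m

theorem shift_holds (l : Fin r → ℤ) :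
    (directLimitRelations (fun _ : Fin r → ℤ => blockCompacts ψ) (connecting ψ)).Holds
      (LimitAlgebra ψ) (fun p => stage ψ (p.1 + l) p.2) := by
  refine ⟨fun m => stage ψ (m + l), fun _ _ => rfl, fun m n hmn x => ?_⟩
  have e : connecting ψ m n hmn = connecting ψ (m + l) (n + l) (add_le_add_left hmn l) := by
    simp [connecting]
  rw [e]
  exact CStarDirectLimit.of_comp (C := fun _ : Fin r → ℤ => blockCompacts ψ) _ x

/-- The action `ρ` of `ℤ^r` on `ℰ` with `ρ(l)(x^{(m)}) = x^{(m+l)}`. -/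
def shiftAction : CStarAction (Fin r → ℤ) (LimitAlgebra ψ) where
  act l := CStarRelations.Univ.lift (shift_holds ψ l)
  act_zero x := by
    have h : CStarRelations.Univ.lift (shift_holds ψ 0) =
        NonUnitalStarAlgHom.id ℂ (LimitAlgebra ψ) :=
      CStarRelations.Univ.hom_ext fun p => by
        rw [CStarRelations.Univ.lift_gen, add_zero, NonUnitalStarAlgHom.coe_id, id_eq]; rfl
    rw [h, NonUnitalStarAlgHom.coe_id, id_eq]
  act_add g h x := by
    have e : CStarRelations.Univ.lift (shift_holds ψ (g + h)) =
        (CStarRelations.Univ.lift (shift_holds ψ g)).comp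
          (CStarRelations.Univ.lift (shift_holds ψ h)) :=
      CStarRelations.Univ.hom_ext fun p => by
        rw [NonUnitalStarAlgHom.comp_apply, CStarRelations.Univ.lift_gen,
          CStarRelations.Univ.lift_gen, add_comm g h, ← add_assoc]
        exact (CStarRelations.Univ.lift_gen (shift_holds ψ g) ⟨p.1 + h, p.2⟩).symm
    rw [e, NonUnitalStarAlgHom.comp_apply]

end AF

/-- A representation on a Hilbert space `H` is nondegenerate if the vectors `ψ(x)ξ` span a dense
subspace. -/
def Nondegenerate {B H : Type u} [NonUnitalCStarAlgebra B] [NormedAddCommGroup H]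
    [InnerProductSpace ℂ H] [CompleteSpace H] (ψ : B →⋆ₙₐ[ℂ] (H →L[ℂ] H)) : Prop :=
  Dense (Submodule.span ℂ {η : H | ∃ x ξ, ψ x ξ = η} : Set H)

end TransitionSystem
end Words

end

noncomputable section

open scoped BigOperators

namespace TransitionSystem

variable {r : ℕ} {A : Type u} {T : TransitionSystem r A}

/-! ## Words -/

namespace Word

/-! Let p_a be the projection of H onto H_a, and V_w = ψ(s'_{w,o(w)}). The relations of 𝒜' make V_w
a partial isometry from H_{o(w)} into H_{t(w)}, with V_{uv} = V_v V_u; the ranges of the V_w for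
words w of one shape are orthogonal and add up to H. Suppose that H has an orthonormal basis (ξ_d)
with ξ_d ∈ H_{δ(d)}. For a decorated word u = (d, w) put η_u = V_w ξ_d. Then for every shape m the
η_u with u of shape m form an orthonormal basis of H, and the operators |η_u⟩⟨η_v| with t(u) = t(v),
for u and v of prescribed shapes, span a dense subspace of 𝒞. Since V_w η_u = η_{uw}, the map α_l
sends |η_u⟩⟨η_v| to the sum of the |η_{uw}⟩⟨η_{vw}| over w of shape l (`alpha_theta`): this is the
sum rule of 𝒜.

Hence the elements |η_u⟩⟨η_v|^{(m)} U^{m-n}, for u of shape m and v of shape n, satisfy the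
relations of 𝒜 in ℰ ⋊ ℤ^r (`IsAdaptedBasis.isCKFamily`). Conversely, let S be any family with these
relations. For u, v of a fixed shape the S_{u,v} are matrix units, so |η_u⟩⟨η_v| ↦ S_{u,v} defines a
homomorphism on 𝒞; the sum rule makes these homomorphisms compatible with the α_l, and they define
`limitHom` on ℰ. In each degree g = m - n the assignment |η_u⟩⟨η_v|^{(m)} ↦ S_{u,v} extends to a
contraction of ℰ, because S_i S_j^* has degree 0 and so comes from ℰ (`exists_gradedMap`); these
contractions form a covariant family (`isCrossedFamily_gradedMap`). The two homomorphisms are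
inverse to each other on generators, so 𝒜 ≅ ℰ ⋊ ℤ^r. Only universal properties enter, no simplicity
or uniqueness theorem. The core is the part of degree 0.

An adapted basis exists as soon as every letter decorates countably infinitely often, provided that
all the H_a are infinite-dimensional. The latter follows from (H3): otherwise the number of words
ending in a given letter would be bounded, words would be determined by shape and terminus, and a
common period would appear (`exists_card_to_ge`). For arbitrary D, tensoring with 𝒦 replaces D by D
× ℕ (`nonempty_tensorEquiv`). The algebra does not change when decorations are replaced by decorated
words of bounded prescribed shapes (`nonempty_refinedEquiv`), and by irreducibility these shapes can
be chosen so that every letter is the terminus of infinitely many of them (`exists_refinement`).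

Representations exist because 𝒜' acts on ℓ² of the set of words that are infinite to the left and
share their far left part with a fixed one, by replacing a final word v by u. -/

theorem ext_at {u v : T.Word} (hs : u.shape = v.shape)
    (h : ∀ l hu hv, u.wd.at' l hu = v.wd.at' l hv) : u = v := by
  obtain ⟨m, u⟩ := u
  obtain ⟨n, v⟩ := v
  obtain rfl : m = n := hs
  congr 1
  exact Wd.ext' fun l hl => h l hl hl

/-- A letter is read off together with a proof that the position lies in the word, which blocks
rewriting; word and position are exchanged here in one go. -/
theorem at_congr {u v : T.Word} (e : u = v) {l l' : Fin r → ℕ} (hl : l = l')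
    (h : l ≤ u.shape) (h' : l' ≤ v.shape) : u.wd.at' l h = v.wd.at' l' h' := by
  subst e; subst hl; rfl

@[simp] theorem mul_shape (u v : T.Word) (h : u.t = v.o) :
    (u.mul v h).shape = u.shape + v.shape := rfl

@[simp] theorem letter_shape (a : A) : (letter T a).shape = 0 := rfl

theorem mul_at_left (u v : T.Word) (h : u.t = v.o) (l : Fin r → ℕ) (hl : l ≤ u.shape)
    (hl' : l ≤ (u.mul v h).shape) : (u.mul v h).wd.at' l hl' = u.wd.at' l hl :=
  (mul_isProd u v h).1 l hl

theorem mul_at_right (u v : T.Word) (h : u.t = v.o) (l : Fin r → ℕ) (hl : l ≤ v.shape)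
    (hl' : u.shape + l ≤ (u.mul v h).shape) :
    (u.mul v h).wd.at' (u.shape + l) hl' = v.wd.at' l hl :=
  (mul_isProd u v h).2 l hl

theorem exists_mul (x : T.Word) {m n : Fin r → ℕ} (hx : x.shape = m + n) :
    ∃ (u v : T.Word) (h : u.t = v.o), u.shape = m ∧ v.shape = n ∧ x = u.mul v h := by
  obtain ⟨k, x⟩ := x
  obtain rfl : k = m + n := hx
  obtain ⟨u, v, h, e⟩ := exists_eq_mul x
  exact ⟨T.ofWd u, T.ofWd v, h, rfl, rfl, e⟩

theorem exists_mul_of_le (x : T.Word) {m : Fin r → ℕ} (hm : m ≤ x.shape) :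
    ∃ (u v : T.Word) (h : u.t = v.o), u.shape = m ∧ v.shape = x.shape - m ∧ x = u.mul v h :=
  x.exists_mul (add_tsub_cancel_of_le hm).symm

/-- A word that restricts to `u` and `v` is the product `uv`. -/
theorem eq_mul {x u v : T.Word} (h : u.t = v.o) (hs : x.shape = u.shape + v.shape)
    (hu : ∀ l (hl : l ≤ u.shape) hl', x.wd.at' l hl' = u.wd.at' l hl)
    (hv : ∀ l (hl : l ≤ v.shape) hl', x.wd.at' (u.shape + l) hl' = v.wd.at' l hl) :
    x = u.mul v h := by
  obtain ⟨u', v', h', hu', hv', rfl⟩ := x.exists_mul hs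
  have e1 : u' = u := ext_at hu' fun l h1 h2 => by
    rw [← hu l h2 (h1.trans le_self_add)]; exact (mul_at_left u' v' h' l h1 _).symm
  subst e1
  have e2 : v' = v := ext_at hv' fun l h1 h2 => by
    rw [← hv l h2 (add_le_add_right h1 _)]; exact (mul_at_right u' v' h' l h1 _).symm
  subst e2
  rfl

theorem mul_inj {u v u' v' : T.Word} {h : u.t = v.o} {h' : u'.t = v'.o}
    (e : u.mul v h = u'.mul v' h') (hs : u.shape = u'.shape) : u = u' ∧ v = v' := by
  have e1 : u = u' := ext_at hs fun l h1 h2 => by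
    rw [← mul_at_left u v h l h1 (h1.trans le_self_add),
      ← mul_at_left u' v' h' l h2 (h2.trans le_self_add)]
    exact at_congr e rfl _ _
  subst e1
  have hs' : v.shape = v'.shape := by
    have := congrArg Word.shape e
    exact add_left_cancel this
  exact ⟨rfl, ext_at hs' fun l h1 h2 => by
    rw [← mul_at_right u v h l h1 (add_le_add_right h1 _),
      ← mul_at_right u v' h' l h2 (add_le_add_right h2 _)]
    exact at_congr e rfl _ _⟩

theorem mul_inj_right {u v u' v' : T.Word} {h : u.t = v.o} {h' : u'.t = v'.o}
    (e : u.mul v h = u'.mul v' h') (hs : v.shape = v'.shape) : u = u' ∧ v = v' := by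
  refine mul_inj e ?_
  have := congrArg Word.shape e
  simp only [mul_shape, hs] at this
  exact add_right_cancel this

/-- The left side is cut at the shape of `u` and then at that of `v`. The three pieces have the same
letters as `u`, `v`, `w`, and a word is the product of its pieces. -/
theorem mul_assoc' {u v w : T.Word} (h : u.t = v.o) (h' : (u.mul v h).t = w.o)
    (h1 : v.t = w.o) (h2 : u.t = (v.mul w h1).o) :
    (u.mul v h).mul w h' = u.mul (v.mul w h1) h2 := by
  obtain ⟨u', y, hy, hu', hy', e⟩ := ((u.mul v h).mul w h').exists_mul
    (m := u.shape) (n := v.shape + w.shape) (add_assoc _ _ _)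
  obtain ⟨v', w', hw, hv', hw', rfl⟩ := y.exists_mul hy'
  have e1 : u' = u := ext_at hu' fun l a b => by
    rw [← mul_at_left u' _ hy l a (a.trans le_self_add), ← mul_at_left u v h l b
      (b.trans le_self_add), ← mul_at_left (u.mul v h) w h' l (b.trans le_self_add)
      ((b.trans le_self_add).trans le_self_add)]
    exact at_congr e.symm rfl _ _
  subst e1
  have e2 : v' = v := ext_at hv' fun l a b => by
    have b' : u'.shape + l ≤ (u'.mul v h).shape := add_le_add_right b _
    have a' : l ≤ (v'.mul w' hw).shape := a.trans le_self_add
    rw [← mul_at_left v' w' hw l a a', ← mul_at_right u' _ hy l a' (add_le_add_right a' _),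
      ← mul_at_right u' v h l b b', ← mul_at_left (u'.mul v h) w h' _ b' (b'.trans le_self_add)]
    exact at_congr e.symm rfl _ _
  subst e2
  have e3 : w' = w := ext_at hw' fun l a b => by
    have a' : v'.shape + l ≤ (v'.mul w' hw).shape := add_le_add_right a _
    have b' : (u'.mul v' h).shape + l ≤ ((u'.mul v' h).mul w h').shape := add_le_add_right b _
    rw [← mul_at_right v' w' hw l a a', ← mul_at_right u' _ hy _ a' (add_le_add_right a' _),
      ← mul_at_right (u'.mul v' h) w h' l b b']
    exact at_congr e.symm (add_assoc _ _ _).symm _ _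
  subst e3
  exact e

theorem letter_mul (u : T.Word) {a : A} (h : a = u.o) : (letter T a).mul u h = u := by
  subst h
  refine (eq_mul _ (by simp) (fun l hl hl' => ?_) fun l hl hl' => ?_).symm
  · obtain rfl : l = 0 := le_antisymm hl fun i => Nat.zero_le _
    rfl
  · exact at_congr rfl (by simp) _ _

theorem mul_letter (u : T.Word) {a : A} (h : u.t = a) : u.mul (letter T a) h = u := by
  subst h
  refine (eq_mul _ (by simp) (fun l hl hl' => rfl) fun l hl hl' => ?_).symm
  obtain rfl : l = 0 := le_antisymm hl fun i => Nat.zero_le _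
  exact at_congr rfl (by simp) _ _

theorem eq_letter {u : T.Word} (h : u.shape = 0) : u = letter T u.t := by
  obtain ⟨m, u⟩ := u
  obtain rfl : m = 0 := h
  exact ofWd_zero u

theorem o_eq_t {u : T.Word} (h : u.shape = 0) : u.o = u.t := by
  rw [eq_letter h]; rfl

end Word

/-! ### Induction on shapes; existence of words with prescribed ends and shapes -/

theorem exists_unitShape_add {m : Fin r → ℕ} (h0 : m ≠ 0) : ∃ j n, m = unitShape j + n := by
  obtain ⟨j, hj⟩ : ∃ j, m j ≠ 0 := by
    by_contra! h
    exact h0 (funext h)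
  refine ⟨j, m - unitShape j, (add_tsub_cancel_of_le fun i => ?_).symm⟩
  by_cases hi : i = j
  · subst hi; simpa [unitShape] using Nat.one_le_iff_ne_zero.2 hj
  · simp [unitShape, hi]

/-- Induction on shapes. -/
theorem shape_induction {P : (Fin r → ℕ) → Prop} (h0 : P 0)
    (h : ∀ j m, P m → P (unitShape j + m)) (m : Fin r → ℕ) : P m := by
  obtain ⟨N, hN⟩ : ∃ N, ∑ i, m i = N := ⟨_, rfl⟩
  induction N generalizing m with
  | zero =>
    obtain rfl : m = 0 := funext fun i => by simpa using (Finset.sum_eq_zero_iff.1 hN) i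
    exact h0
  | succ N ih =>
    obtain ⟨j, n, rfl⟩ := exists_unitShape_add (m := m) (by rintro rfl; simp at hN)
    refine h j n (ih n ?_)
    have : ∑ i, (unitShape j + n) i = 1 + ∑ i, n i := by
      simp [unitShape, Finset.sum_add_distrib]
    omega

/-- The word of shape `e_j` given by an edge. -/
def edge {j : Fin r} {a b : A} (h : T.M j b a = 1) : T.Word := ⟨unitShape j,
  ⟨fun l => if l.1 = 0 then a else b, fun l i hl => by
    -- The interval [0, e_j] has only the points 0 and e_j, so the one condition to check is at `l =
    -- 0` in direction `j`.
    have hu : unitShape i ≤ unitShape j := le_add_self.trans hl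
    obtain rfl : i = j := by
      by_contra hij
      have := hu i
      simp [unitShape, hij] at this
    have hl0 : l = 0 := by
      have : l + unitShape i ≤ 0 + unitShape i := by simpa using hl
      exact le_antisymm (le_of_add_le_add_right this) fun _ => Nat.zero_le _
    subst hl0
    have hne : (0 + unitShape i : Fin r → ℕ) ≠ 0 := fun e => by
      have := congrFun e i
      simp [unitShape] at this
    simp only [hne, if_true, if_false]
    exact h⟩⟩

@[simp] theorem edge_shape {j : Fin r} {a b : A} (h : T.M j b a = 1) :
    (edge h).shape = unitShape j := rfl

@[simp] theorem edge_o {j : Fin r} {a b : A} (h : T.M j b a = 1) : (edge h).o = a :=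
  if_pos rfl

@[simp] theorem edge_t {j : Fin r} {a b : A} (h : T.M j b a = 1) : (edge h).t = b :=
  if_neg fun e => by
    have := congrFun e j
    simp [unitShape] at this

/-- Words connect any two letters. -/
theorem exists_word (T : TransitionSystem r A) (a b : A) : ∃ w : T.Word, w.o = a ∧ w.t = b := by
  induction T.irreducible a b with
  | refl => exact ⟨Word.letter T a, rfl, rfl⟩
  | tail _ h ih =>
    obtain ⟨w, ho, ht⟩ := ih
    obtain ⟨i, hi⟩ := h
    exact ⟨w.mul (edge hi) (by simp [ht]), by rw [Word.mul_o, ho], by rw [Word.mul_t, edge_t]⟩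

/-- Words of shape `e_i` and `e_j` can be commuted past each other. -/
theorem Word.exists_swap (u v : T.Word) (h : u.t = v.o) : ∃ (v' u' : T.Word) (h' : v'.t = u'.o),
    v'.shape = v.shape ∧ u'.shape = u.shape ∧ u.mul v h = v'.mul u' h' := by
  obtain ⟨v', u', h', hv, hu, e⟩ := (u.mul v h).exists_mul (add_comm u.shape v.shape)
  exact ⟨v', u', h', hv, hu, e⟩

theorem exists_edge (T : TransitionSystem r A) (j : Fin r) : ∃ w : T.Word, w.shape = unitShape j := by
  by_contra! h
  refine T.ne_zero j (Matrix.ext fun b a => ?_)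
  rcases T.zero_or_one j b a with e | e
  · exact e
  · exact absurd rfl (h (edge e))

/-- Some edge of direction `j` exists because `M j ≠ 0`, and irreducibility gives a path from `a` to
it. Factoring path times edge in the other order moves a step of direction `j` to the front, where
it starts at `a`. -/
theorem exists_succ (T : TransitionSystem r A) (a : A) (j : Fin r) :
    ∃ w : T.Word, w.o = a ∧ w.shape = unitShape j := by
  obtain ⟨e, he⟩ := T.exists_edge j
  obtain ⟨p, hpo, hpt⟩ := T.exists_word a e.o
  obtain ⟨v', u', h', hv, -, hmul⟩ := p.exists_swap e hpt
  refine ⟨v', ?_, hv.trans he⟩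
  rw [← Word.mul_o v' u' h', ← hmul, Word.mul_o, hpo]

theorem exists_pred (T : TransitionSystem r A) (a : A) (j : Fin r) :
    ∃ w : T.Word, w.t = a ∧ w.shape = unitShape j := by
  obtain ⟨e, he⟩ := T.exists_edge j
  obtain ⟨p, hpo, hpt⟩ := T.exists_word e.t a
  obtain ⟨v', u', h', -, hu, hmul⟩ := e.exists_swap p hpo.symm
  refine ⟨u', ?_, hu.trans he⟩
  rw [← Word.mul_t v' u' h', ← hmul, Word.mul_t, hpt]

theorem exists_word_from (T : TransitionSystem r A) (a : A) (m : Fin r → ℕ) :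
    ∃ w : T.Word, w.o = a ∧ w.shape = m := by
  induction m using shape_induction generalizing a with
  | h0 => exact ⟨Word.letter T a, rfl, rfl⟩
  | h j m ih =>
    obtain ⟨e, ho, hs⟩ := T.exists_succ a j
    obtain ⟨w, hwo, hws⟩ := ih e.t
    exact ⟨e.mul w hwo.symm, by rw [Word.mul_o, ho], by rw [Word.mul_shape, hs, hws]⟩

theorem exists_word_to (T : TransitionSystem r A) (a : A) (m : Fin r → ℕ) :
    ∃ w : T.Word, w.t = a ∧ w.shape = m := by
  induction m using shape_induction generalizing a with
  | h0 => exact ⟨Word.letter T a, rfl, rfl⟩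
  | h j m ih =>
    obtain ⟨w, hwt, hws⟩ := ih a
    obtain ⟨e, ht, hs⟩ := T.exists_pred w.o j
    exact ⟨e.mul w ht, by rw [Word.mul_t, hwt], by rw [Word.mul_shape, hs, hws]⟩

/-! ## Sums over words -/

section sums

variable (T)

/-- The words of shape `l` with origin `a`. -/
abbrev From (l : Fin r → ℕ) (a : A) : Type u := {w : Wd T.M l // a = (T.ofWd w).o}

/-- The words of shape `l` with terminus `a`. -/
abbrev To (l : Fin r → ℕ) (a : A) : Type u := {w : Wd T.M l // (T.ofWd w).t = a}

variable {T}

/-- The underlying word. -/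
def From.wd {l : Fin r → ℕ} {a : A} (w : T.From l a) : T.Word := T.ofWd w.1

/-- The underlying word. -/
def To.wd {l : Fin r → ℕ} {a : A} (w : T.To l a) : T.Word := T.ofWd w.1

theorem From.o_eq {l : Fin r → ℕ} {a : A} (w : T.From l a) : a = w.wd.o := w.2

theorem To.t_eq {l : Fin r → ℕ} {a : A} (w : T.To l a) : w.wd.t = a := w.2

@[simp] theorem From.shape_eq {l : Fin r → ℕ} {a : A} (w : T.From l a) : w.wd.shape = l := rfl

@[simp] theorem To.shape_eq {l : Fin r → ℕ} {a : A} (w : T.To l a) : w.wd.shape = l := rfl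

theorem From.ext {l : Fin r → ℕ} {a : A} {w w' : T.From l a} (h : w.wd = w'.wd) : w = w' := by
  have h' : (⟨l, w.1⟩ : T.Word) = ⟨l, w'.1⟩ := h
  exact Subtype.ext (by simpa using h')

theorem To.ext {l : Fin r → ℕ} {a : A} {w w' : T.To l a} (h : w.wd = w'.wd) : w = w' := by
  have h' : (⟨l, w.1⟩ : T.Word) = ⟨l, w'.1⟩ := h
  exact Subtype.ext (by simpa using h')

/-- A word of shape `l` and origin `a`, as an element of `T.From l a`. -/
def Word.toFrom (w : T.Word) {l : Fin r → ℕ} {a : A} (hs : w.shape = l) (h : a = w.o) :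
    T.From l a := ⟨hs ▸ w.wd, by subst hs; exact h⟩

@[simp] theorem Word.toFrom_wd (w : T.Word) {l : Fin r → ℕ} {a : A} (hs : w.shape = l)
    (h : a = w.o) : (w.toFrom hs h).wd = w := by
  subst hs; rfl

/-- A word of shape `l` and terminus `a`, as an element of `T.To l a`. -/
def Word.toTo (w : T.Word) {l : Fin r → ℕ} {a : A} (hs : w.shape = l) (h : w.t = a) :
    T.To l a := ⟨hs ▸ w.wd, by subst hs; exact h⟩

@[simp] theorem Word.toTo_wd (w : T.Word) {l : Fin r → ℕ} {a : A} (hs : w.shape = l)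
    (h : w.t = a) : (w.toTo hs h).wd = w := by
  subst hs; rfl

variable [Finite A] {M : Type*} [AddCommMonoid M]

theorem sum_from_zero (a : A) (F : ∀ w : T.Word, a = w.o → M) :
    ∑ w : T.From 0 a, F w.wd w.o_eq = F (Word.letter T a) (Word.letter_o a).symm := by
  let w₀ : T.From 0 a := (Word.letter T a).toFrom (Word.letter_shape a) (Word.letter_o a).symm
  have : ∀ w : T.From 0 a, w = w₀ := fun w => From.ext <| by
    have h1 := Word.eq_letter (u := w.wd) rfl
    have h2 := Word.o_eq_t (u := w.wd) rfl
    have h3 := w.o_eq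
    rw [h1, ← h2, ← h3, Word.toFrom_wd]
  rw [Fintype.sum_eq_single w₀ (fun w hw => absurd (this w) hw)]
  simp only [w₀, Word.toFrom_wd]

/-- Unique factorization: (w, w') ↦ ww' is a bijection from composable pairs of shapes `m`, `n` onto
the words of shape `m + n`. The summand receives the proof of `a = w.o` because the extensions of a
pair of decorated words require it. -/
theorem sum_from_add (m n : Fin r → ℕ) (a : A) (F : ∀ w : T.Word, a = w.o → M) :
    ∑ w : T.From (m + n) a, F w.wd w.o_eq = ∑ w : T.From m a, ∑ w' : T.From n w.wd.t,
      F (w.wd.mul w'.wd w'.o_eq) (by rw [Word.mul_o]; exact w.o_eq) := by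
  rw [Finset.sum_sigma']
  symm
  refine Finset.sum_bij (fun x _ => (x.1.wd.mul x.2.wd x.2.o_eq).toFrom
    (by rw [Word.mul_shape, From.shape_eq, From.shape_eq]) (by rw [Word.mul_o]; exact x.1.o_eq))
    (fun _ _ => Finset.mem_univ _) ?_ ?_ ?_
  · rintro ⟨w, w'⟩ _ ⟨x, x'⟩ _ e
    have e' := congrArg From.wd e
    rw [Word.toFrom_wd, Word.toFrom_wd] at e'
    obtain ⟨e1, e2⟩ := Word.mul_inj e' rfl
    obtain rfl := From.ext e1
    obtain rfl := From.ext e2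
    rfl
  · intro w _
    obtain ⟨u, v, h, hu, hv, e⟩ := w.wd.exists_mul w.shape_eq
    have ho : a = u.o := by rw [w.o_eq, e, Word.mul_o]
    refine ⟨⟨u.toFrom hu ho, v.toFrom hv (by rw [Word.toFrom_wd]; exact h)⟩,
      Finset.mem_sigma.2 ⟨Finset.mem_univ _, Finset.mem_univ _⟩, From.ext ?_⟩
    simp only [Word.toFrom_wd]
    exact e.symm
  · rintro ⟨w, w'⟩ _
    simp only [Word.toFrom_wd]

end sums

end TransitionSystem

/-! ## Density and extension of linear maps -/

/-- The form in which every later identity between continuous maps is reduced to generators or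
matrix units. -/
theorem dense_span_induction {E : Type*} [NormedAddCommGroup E] [NormedSpace ℂ E] {G : Set E}
    (hG : Dense (Submodule.span ℂ G : Set E)) {P : E → Prop} (hc : IsClosed {x | P x})
    (mem : ∀ x ∈ G, P x) (zero : P 0) (add : ∀ x y, P x → P y → P (x + y))
    (smul : ∀ (c : ℂ) x, P x → P (c • x)) (x : E) : P x :=
  hG.induction (P := P) (fun _ hy => Submodule.span_induction mem zero
    (fun x y _ _ => add x y) (fun c x _ => smul c x) hy) hc x

theorem dense_range_linearCombination {E ι : Type*} [NormedAddCommGroup E] [NormedSpace ℂ E]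
    {e : ι → E} (h : Dense (Submodule.span ℂ (Set.range e) : Set E)) :
    DenseRange (Finsupp.linearCombination ℂ e) := by
  rw [DenseRange, ← LinearMap.coe_range, Finsupp.range_linearCombination]
  exact h

section starHom

variable {E B : Type*} [NonUnitalCStarAlgebra E] [NonUnitalCStarAlgebra B]

/-- A continuous linear map that is multiplicative and ⋆-preserving on a total set is a
⋆-homomorphism. -/
def starHomOfDense (L : E →L[ℂ] B) (G : Set E) (hG : Dense (Submodule.span ℂ G : Set E))
    (hmul : ∀ x ∈ G, ∀ y ∈ G, L (x * y) = L x * L y) (hstar : ∀ x ∈ G, L (star x) = star (L x)) :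
    E →⋆ₙₐ[ℂ] B where
  toFun := L
  map_zero' := map_zero L
  map_add' := map_add L
  map_smul' := map_smul L
  map_mul' x y := by
    -- One variable at a time: the property in `x` is quantified over all `y`, and for `x` in the
    -- total set a second density argument treats `y`.
    refine dense_span_induction hG (P := fun x => ∀ y, L (x * y) = L x * L y) ?_ ?_ ?_ ?_ ?_ x y
    · rw [Set.ofPred_forall]
      exact isClosed_iInter fun y => isClosed_eq (by fun_prop) (by fun_prop)
    · intro x hx y
      refine dense_span_induction hG (P := fun y => L (x * y) = L x * L y)
        (isClosed_eq (by fun_prop) (by fun_prop)) (hmul x hx) (by simp) ?_ ?_ y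
      · intro y z hy hz; rw [mul_add, map_add, map_add, mul_add, hy, hz]
      · intro c y hy; rw [mul_smul_comm, map_smul, map_smul, mul_smul_comm, hy]
    · simp
    · intro x x' h h' y; rw [add_mul, map_add, map_add, add_mul, h, h']
    · intro c x h y; rw [smul_mul_assoc, map_smul, map_smul, smul_mul_assoc, h]
  map_star' x := by
    refine dense_span_induction hG (P := fun x => L (star x) = star (L x))
        (isClosed_eq (by fun_prop) (by fun_prop)) hstar (by simp) ?_ ?_ x
    · intro y z hy hz; rw [star_add, map_add, map_add, star_add, hy, hz]
    · intro c y hy; rw [star_smul, map_smul, map_smul, star_smul, hy]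

/-- A total family `e` and a family `f` with `f_i f_j^* = J(e_i e_j^*)` for a ⋆-homomorphism `J`
are related by a contraction. -/
theorem exists_extension_of_starHom {ι : Type*} {e : ι → E} {f : ι → B} (J : E →⋆ₙₐ[ℂ] B)
    (he : Dense (Submodule.span ℂ (Set.range e) : Set E))
    (h : ∀ i j, f i * star (f j) = J (e i * star (e j))) :
    ∃ L : E →L[ℂ] B, (∀ i, L (e i) = f i) ∧ ∀ x, ‖L x‖ ≤ ‖x‖ := by
  let e' := Finsupp.linearCombination ℂ e
  let f' := Finsupp.linearCombination ℂ f
  -- By the C⋆-identity, ‖f'c‖² = ‖J(e'c (e'c)^*)‖ ≤ ‖e'c‖². So `J` is needed only on the products e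
  -- e^*, and the map to be built need not be multiplicative.
  have key : ∀ c d, f' c * star (f' d) = J (e' c * star (e' d)) := by
    intro c d
    simp only [e', f', Finsupp.linearCombination_apply, Finsupp.sum, star_sum, Finset.sum_mul_sum,
      map_sum, star_smul, smul_mul_smul_comm, map_smul, h]
  have hn : ∀ c, ‖f' c‖ ≤ 1 * ‖e' c‖ := by
    intro c
    rw [one_mul]
    refine abs_le_of_sq_le_sq' ?_ (norm_nonneg _) |>.2
    rw [sq, sq, ← CStarRing.norm_self_mul_star, ← CStarRing.norm_self_mul_star, key]
    exact NonUnitalStarAlgHom.norm_apply_le J _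
  have hd := dense_range_linearCombination he
  refine ⟨f'.extendOfNorm e', fun i => ?_, fun x => ?_⟩
  · have := LinearMap.extendOfNorm_eq hd ⟨1, hn⟩ (Finsupp.single i 1)
    simpa [e', f'] using this
  · simpa using LinearMap.norm_extendOfNorm_apply_le hd 1 hn x

end starHom

/-! ## Projections and norm bounds in C⋆-algebras -/

section

variable {B : Type*} [NonUnitalCStarAlgebra B]

/-- Finitely many projections in a C⋆-algebra whose sum is a projection are mutually orthogonal. -/
theorem CStarAlgebra.projections_orthogonal {κ : Type*} [Fintype κ] {p : κ → B} {q : B}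
    (hp : ∀ i, star (p i) = p i) (hp' : ∀ i, p i * p i = p i) (hq : star q = q) (hq' : q * q = q)
    (hs : q = ∑ i, p i) {i j : κ} (hij : i ≠ j) : p i * p j = 0 := by
  classical
  let _ := CStarAlgebra.spectralOrder B
  have := CStarAlgebra.spectralOrderedRing B
  have hn : ‖q‖ ≤ 1 := TransitionSystem.norm_le_one_of_relations (p := q) (by rw [hq, hq']) hq hq'
  -- Since ‖q‖ ≤ 1, p_j q p_j ≤ p_j. But p_j q p_j is p_j plus the positive elements (p_k p_j)^*(p_k
  -- p_j) with k ≠ j, so all of these vanish.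
  have h1 : star (p j) * q * p j ≤ p j := by
    have h2 := CStarAlgebra.star_left_conjugate_le_norm_smul (a := p j) (b := q) hq
    refine h2.trans ?_
    rw [hp, hp']
    have h3 : 0 ≤ p j := by
      have := star_mul_self_nonneg (p j)
      rwa [hp, hp'] at this
    calc ‖q‖ • p j ≤ (1 : ℝ) • p j := smul_le_smul_of_nonneg_right hn h3
      _ = p j := one_smul _ _
  have h4 : star (p j) * q * p j = p j + ∑ k ∈ Finset.univ.erase j, star (p k * p j) * (p k * p j) := by
    rw [hs, Finset.mul_sum, Finset.sum_mul, ← Finset.add_sum_erase _ _ (Finset.mem_univ j)]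
    congr 1
    · rw [hp, hp', hp']
    · refine Finset.sum_congr rfl fun k _ => ?_
      rw [star_mul, hp k, mul_assoc, mul_assoc, ← mul_assoc (p k) (p k), hp']
  have h5 : ∑ k ∈ Finset.univ.erase j, star (p k * p j) * (p k * p j) ≤ 0 := by
    rw [h4] at h1
    simpa using h1
  have h6 : ∀ k ∈ Finset.univ.erase j, 0 ≤ star (p k * p j) * (p k * p j) :=
    fun k _ => star_mul_self_nonneg _
  have h7 := (Finset.sum_eq_zero_iff_of_nonneg h6).1 (le_antisymm h5 (Finset.sum_nonneg h6)) i
    (Finset.mem_erase.2 ⟨hij, Finset.mem_univ _⟩)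
  exact (CStarRing.star_mul_self_eq_zero_iff _).1 h7

/-- A bound up to a constant that is stable under squaring of selfadjoint elements holds with
constant `1`. -/
theorem norm_le_of_stable_under_squaring {P : B → ℝ → Prop} {C : ℝ}
    (hsa : ∀ k h, P k h → IsSelfAdjoint k) (hsq : ∀ k h, P k h → P (k * k) (h * h))
    (hC : ∀ k h, P k h → ‖k‖ ≤ C * h) {k : B} {h : ℝ} (hP : P k h) (hh : 0 ≤ h) : ‖k‖ ≤ h := by
  -- Squaring n times gives ‖k‖^(2^n) ≤ C h^(2^n), because ‖k²‖ = ‖k‖² for selfadjoint k. If ‖k‖ > h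
  -- > 0 the powers of ‖k‖/h are unbounded, which contradicts the fixed C; h = 0 is treated
  -- directly.
  have iter : ∀ n : ℕ, ∀ k h, P k h → ‖k‖ ^ 2 ^ n ≤ C * h ^ 2 ^ n := by
    intro n
    induction n with
    | zero => simpa using hC
    | succ n ih =>
      intro k h hP
      have h1 := ih _ _ (hsq k h hP)
      have h2 : ‖k * k‖ = ‖k‖ ^ 2 := by
        conv_lhs => rw [← (hsa k h hP).star_eq, (hsa k h hP).star_eq]
        rw [sq, ← CStarRing.norm_star_mul_self, (hsa k h hP).star_eq]
      rw [h2, ← sq, ← pow_mul, ← pow_mul, mul_comm 2, ← pow_succ] at h1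
      exact h1
  by_contra! hlt
  rcases hh.eq_or_lt with rfl | hpos
  · have := hC k 0 hP
    rw [mul_zero] at this
    exact absurd (this.trans_lt' hlt) (lt_irrefl _)
  · have hx : 1 < ‖k‖ / h := (one_lt_div hpos).2 hlt
    obtain ⟨n, hn⟩ := pow_unbounded_of_one_lt C hx
    have h3 := iter n k h hP
    have h4 : (‖k‖ / h) ^ 2 ^ n ≤ C := by
      rw [div_pow, div_le_iff₀ (by positivity)]
      exact h3
    have h5 : (‖k‖ / h) ^ n ≤ (‖k‖ / h) ^ 2 ^ n := pow_le_pow_right₀ hx.le Nat.lt_two_pow_self.le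
    linarith

end

/-! ## Matrix units -/

/-- Matrix units `e_{ij}`, indexed by the pairs in an equivalence relation `R`. -/
structure IsMatrixUnits {I : Type*} (R : I → I → Prop) {B : Type*} [NonUnitalCStarAlgebra B]
    (e : I → I → B) : Prop where
  star_eq : ∀ i j, R i j → star (e i j) = e j i
  mul_eq : ∀ i j k, R i j → R j k → e i j * e j k = e i k
  mul_ne : ∀ i j k l, R i j → R k l → j ≠ k → e i j * e k l = 0

namespace IsMatrixUnits

variable {I : Type*} {R : I → I → Prop} {E B : Type*} [NonUnitalCStarAlgebra E]
  [NonUnitalCStarAlgebra B] {e : I → I → E} {f : I → I → B}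

/-- The graph of the linear map `e_{ij} ↦ f_{ij}` on finite matrices. -/
def graph (R : I → I → Prop) (e : I → I → E) (f : I → I → B) (S : Set I) : Submodule ℂ (E × B) :=
  Submodule.span ℂ {x | ∃ i ∈ S, ∃ j ∈ S, R i j ∧ x = (e i j, f i j)}

theorem graph_mul (hR : Equivalence R) (he : IsMatrixUnits R e) (hf : IsMatrixUnits R f) {S : Set I}
    {x y : E × B} (hx : x ∈ graph R e f S) (hy : y ∈ graph R e f S) : x * y ∈ graph R e f S := by
  classical
  induction hx using Submodule.span_induction with
  | zero => rw [zero_mul]; exact zero_mem _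
  | add x x' _ _ h h' => rw [add_mul]; exact add_mem h h'
  | smul c x _ h => rw [smul_mul_assoc]; exact Submodule.smul_mem _ c h
  | mem x hx =>
    obtain ⟨i, hi, j, hj, hij, rfl⟩ := hx
    induction hy using Submodule.span_induction with
    | zero => rw [mul_zero]; exact zero_mem _
    | add x x' _ _ h h' => rw [mul_add]; exact add_mem h h'
    | smul c x _ h => rw [mul_smul_comm]; exact Submodule.smul_mem _ c h
    | mem y hy =>
      obtain ⟨k, hk, l, hl, hkl, rfl⟩ := hy
      rw [Prod.mk_mul_mk]
      by_cases hjk : j = k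
      · subst hjk
        rw [he.mul_eq i j l hij hkl, hf.mul_eq i j l hij hkl]
        exact Submodule.subset_span ⟨i, hi, l, hl, hR.trans hij hkl, rfl⟩
      · rw [he.mul_ne i j k l hij hkl hjk, hf.mul_ne i j k l hij hkl hjk]
        exact zero_mem _

theorem graph_star (hR : Equivalence R) (he : IsMatrixUnits R e) (hf : IsMatrixUnits R f) {S : Set I}
    {x : E × B} (hx : x ∈ graph R e f S) : star x ∈ graph R e f S := by
  induction hx using Submodule.span_induction with
  | zero => rw [star_zero]; exact zero_mem _
  | add x x' _ _ h h' => rw [star_add]; exact add_mem h h'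
  | smul c x _ h => rw [star_smul]; exact Submodule.smul_mem _ _ h
  | mem x hx =>
    obtain ⟨i, hi, j, hj, hij, rfl⟩ := hx
    refine Submodule.subset_span ⟨j, hj, i, hi, hR.symm hij, ?_⟩
    exact Prod.ext (he.star_eq i j hij) (hf.star_eq i j hij)

/-- Multiplying a vanishing combination of the e_{kl} by e_{ii} on the left and by e_{jj} on the
right isolates the coefficient of e_{ij}, which is zero because e_{ij} ≠ 0. So the span is indeed
the graph of a map. -/
theorem eq_zero_of_mem_graph (hR : Equivalence R) (he : IsMatrixUnits R e)
    (h0 : ∀ i j, R i j → e i j ≠ 0) {S : Set I} {x : E × B} (hx : x ∈ graph R e f S)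
    (hx0 : x.1 = 0) : x = 0 := by
  classical
  rw [graph, Finsupp.mem_span_iff_linearCombination] at hx
  obtain ⟨c, rfl⟩ := hx
  suffices c = 0 by rw [this, map_zero]
  ext ⟨_, hp⟩
  obtain ⟨i, hi, j, hj, hij, rfl⟩ := id hp
  rw [Finsupp.linearCombination_apply, Finsupp.sum, Prod.fst_sum] at hx0
  have h1 := congrArg (fun z => e i i * z * e j j) hx0
  simp only [Finset.mul_sum, Finset.sum_mul, mul_zero, zero_mul] at h1
  rw [Finset.sum_eq_single ⟨_, hp⟩] at h1
  · simp only [Prod.smul_fst, mul_smul_comm, smul_mul_assoc] at h1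
    rw [he.mul_eq i i j (hR.refl i) hij, he.mul_eq i j j hij (hR.refl j)] at h1
    simpa [h0 i j hij] using h1
  · rintro ⟨_, hq⟩ - hne
    obtain ⟨k, hk, l, hl, hkl, rfl⟩ := id hq
    simp only [Prod.smul_fst, mul_smul_comm, smul_mul_assoc]
    by_cases hik : i = k
    · subst hik
      by_cases hlj : l = j
      · subst hlj; exact absurd rfl hne
      · rw [he.mul_eq i i l (hR.refl i) hkl, he.mul_ne i l j j hkl (hR.refl j) hlj, smul_zero]
    · rw [he.mul_ne i i k l (hR.refl i) hkl hik, zero_mul, smul_zero]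
  · intro h
    rw [Finsupp.notMem_support_iff.1 h]
    simp

/-- For finite `S` the graph is finite-dimensional and projects injectively to the first factor, so
the second coordinate is bounded by some constant times the first. For selfadjoint elements squaring
improves the constant to 1; the general case is applied to x x^*. -/
theorem norm_le_of_mem_graph (hR : Equivalence R) (he : IsMatrixUnits R e) (hf : IsMatrixUnits R f)
    (h0 : ∀ i j, R i j → e i j ≠ 0) {S : Set I} (hS : S.Finite) {x : E × B}
    (hx : x ∈ graph R e f S) : ‖x.2‖ ≤ ‖x.1‖ := by
  have hfin : {x : E × B | ∃ i ∈ S, ∃ j ∈ S, R i j ∧ x = (e i j, f i j)}.Finite := by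
    refine ((hS.prod hS).image fun p : I × I => (e p.1 p.2, f p.1 p.2)).subset ?_
    rintro _ ⟨i, hi, j, hj, -, rfl⟩
    exact ⟨(i, j), ⟨hi, hj⟩, rfl⟩
  have : FiniteDimensional ℂ (graph R e f S) := FiniteDimensional.span_of_finite ℂ hfin
  let π : graph R e f S →ₗ[ℂ] E := (LinearMap.fst ℂ E B).comp (graph R e f S).subtype
  have hπ : LinearMap.ker π = ⊥ := by
    rw [LinearMap.ker_eq_bot']
    exact fun y hy => Subtype.ext (eq_zero_of_mem_graph hR he h0 y.2 hy)
  obtain ⟨K, -, hK⟩ := LinearMap.exists_antilipschitzWith π hπ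
  have main : ‖x.2 * star x.2‖ ≤ ‖x.1 * star x.1‖ := by
    refine norm_le_of_stable_under_squaring (C := K)
      (P := fun k h => ∃ y ∈ graph R e f S, IsSelfAdjoint y ∧ k = y.2 ∧ h = ‖y.1‖)
      ?_ ?_ ?_ ⟨x * star x, graph_mul hR he hf hx (graph_star hR he hf hx), ?_, rfl, rfl⟩
      (norm_nonneg _)
    · rintro _ _ ⟨y, -, hy, rfl, rfl⟩
      exact congrArg Prod.snd hy
    · rintro _ _ ⟨y, hy, hs, rfl, rfl⟩
      refine ⟨y * y, graph_mul hR he hf hy hy, ?_, rfl, ?_⟩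
      · rw [isSelfAdjoint_iff, star_mul, hs.star_eq]
      · have h1 : star y.1 = y.1 := congrArg Prod.fst hs
        rw [Prod.fst_mul, ← CStarRing.norm_star_mul_self, h1]
    · rintro _ _ ⟨y, hy, -, rfl, rfl⟩
      have h2 := hK.le_mul_dist ⟨y, hy⟩ 0
      rw [dist_zero_right, map_zero, dist_zero_right] at h2
      exact (norm_snd_le y).trans h2
    · rw [isSelfAdjoint_iff, star_mul, star_star]
  rw [CStarRing.norm_self_mul_star, CStarRing.norm_self_mul_star] at main
  exact abs_le_of_sq_le_sq' (by rwa [sq, sq]) (norm_nonneg _) |>.2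

/-- A C⋆-algebra spanned by nonzero matrix units is universal for them. -/
theorem exists_starHom (hR : Equivalence R) (he : IsMatrixUnits R e) (hf : IsMatrixUnits R f)
    (h0 : ∀ i j, R i j → e i j ≠ 0)
    (hd : Dense (Submodule.span ℂ {x | ∃ i j, R i j ∧ x = e i j} : Set E)) :
    ∃ φ : E →⋆ₙₐ[ℂ] B, ∀ i j, R i j → φ (e i j) = f i j := by
  classical
  let ι := {p : I × I // R p.1 p.2}
  let e' := Finsupp.linearCombination ℂ fun p : ι => e p.1.1 p.1.2
  let f' := Finsupp.linearCombination ℂ fun p : ι => f p.1.1 p.1.2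
  have hrange : {x | ∃ i j, R i j ∧ x = e i j} = Set.range fun p : ι => e p.1.1 p.1.2 := by
    ext x
    constructor
    · rintro ⟨i, j, h, rfl⟩; exact ⟨⟨(i, j), h⟩, rfl⟩
    · rintro ⟨⟨⟨i, j⟩, h⟩, rfl⟩; exact ⟨i, j, h, rfl⟩
  have hn : ∀ c, ‖f' c‖ ≤ 1 * ‖e' c‖ := by
    intro c
    rw [one_mul]
    -- All row and column indices that occur in `c`.
    let S : Set I := (c.support.image fun p => p.1.1) ∪ (c.support.image fun p => p.1.2)
    refine norm_le_of_mem_graph (x := (e' c, f' c)) hR he hf h0 (S := S)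
      ((Finset.finite_toSet _).union (Finset.finite_toSet _)) ?_
    have : (e' c, f' c) = ∑ p ∈ c.support, c p • (e p.1.1 p.1.2, f p.1.1 p.1.2) := by
      refine Prod.ext ?_ ?_
      · rw [Prod.fst_sum]; rfl
      · rw [Prod.snd_sum]; rfl
    rw [this]
    refine sum_mem fun p hp => Submodule.smul_mem _ _ (Submodule.subset_span ?_)
    exact ⟨_, Or.inl (Finset.mem_image_of_mem (fun p : ι => p.1.1) hp), _,
      Or.inr (Finset.mem_image_of_mem (fun p : ι => p.1.2) hp), p.2, rfl⟩
  rw [hrange] at hd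
  have hdr := dense_range_linearCombination hd
  let L := f'.extendOfNorm e'
  have hL : ∀ i j, R i j → L (e i j) = f i j := fun i j h => by
    have := LinearMap.extendOfNorm_eq hdr ⟨1, hn⟩ (Finsupp.single ⟨(i, j), h⟩ 1)
    simpa [e', f'] using this
  refine ⟨starHomOfDense L _ hd ?_ ?_, hL⟩
  · rintro _ ⟨⟨⟨i, j⟩, hij⟩, rfl⟩ _ ⟨⟨⟨k, l⟩, hkl⟩, rfl⟩
    dsimp only at hij hkl ⊢
    by_cases hjk : j = k
    · subst hjk
      rw [he.mul_eq i j l hij hkl, hL _ _ hij, hL _ _ hkl, hf.mul_eq i j l hij hkl,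
        hL _ _ (hR.trans hij hkl)]
    · rw [he.mul_ne i j k l hij hkl hjk, hL _ _ hij, hL _ _ hkl, hf.mul_ne i j k l hij hkl hjk,
        map_zero]
  · rintro _ ⟨⟨⟨i, j⟩, hij⟩, rfl⟩
    dsimp only at hij ⊢
    rw [he.star_eq i j hij, hL _ _ hij, hL _ _ (hR.symm hij), hf.star_eq i j hij]

end IsMatrixUnits

/-! ## Approximation of compact operators by matrices -/

section compact

variable {H : Type*} [NormedAddCommGroup H] [InnerProductSpace ℂ H] [CompleteSpace H]

open InnerProductSpace in
/-- The projection onto the span of finitely many basis vectors. -/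
def HilbertBasis.cutoff {ι : Type*} (b : HilbertBasis ι ℂ H) (F : Finset ι) : H →L[ℂ] H :=
  ∑ i ∈ F, rankOne ℂ (b i) (b i)

theorem HilbertBasis.cutoff_apply {ι : Type*} (b : HilbertBasis ι ℂ H) (F : Finset ι) (x : H) :
    b.cutoff F x = ∑ i ∈ F, inner ℂ (b i) x • b i := by
  simp [cutoff, sum_apply]

theorem HilbertBasis.star_cutoff {ι : Type*} (b : HilbertBasis ι ℂ H) (F : Finset ι) :
    star (b.cutoff F) = b.cutoff F := by
  simp [cutoff, star_sum, ContinuousLinearMap.star_eq_adjoint]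

theorem HilbertBasis.cutoff_mul_self {ι : Type*} (b : HilbertBasis ι ℂ H) (F : Finset ι) :
    b.cutoff F * b.cutoff F = b.cutoff F := by
  classical
  ext x
  rw [mul_apply_eq_comp, cutoff_apply, cutoff_apply]
  refine Finset.sum_congr rfl fun i hi => ?_
  congr 1
  simp only [inner_sum, inner_smul_right, orthonormal_iff_ite.1 b.orthonormal]
  simp [hi]

theorem HilbertBasis.norm_cutoff_le {ι : Type*} (b : HilbertBasis ι ℂ H) (F : Finset ι) :
    ‖b.cutoff F‖ ≤ 1 := by
  have h : ‖b.cutoff F‖ * ‖b.cutoff F‖ = ‖b.cutoff F‖ := by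
    rw [← CStarRing.norm_star_mul_self, b.star_cutoff, b.cutoff_mul_self]
  nlinarith [norm_nonneg (b.cutoff F)]

/-- The image of the unit ball has a finite ε/3-net. The cutoffs converge strongly to 1, so one of
them is good on the whole net, and, having norm at most 1, it is good on the whole image. -/
theorem HilbertBasis.exists_cutoff_mul {ι : Type*} (b : HilbertBasis ι ℂ H) {x : H →L[ℂ] H}
    (hx : IsCompactOperator x) {ε : ℝ} (hε : 0 < ε) : ∃ F, ‖b.cutoff F * x - x‖ ≤ ε := by
  classical
  have htb : TotallyBounded (x '' Metric.closedBall 0 1) :=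
    (IsCompactOperator.isCompact_closure_image_closedBall (f := x.toLinearMap) hx
      1).totallyBounded.subset
      subset_closure
  obtain ⟨t, ht, hcov⟩ := Metric.totallyBounded_iff.1 htb (ε / 3) (by positivity)
  have hF : ∀ y : H, ∃ F : Finset ι, ∀ F', F ⊆ F' → ‖b.cutoff F' y - y‖ < ε / 3 := by
    intro y
    have h1 := b.hasSum_repr y
    simp only [HilbertBasis.repr_apply_apply] at h1
    have h2 := (Metric.tendsto_atTop.1 h1) (ε / 3) (by positivity)
    obtain ⟨F, hF⟩ := h2
    exact ⟨F, fun F' h => by rw [b.cutoff_apply, ← dist_eq_norm]; exact hF F' h⟩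
  choose F hF using hF
  refine ⟨ht.toFinset.biUnion F, ContinuousLinearMap.opNorm_le_of_unit_norm hε.le fun z hz => ?_⟩
  obtain ⟨y, hy, hxy⟩ := Set.mem_iUnion₂.1 (hcov ⟨z, by simp [hz], rfl⟩)
  rw [Metric.mem_ball, dist_eq_norm] at hxy
  set P := b.cutoff (ht.toFinset.biUnion F)
  have h3 : ‖P y - y‖ < ε / 3 := hF y _ (Finset.subset_biUnion_of_mem F (ht.mem_toFinset.2 hy))
  have h4 : ‖P (x z - y)‖ ≤ ‖x z - y‖ := by
    refine (P.le_opNorm _).trans ?_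
    exact mul_le_of_le_one_left (norm_nonneg _) (b.norm_cutoff_le _)
  have h5 : (P * x - x) z = P (x z - y) + (P y - y) - (x z - y) := by
    rw [sub_apply, mul_apply_eq_comp, map_sub]; abel
  rw [h5]
  calc _ ≤ ‖P (x z - y)‖ + ‖P y - y‖ + ‖x z - y‖ :=
        (norm_sub_le _ _).trans (by gcongr; exact norm_add_le _ _)
    _ ≤ ε := by linarith

theorem HilbertBasis.exists_mul_cutoff {ι : Type*} (b : HilbertBasis ι ℂ H) {x : H →L[ℂ] H}
    (hx : IsCompactOperator (star x : H →L[ℂ] H)) {ε : ℝ} (hε : 0 < ε) :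
    ∃ F, ‖x * b.cutoff F - x‖ ≤ ε := by
  obtain ⟨F, hF⟩ := b.exists_cutoff_mul hx hε
  refine ⟨F, ?_⟩
  rw [← norm_star, star_sub, star_mul, b.star_cutoff]
  exact hF

open InnerProductSpace in
/-- A compact operator is a limit of finite matrices with respect to two orthonormal bases. -/
theorem HilbertBasis.mem_closure_span_rankOne {ι κ : Type*} (b : HilbertBasis ι ℂ H)
    (c : HilbertBasis κ ℂ H) {R : ι → κ → Prop} {x : H →L[ℂ] H} (hx : IsCompactOperator x)
    (hx' : IsCompactOperator (star x : H →L[ℂ] H)) (hR : ∀ i j, ¬ R i j → inner ℂ (b i) (x (c j)) = 0) :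
    x ∈ closure (Submodule.span ℂ {y | ∃ i j, R i j ∧ y = rankOne ℂ (b i) (c j)} :
      Set (H →L[ℂ] H)) := by
  rw [Metric.mem_closure_iff]
  intro ε hε
  obtain ⟨F, hF⟩ := b.exists_cutoff_mul hx (ε := ε / 3) (by positivity)
  obtain ⟨G, hG⟩ := c.exists_mul_cutoff hx' (ε := ε / 3) (by positivity)
  -- The compression of `x` is the finite matrix of its entries between the two bases, and `hR`
  -- deletes the entries outside `R`.
  refine ⟨b.cutoff F * x * c.cutoff G, ?_, ?_⟩
  · have : b.cutoff F * x * c.cutoff G = ∑ i ∈ F, ∑ j ∈ G,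
        inner ℂ (b i) (x (c j)) • rankOne ℂ (b i) (c j) := by
      ext z
      rw [mul_apply_eq_comp, mul_apply_eq_comp, c.cutoff_apply, b.cutoff_apply]
      simp only [sum_apply, smul_apply, rankOne_apply, map_sum, map_smul, inner_sum,
        inner_smul_right, Finset.sum_smul, smul_smul]
      refine Finset.sum_congr rfl fun i _ => Finset.sum_congr rfl fun j _ => ?_
      rw [mul_comm]
    rw [this]
    refine sum_mem fun i _ => sum_mem fun j _ => ?_
    by_cases h : R i j
    · exact Submodule.smul_mem _ _ (Submodule.subset_span ⟨i, j, h, rfl⟩)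
    · rw [hR i j h, zero_smul]; exact zero_mem _
  · rw [dist_eq_norm, ← norm_neg, neg_sub]
    have h1 : b.cutoff F * x * c.cutoff G - x
        = b.cutoff F * (x * c.cutoff G - x) + (b.cutoff F * x - x) := by
      rw [mul_sub, mul_assoc]; abel
    rw [h1]
    have h2 : ‖b.cutoff F * (x * c.cutoff G - x)‖ ≤ ε / 3 := (norm_mul_le _ _).trans
      ((mul_le_of_le_one_left (norm_nonneg _) (b.norm_cutoff_le F)).trans hG)
    linarith [norm_add_le (b.cutoff F * (x * c.cutoff G - x)) (b.cutoff F * x - x)]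

end compact

/-! ### Density of the span of the generators of a universal algebra -/

namespace CStarRelations

/-- If the products and adjoints of generators are linear combinations of generators, then the
generators span a dense subspace of the universal C⋆-algebra. -/
theorem Univ.dense_span_gen {X : Type u} {R : CStarRelations X}
    (hmul : ∀ x y : X, (gen x * gen y : R.Univ) ∈ Submodule.span ℂ (Set.range (gen (R := R))))
    (hstar : ∀ x : X, (star (gen x) : R.Univ) ∈ Submodule.span ℂ (Set.range (gen (R := R)))) :
    Dense (Submodule.span ℂ (Set.range (gen (R := R))) : Set R.Univ) := by
  set V := Submodule.span ℂ (Set.range (gen (R := R)))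
  have hmul' : ∀ a ∈ V, ∀ b ∈ V, a * b ∈ V := by
    intro a ha b hb
    induction ha using Submodule.span_induction with
    | zero => rw [zero_mul]; exact zero_mem _
    | add x x' _ _ h h' => rw [add_mul]; exact add_mem h h'
    | smul c x _ h => rw [smul_mul_assoc]; exact Submodule.smul_mem _ c h
    | mem x hx =>
      obtain ⟨x, rfl⟩ := hx
      induction hb using Submodule.span_induction with
      | zero => rw [mul_zero]; exact zero_mem _
      | add x x' _ _ h h' => rw [mul_add]; exact add_mem h h'
      | smul c x _ h => rw [mul_smul_comm]; exact Submodule.smul_mem _ c h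
      | mem y hy => obtain ⟨y, rfl⟩ := hy; exact hmul x y
  have hstar' : ∀ a ∈ V, star a ∈ V := by
    intro a ha
    induction ha using Submodule.span_induction with
    | zero => rw [star_zero]; exact zero_mem _
    | add x x' _ _ h h' => rw [star_add]; exact add_mem h h'
    | smul c x _ h => rw [star_smul]; exact Submodule.smul_mem _ _ h
    | mem x hx => obtain ⟨x, rfl⟩ := hx; exact hstar x
  -- The span is now a ⋆-subalgebra that contains the generators, hence contains the classes of all
  -- ⋆-polynomials, and these are dense in the completion.
  have key : ∀ p : StarPoly X, ofPoly (Poly.mk R p) ∈ V := by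
    intro p
    induction p with
    | gen x => exact Submodule.subset_span ⟨x, rfl⟩
    | zero => exact zero_mem V
    | add p q hp hq =>
      have e : Poly.mk R (p.add q) = Poly.mk R p + Poly.mk R q := rfl
      rw [e, ofPoly_add]; exact add_mem hp hq
    | neg p hp =>
      have e : Poly.mk R p.neg = (-1 : ℂ) • Poly.mk R p := by rw [neg_one_smul]; rfl
      rw [e, ofPoly_smul]; exact V.smul_mem _ hp
    | smul c p hp =>
      have e : Poly.mk R (StarPoly.smul c p) = c • Poly.mk R p := rfl
      rw [e, ofPoly_smul]; exact V.smul_mem _ hp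
    | mul p q hp hq =>
      have e : Poly.mk R (p.mul q) = Poly.mk R p * Poly.mk R q := rfl
      rw [e, ofPoly_mul]; exact hmul' _ hp _ hq
    | star p hp =>
      have e : Poly.mk R p.star = Star.star (Poly.mk R p) := rfl
      rw [e, ofPoly_star]; exact hstar' _ hp
  refine ofPoly_isDenseInducing.dense.mono ?_
  rintro _ ⟨p, rfl⟩
  exact Quotient.inductionOn p key

end CStarRelations

namespace TransitionSystem

variable {r : ℕ} {A : Type u} {T : TransitionSystem r A}

/-! ## Decorated words -/

section

variable {D : Type u} {δ : D → A}

namespace DecoratedWord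

theorem ext_of {u v : T.DecoratedWord δ} (hd : u.deco = v.deco) (hw : u.word = v.word) : u = v := by
  obtain ⟨d, w, h⟩ := u
  obtain ⟨d', w', h'⟩ := v
  obtain rfl : d = d' := hd
  obtain rfl : w = w' := hw
  rfl

theorem mul_assoc' {u : T.DecoratedWord δ} {v w : T.Word} (h : u.t = v.o)
    (h' : (u.mul v h).t = w.o) (h1 : v.t = w.o) (h2 : u.t = (v.mul w h1).o) :
    (u.mul v h).mul w h' = u.mul (v.mul w h1) h2 :=
  ext_of rfl (Word.mul_assoc' h h' h1 h2)

theorem mul_letter (u : T.DecoratedWord δ) {a : A} (h : u.t = a) :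
    u.mul (Word.letter T a) h = u :=
  ext_of rfl (Word.mul_letter _ h)

theorem mul_inj {u u' : T.DecoratedWord δ} {v v' : T.Word} {h : u.t = v.o} {h' : u'.t = v'.o}
    (e : u.mul v h = u'.mul v' h') (hs : u.shape = u'.shape) : u = u' ∧ v = v' := by
  obtain ⟨h1, h2⟩ := Word.mul_inj (h := h) (h' := h') (congrArg DecoratedWord.word e) hs
  have h3 := congrArg DecoratedWord.deco e
  exact ⟨ext_of h3 h1, h2⟩

theorem exists_mul (x : T.DecoratedWord δ) {m n : Fin r → ℕ} (hx : x.shape = m + n) :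
    ∃ (u : T.DecoratedWord δ) (v : T.Word) (h : u.t = v.o),
      u.shape = m ∧ v.shape = n ∧ x = u.mul v h := by
  obtain ⟨u, v, h, hu, hv, e⟩ := x.word.exists_mul hx
  refine ⟨⟨x.deco, u, ?_⟩, v, h, hu, hv, ext_of rfl e⟩
  rw [← x.o_eq, e, Word.mul_o]

end DecoratedWord

namespace CKIndex

/-- The common terminus of a pair of decorated words. -/
def t (i : T.CKIndex δ) : A := i.fst.t

/-- The extension `(uw, vw)` of a pair `(u, v)`. -/
def ext (i : T.CKIndex δ) (w : T.Word) (h : i.t = w.o) : T.CKIndex δ :=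
  ⟨i.fst.mul w h, i.snd.mul w (i.t_eq.symm.trans h),
    (DecoratedWord.mul_t _ _ _).trans (DecoratedWord.mul_t _ _ _).symm⟩

/-- The degree of a pair, the difference of the shapes. -/
def deg (i : T.CKIndex δ) : Fin r → ℤ := fun k => (i.fst.shape k : ℤ) - i.snd.shape k

/-- The flipped pair. -/
def flip (i : T.CKIndex δ) : T.CKIndex δ := ⟨i.snd, i.fst, i.t_eq.symm⟩

@[simp] theorem deg_flip (i : T.CKIndex δ) : i.flip.deg = -i.deg := by
  funext k; simp [deg, flip]

theorem ext_t (i : T.CKIndex δ) (w : T.Word) (h : i.t = w.o) : (i.ext w h).t = w.t :=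
  DecoratedWord.mul_t _ _ _

@[simp] theorem ext_fst_shape (i : T.CKIndex δ) (w : T.Word) (h : i.t = w.o) :
    (i.ext w h).fst.shape = i.fst.shape + w.shape := rfl

@[simp] theorem ext_snd_shape (i : T.CKIndex δ) (w : T.Word) (h : i.t = w.o) :
    (i.ext w h).snd.shape = i.snd.shape + w.shape := rfl

@[simp] theorem deg_ext (i : T.CKIndex δ) (w : T.Word) (h : i.t = w.o) :
    (i.ext w h).deg = i.deg := by
  funext k; simp [deg]

theorem ext_eq {i k : T.CKIndex δ} (h1 : i.fst = k.fst) (h2 : i.snd = k.snd) : i = k := by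
  obtain ⟨u, v, h⟩ := i
  obtain ⟨u', v', h'⟩ := k
  obtain rfl : u = u' := h1
  obtain rfl : v = v' := h2
  rfl

theorem ext_ext (i : T.CKIndex δ) (v w : T.Word) (h : i.t = v.o) (h' : (i.ext v h).t = w.o)
    (h1 : v.t = w.o) (h2 : i.t = (v.mul w h1).o) :
    (i.ext v h).ext w h' = i.ext (v.mul w h1) h2 :=
  ext_eq (DecoratedWord.mul_assoc' _ _ _ _) (DecoratedWord.mul_assoc' _ _ _ _)

theorem ext_letter (i : T.CKIndex δ) : i.ext (Word.letter T i.t) (Word.letter_o _).symm = i :=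
  ext_eq (DecoratedWord.mul_letter _ _) (DecoratedWord.mul_letter _ _)

/-- The product of the pairs `(u, v)` and `(v, w)` is `(u, w)`. -/
def comp (i k : T.CKIndex δ) (h : i.snd = k.fst) : T.CKIndex δ :=
  ⟨i.fst, k.snd, by rw [i.t_eq, h, k.t_eq]⟩

open scoped Classical in
/-- The value of a family at the product of two pairs, `0` if the product is not defined. -/
def compVal {M : Type*} [Zero M] (K : T.CKIndex δ → M) (i k : T.CKIndex δ) : M :=
  if h : i.snd = k.fst then K (i.comp k h) else 0

end CKIndex

/-! ### The sum rule and the expansion of products -/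

theorem sum_from_congr [Finite A] {M : Type*} [AddCommMonoid M] {l l' : Fin r → ℕ} {a b : A}
    (hl : l = l') (h : a = b) (F : ∀ w : T.Word, a = w.o → M) :
    ∑ w : T.From l a, F w.wd w.o_eq = ∑ w : T.From l' b, F w.wd (h.trans w.o_eq) := by
  subst h; subst hl; rfl

/-- The sum rule for families indexed by pairs of decorated words. -/
def IsSummable [Finite A] {M : Type*} [AddCommMonoid M] (F : T.CKIndex δ → M) : Prop :=
  ∀ (i : T.CKIndex δ) (l : Fin r → ℕ), F i = ∑ w : T.From l i.t, F (i.ext w.wd w.o_eq)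

/-- Every word is a product of words of unit shapes, so the rule for unit shapes iterates. -/
theorem isSummable_of_unit [Finite A] {M : Type*} [AddCommMonoid M] {F : T.CKIndex δ → M}
    (h : ∀ i (j : Fin r), F i = ∑ w : T.From (unitShape j) i.t, F (i.ext w.wd w.o_eq)) :
    IsSummable F := by
  intro i l
  induction l using shape_induction generalizing i with
  | h0 =>
    rw [sum_from_zero i.t (fun w hw => F (i.ext w hw)), CKIndex.ext_letter]
  | h j m ih =>
    rw [sum_from_add (unitShape j) m i.t (fun w hw => F (i.ext w hw)), h i j]
    refine Finset.sum_congr rfl fun w _ => ?_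
    rw [ih, sum_from_congr rfl (i.ext_t w.wd w.o_eq) (fun w' hw' => F ((i.ext w.wd w.o_eq).ext w' hw'))]
    refine Finset.sum_congr rfl fun w' _ => ?_
    rw [CKIndex.ext_ext _ _ _ _ _ w'.o_eq]

/-- The expansion of the product of the values of a family at two pairs. -/
def mulSum [Finite A] {M : Type*} [AddCommMonoid M] (K : T.CKIndex δ → M) (i k : T.CKIndex δ) : M :=
  ∑ w : T.From k.fst.shape i.t, ∑ w' : T.From i.snd.shape k.t,
    CKIndex.compVal K (i.ext w.wd w.o_eq) (k.ext w'.wd w'.o_eq)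

/-- Extending a pair keeps its degree and composition adds degrees, so all terms lie in degree
`i.deg + k.deg`. A map that carries `K` to `K'` in this one degree therefore carries one expansion
to the other. -/
theorem mulSum_eq [Finite A] {M M' : Type*} [AddCommMonoid M] [AddCommMonoid M'] (L : M →+ M')
    (K : T.CKIndex δ → M) (K' : T.CKIndex δ → M') (i k : T.CKIndex δ)
    (h : ∀ x : T.CKIndex δ, x.deg = i.deg + k.deg → L (K x) = K' x) :
    L (mulSum K i k) = mulSum K' i k := by
  simp only [mulSum, map_sum]
  refine Finset.sum_congr rfl fun w _ => Finset.sum_congr rfl fun w' _ => ?_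
  unfold CKIndex.compVal
  split_ifs with hc
  · refine h _ ?_
    rw [← CKIndex.deg_ext i w.wd w.o_eq, ← CKIndex.deg_ext k w'.wd w'.o_eq]
    funext a
    simp only [CKIndex.deg, CKIndex.comp, Pi.add_apply, hc]
    ring
  · exact map_zero L

/-- Both factors are expanded by the sum rule until the inner words have the common shape
`i.snd.shape + k.fst.shape`; there each product is either a single value or zero. A general
biadditive `μ` is allowed so that this covers the product of a C⋆-algebra as well as the twisted
product x ρ_g(y) on ℰ. -/
theorem biadditive_eq_mulSum [Finite A] {M M' N : Type*} [AddCommMonoid M] [AddCommMonoid M']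
    [AddCommMonoid N] (μ : M →+ M' →+ N) {F : T.CKIndex δ → M} {G : T.CKIndex δ → M'}
    (K : T.CKIndex δ → N) (hF : IsSummable F) (hG : IsSummable G) (i k : T.CKIndex δ)
    (h : ∀ x y : T.CKIndex δ, x.deg = i.deg → y.deg = k.deg → x.snd.shape = y.fst.shape →
      μ (F x) (G y) = CKIndex.compVal K x y) :
    μ (F i) (G k) = mulSum K i k := by
  rw [hF i k.fst.shape, hG k i.snd.shape]
  simp only [mulSum, map_sum, AddMonoidHom.finsetSum_apply]
  rw [Finset.sum_comm]
  refine Finset.sum_congr rfl fun w _ => Finset.sum_congr rfl fun w' _ => ?_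
  exact h _ _ (CKIndex.deg_ext _ _ _) (CKIndex.deg_ext _ _ _) (add_comm _ _)

/-! ## Cuntz-Krieger families -/

namespace IsCKFamily

variable [Finite A] {B : Type u} [NonUnitalCStarAlgebra B] {S : T.CKIndex δ → B}

theorem star_apply (hS : T.IsCKFamily δ S) (i : T.CKIndex δ) : star (S i) = S i.flip :=
  hS.star_eq _ _ _

theorem isSummable (hS : T.IsCKFamily δ S) : IsSummable S :=
  isSummable_of_unit fun i j => hS.sum_eq i.fst i.snd i.t_eq j

/-- The projection `s_{u,u}`. -/
abbrev _root_.TransitionSystem.diag (T : TransitionSystem r A) {D : Type u} {δ : D → A}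
    (u : T.DecoratedWord δ) : T.CKIndex δ := ⟨u, u, rfl⟩

/-- The projection of `u` is the sum of the projections of its one-step extensions; a sum of
projections that is a projection has orthogonal summands, all of them below the sum. -/
theorem diag_extend (hS : T.IsCKFamily δ S) (u : T.DecoratedWord δ) (j : Fin r) :
    (∀ (w : T.From (unitShape j) u.t), S (T.diag u) * S (T.diag (u.mul w.wd w.o_eq)) =
      S (T.diag (u.mul w.wd w.o_eq))) ∧
    ∀ (w w' : T.From (unitShape j) u.t), w ≠ w' →
      S (T.diag (u.mul w.wd w.o_eq)) * S (T.diag (u.mul w'.wd w'.o_eq)) = 0 := by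
  let p : T.From (unitShape j) u.t → B := fun w => S (T.diag (u.mul w.wd w.o_eq))
  have hp : ∀ i, star (p i) = p i := fun i => hS.star_eq _ _ _
  have hp' : ∀ i, p i * p i = p i := fun i => hS.mul_eq _ _ _ _ _
  have hs : S (T.diag u) = ∑ i, p i := hS.isSummable (T.diag u) (unitShape j)
  have ho : ∀ {i k}, i ≠ k → p i * p k = 0 := fun hik =>
    CStarAlgebra.projections_orthogonal hp hp' (hS.star_eq u u rfl) (hS.mul_eq u u u rfl rfl) hs hik
  refine ⟨fun w => ?_, fun w w' hw => ho hw⟩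
  change _ * p w = p w
  rw [hs, Finset.sum_mul, Fintype.sum_eq_single w fun i hi => ho hi, hp']

/-- The projections of distinct decorated words of the same shape are orthogonal. -/
theorem diag_mul_diag (hS : T.IsCKFamily δ S) (m : Fin r → ℕ) : ∀ u v : T.DecoratedWord δ,
    u.shape = m → v.shape = m → u ≠ v → S (T.diag u) * S (T.diag v) = 0 := by
  induction m using shape_induction with
  | h0 => exact fun u v hu hv h => hS.orthogonal u v hu hv h
  | h j m ih =>
    intro u v hu hv huv
    rw [add_comm] at hu hv
    obtain ⟨u, w, h, hu0, hw, rfl⟩ := u.exists_mul hu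
    obtain ⟨v, x, h', hv0, hx, rfl⟩ := v.exists_mul hv
    have hw' := (hS.diag_extend u j).1 (w.toFrom hw h)
    have hx' := (hS.diag_extend v j).1 (x.toFrom hx h')
    simp only [Word.toFrom_wd] at hw' hx'
    -- Equal prefixes have orthogonal one-step extensions. For different prefixes each projection
    -- lies below that of its prefix, and these are orthogonal by induction.
    by_cases e : u = v
    · subst e
      have := (hS.diag_extend u j).2 (w.toFrom hw h) (x.toFrom hx h') fun e => huv (by
        have e' := congrArg From.wd e
        simp only [Word.toFrom_wd] at e'
        subst e'; rfl)
      simpa only [Word.toFrom_wd] using this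
    · have a1 := congrArg star hw'
      rw [star_mul, hS.star_eq, hS.star_eq] at a1
      rw [← a1, ← hx', mul_assoc, ← mul_assoc (S (T.diag u)), ih u v hu0 hv0 e, zero_mul, mul_zero]

/-- If the inner words differ, their projections, which are orthogonal at equal shapes, can be
inserted between the factors. -/
theorem mul_eq_compVal (hS : T.IsCKFamily δ S) {i k : T.CKIndex δ}
    (h : i.snd.shape = k.fst.shape) : S i * S k = CKIndex.compVal S i k := by
  unfold CKIndex.compVal
  split_ifs with hc
  · obtain ⟨u, v, h1⟩ := i
    obtain ⟨v', w, h2⟩ := k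
    obtain rfl : v = v' := hc
    exact hS.mul_eq _ _ _ _ _
  · have h1 : S i * S (T.diag i.snd) = S i := hS.mul_eq _ _ _ i.t_eq _
    have h2 : S (T.diag k.fst) * S k = S k := hS.mul_eq _ _ _ _ k.t_eq
    rw [← h1, ← h2, mul_assoc, ← mul_assoc (S (T.diag i.snd)),
      hS.diag_mul_diag _ _ _ h rfl hc, zero_mul, mul_zero]

theorem mul_eq_mulSum (hS : T.IsCKFamily δ S) (i k : T.CKIndex δ) : S i * S k = mulSum S i k :=
  biadditive_eq_mulSum (AddMonoidHom.mul : B →+ B →+ B) S hS.isSummable hS.isSummable i k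
    fun _ _ _ _ h => hS.mul_eq_compVal h

end IsCKFamily

open CStarRelations in
theorem isCKFamily_gen [Finite A] (T : TransitionSystem r A) (δ : D → A) :
    T.IsCKFamily δ (Univ.gen : T.CKIndex δ → T.CKAlgebra δ) where
  star_eq u v h := Univ.eq_of_lift_eq fun B _ S hS => by
    rw [map_star, Univ.lift_gen, Univ.lift_gen]; exact IsCKFamily.star_eq hS u v h
  mul_eq u v w h h' := Univ.eq_of_lift_eq fun B _ S hS => by
    rw [map_mul, Univ.lift_gen, Univ.lift_gen, Univ.lift_gen]
    exact IsCKFamily.mul_eq hS u v w h h'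
  sum_eq u v h j := Univ.eq_of_lift_eq fun B _ S hS => by
    rw [map_sum, Univ.lift_gen]
    simp only [Univ.lift_gen]
    exact IsCKFamily.sum_eq hS u v h j
  orthogonal u v hu hv huv := Univ.eq_of_lift_eq fun B _ S hS => by
    rw [map_mul, Univ.lift_gen, Univ.lift_gen, map_zero]
    exact IsCKFamily.orthogonal hS u v hu hv huv

theorem mulSum_mem_span [Finite A] {B : Type*} [AddCommMonoid B] [Module ℂ B] (K : T.CKIndex δ → B)
    (i k : T.CKIndex δ) : mulSum K i k ∈ Submodule.span ℂ (Set.range K) := by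
  refine sum_mem fun w _ => sum_mem fun w' _ => ?_
  unfold CKIndex.compVal
  split_ifs
  · exact Submodule.subset_span ⟨_, rfl⟩
  · exact zero_mem _

open CStarRelations in
/-- The generators span a dense subspace of `𝒜`. -/
theorem dense_span_s [Finite A] (T : TransitionSystem r A) (δ : D → A) :
    Dense (Submodule.span ℂ (Set.range (Univ.gen : T.CKIndex δ → T.CKAlgebra δ)) :
      Set (T.CKAlgebra δ)) := by
  refine Univ.dense_span_gen (fun i k => ?_) fun i => ?_
  · have h := (T.isCKFamily_gen δ).mul_eq_mulSum i k
    rw [h]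
    exact mulSum_mem_span _ _ _
  · rw [(T.isCKFamily_gen δ).star_apply]
    exact Submodule.subset_span ⟨_, rfl⟩

end

end TransitionSystem

/-! ## Universal families -/

open CStarRelations

theorem isCrossedFamily_gen {G : Type} [AddGroup G] {E : Type u} [NonUnitalCStarAlgebra E]
    (ρ : CStarAction G E) : IsCrossedFamily ρ (Univ.gen : E × G → CrossedProduct ρ) where
  add x y g := Univ.eq_of_lift_eq fun B _ S hS => by
    simp only [map_add, Univ.lift_gen]; exact IsCrossedFamily.add hS x y g
  smul c x g := Univ.eq_of_lift_eq fun B _ S hS => by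
    simp only [map_smul, Univ.lift_gen]; exact IsCrossedFamily.smul hS c x g
  mul_eq x g y h := Univ.eq_of_lift_eq fun B _ S hS => by
    simp only [map_mul, Univ.lift_gen]; exact IsCrossedFamily.mul_eq hS x g y h
  star_eq x g := Univ.eq_of_lift_eq fun B _ S hS => by
    rw [map_star]; simp only [Univ.lift_gen]; exact IsCrossedFamily.star_eq hS x g

theorem isTensorFamily_gen (E F : Type u) [NonUnitalCStarAlgebra E] [NonUnitalCStarAlgebra F] :
    IsTensorFamily (Univ.gen : E × F → CStarTensor E F) where
  add_left a a' b := Univ.eq_of_lift_eq fun B _ S hS => by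
    simp only [map_add, Univ.lift_gen]; exact IsTensorFamily.add_left hS a a' b
  add_right a b b' := Univ.eq_of_lift_eq fun B _ S hS => by
    simp only [map_add, Univ.lift_gen]; exact IsTensorFamily.add_right hS a b b'
  smul_left c a b := Univ.eq_of_lift_eq fun B _ S hS => by
    simp only [map_smul, Univ.lift_gen]; exact IsTensorFamily.smul_left hS c a b
  smul_right c a b := Univ.eq_of_lift_eq fun B _ S hS => by
    simp only [map_smul, Univ.lift_gen]; exact IsTensorFamily.smul_right hS c a b
  mul_eq a b a' b' := Univ.eq_of_lift_eq fun B _ S hS => by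
    simp only [map_mul, Univ.lift_gen]; exact IsTensorFamily.mul_eq hS a b a' b'
  star_eq a b := Univ.eq_of_lift_eq fun B _ S hS => by
    rw [map_star]; simp only [Univ.lift_gen]; exact IsTensorFamily.star_eq hS a b
  norm_le a b := by
    change ‖Univ.ofPoly (Poly.mk (tensorRelations E F) (.gen (a, b)))‖ ≤ _
    rw [Univ.norm_ofPoly]
    exact Poly.norm_le (by positivity) fun B _ S hS => IsTensorFamily.norm_le hS a b

/-- By directedness two elements can be moved to a common stage, so a product of generators is again
a generator. -/
theorem dense_span_directLimit {ι : Type} [Preorder ι] [IsDirectedOrder ι] (C : ι → Type u)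
    [∀ i, NonUnitalCStarAlgebra (C i)] (f : ∀ i j, i ≤ j → (C i →⋆ₙₐ[ℂ] C j)) :
    Dense (Submodule.span ℂ (Set.range (Univ.gen : (Σ i, C i) → CStarDirectLimit C f)) :
      Set (CStarDirectLimit C f)) := by
  refine Univ.dense_span_gen (fun x y => ?_) fun x => ?_
  · obtain ⟨i, x⟩ := x
    obtain ⟨j, y⟩ := y
    obtain ⟨k, hik, hjk⟩ := exists_ge_ge i j
    refine Submodule.subset_span ⟨⟨k, f i k hik x * f j k hjk y⟩, ?_⟩
    change CStarDirectLimit.of C f k _ = CStarDirectLimit.of C f i x * CStarDirectLimit.of C f j y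
    rw [map_mul, CStarDirectLimit.of_comp, CStarDirectLimit.of_comp]
  · obtain ⟨i, x⟩ := x
    refine Submodule.subset_span ⟨⟨i, star x⟩, ?_⟩
    change CStarDirectLimit.of C f i _ = star (CStarDirectLimit.of C f i x)
    rw [map_star]

namespace TransitionSystem

open InnerProductSpace

variable {r : ℕ} {A : Type u} [Fintype A] {T : TransitionSystem r A}
  {H : Type u} [NormedAddCommGroup H] [InnerProductSpace ℂ H] [CompleteSpace H]
  (ψ : T.RevAlgebra →⋆ₙₐ[ℂ] (H →L[ℂ] H))

/-! ## The representation of `𝒜'` -/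

/-- The operators `ψ(s'_{u,v})`. -/
def revOp (i : T.RevIndex) : H →L[ℂ] H := ψ (CStarRelations.Univ.gen i)

theorem isRevFamily_revOp : T.IsRevFamily (revOp ψ) := isRevFamily_comp ψ

theorem revOp_letter_mul (u : T.Word) :
    revOp ψ ⟨Word.letter T u.t, Word.letter T u.t, rfl⟩ * revOp ψ ⟨u, u, rfl⟩
      = revOp ψ ⟨u, u, rfl⟩ :=
  (isRevFamily_revOp ψ).letter_mul u.wd

/-- Induction on the shape of the first word, peeling a unit step w off its left end: x = wu. The
projection of wu lies below that of u; by induction V_v times the latter is s'_{uv,u}, the sum over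
y of the s'_{yuv,yu}; multiplying by the projection of wu leaves only y = w. -/
theorem revOp_mul_diag (m : Fin r → ℕ) : ∀ (u v : T.Word) (h : u.t = v.o), u.shape = m →
    revOp ψ ⟨v, Word.letter T v.o, rfl⟩ * revOp ψ ⟨u, u, rfl⟩ =
      revOp ψ ⟨u.mul v h, u, Word.mul_o u v h⟩ := by
  have hF := isRevFamily_revOp ψ
  induction m using shape_induction with
  | h0 =>
    intro u v h hu
    obtain ⟨a, rfl⟩ : ∃ a, u = Word.letter T a := ⟨u.t, Word.eq_letter hu⟩
    obtain rfl : a = v.o := h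
    simp only [Word.letter_mul v rfl]
    exact hF.mul_eq _ _ _ _ _
  | h j m ih =>
    intro x v h hx
    obtain ⟨w, u, hwu, hw, hu, rfl⟩ := x.exists_mul hx
    have huv : u.t = v.o := by rw [← h, Word.mul_t]
    have key := hF.extension_aux u j
    let W : {w : Wd T.M (unitShape j) // (T.ofWd w).t = u.o} := w.toTo hw hwu
    have hW : T.ofWd W.1 = w := Word.toTo_wd w hw hwu
    have h1 : revOp ψ ⟨u, u, rfl⟩ * revOp ψ ⟨w.mul u hwu, w.mul u hwu, rfl⟩
        = revOp ψ ⟨w.mul u hwu, w.mul u hwu, rfl⟩ := by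
      have := key.1 W.1 W.2
      simpa only [hW] using this
    rw [← h1, ← mul_assoc, ih u v huv hu,
      hF.sum_eq (u.mul v huv) u (Word.mul_o u v huv) j, Finset.sum_mul,
      Fintype.sum_eq_single (W.1.2 |> fun _ => ⟨W.1, by rw [Word.mul_o]; exact W.2⟩)]
    · simp only [hW]
      rw [hF.mul_eq]
      congr 2
      exact (Word.mul_assoc' _ _ _ _).symm
    · rintro ⟨y, hy⟩ hne
      have hy' : (T.ofWd y).t = u.o := by rw [hy, Word.mul_o]
      have h2 := key.2 y W.1 hy' W.2 fun e => hne (Subtype.ext e)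
      simp only [hW] at h2
      have h3 := hF.mul_eq ((T.ofWd y).mul (u.mul v huv) hy) ((T.ofWd y).mul u hy')
        ((T.ofWd y).mul u hy') (by simp only [Word.mul_o]) rfl
      rw [← h3, mul_assoc, h2, mul_zero]

/-- The range projection of V_u is inserted between V_v and V_u, where `revOp_mul_diag` applies. The
order is reversed because V_v acts on what already ends with `u`. -/
theorem shiftOp_mul (u v : T.Word) (h : u.t = v.o) :
    shiftOp ψ (u.mul v h).wd = shiftOp ψ v.wd * shiftOp ψ u.wd := by
  have hF := isRevFamily_revOp ψ
  have h1 : shiftOp ψ u.wd = revOp ψ ⟨u, u, rfl⟩ * revOp ψ ⟨u, Word.letter T u.o, rfl⟩ :=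
    (hF.mul_eq _ _ _ _ _).symm
  have h2 : shiftOp ψ (u.mul v h).wd = revOp ψ ⟨u.mul v h, u, Word.mul_o u v h⟩ *
      revOp ψ ⟨u, Word.letter T u.o, rfl⟩ := by
    have e : ∀ a (ha : (u.mul v h).o = a), shiftOp ψ (u.mul v h).wd =
        revOp ψ ⟨u.mul v h, Word.letter T a, ha⟩ := by
      rintro _ rfl
      rfl
    exact (e u.o (Word.mul_o u v h)).trans (hF.mul_eq _ _ _ _ _).symm
  rw [h2, h1, ← revOp_mul_diag ψ _ u v h rfl, mul_assoc]
  rfl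

theorem shiftOp_mul_proj_of_ne {m : Fin r → ℕ} (w : Wd T.M m) {a : A} (h : w.o ≠ a) :
    shiftOp ψ w * proj ψ a = 0 := by
  rw [← shiftOp_mul_proj, mul_assoc, proj_mul_of_ne ψ h, mul_zero]

theorem proj_mul_revOp (i : T.RevIndex) : proj ψ i.fst.t * revOp ψ i = revOp ψ i := by
  have hF := isRevFamily_revOp ψ
  have h1 : revOp ψ ⟨i.fst, i.fst, rfl⟩ * revOp ψ i = revOp ψ i := hF.mul_eq _ _ _ _ i.o_eq
  have h2 := revOp_letter_mul ψ i.fst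
  rw [← h1, ← mul_assoc]
  congr 1

variable {ψ}

/-- In a nondegenerate representation the projections onto the `H_a` add up to the identity. -/
theorem sum_proj (hψ : Nondegenerate ψ) : ∑ a, proj ψ a = 1 := by
  classical
  set P := ∑ a, proj ψ a with hP
  have h1 : ∀ i, P * revOp ψ i = revOp ψ i := fun i => by
    rw [hP, Finset.sum_mul, Fintype.sum_eq_single i.fst.t, proj_mul_revOp]
    intro a ha
    rw [← proj_mul_revOp, ← mul_assoc, proj_mul_of_ne ψ ha, zero_mul]
  have hPs : star P = P := by simp only [hP, star_sum, star_proj]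
  have h2 : ∀ i, revOp ψ i * P = revOp ψ i := fun i => by
    have := congrArg star (h1 ⟨i.snd, i.fst, i.o_eq.symm⟩)
    rw [star_mul, hPs, (isRevFamily_revOp ψ).star_eq] at this
    exact this
  have hc : Continuous ψ :=
    (NonUnitalStarAlgHom.instContinuousLinearMapClassComplex
      (F := T.RevAlgebra →⋆ₙₐ[ℂ] (H →L[ℂ] H))).map_continuous ψ
  -- `P` is a unit for the image of each generator, hence for that of each ⋆-polynomial. The left
  -- and right statements are carried along together because taking adjoints interchanges them.
  have h3 : ∀ x : T.RevAlgebra, P * ψ x = ψ x ∧ ψ x * P = ψ x := by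
    intro x
    induction x using CStarRelations.Univ.induction₁ with
    | hc => exact (isClosed_eq (by fun_prop) hc).inter (isClosed_eq (by fun_prop) hc)
    | h p =>
      refine Quotient.inductionOn p fun p => ?_
      change P * ψ (CStarRelations.Univ.ofPoly (CStarRelations.Poly.mk _ p)) =
          ψ (CStarRelations.Univ.ofPoly (CStarRelations.Poly.mk _ p)) ∧
        ψ (CStarRelations.Univ.ofPoly (CStarRelations.Poly.mk _ p)) * P =
          ψ (CStarRelations.Univ.ofPoly (CStarRelations.Poly.mk _ p))
      induction p with
      | gen i => exact ⟨h1 i, h2 i⟩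
      | zero =>
        have e : CStarRelations.Univ.ofPoly (CStarRelations.Poly.mk T.revRelations .zero) = 0 :=
          CStarRelations.Univ.ofPoly_zero
        rw [e]; simp
      | add p q hp hq =>
        have e : CStarRelations.Poly.mk T.revRelations (p.add q) =
            CStarRelations.Poly.mk _ p + CStarRelations.Poly.mk _ q := rfl
        rw [e, CStarRelations.Univ.ofPoly_add, map_add, mul_add, add_mul, hp.1, hq.1, hp.2, hq.2]
        exact ⟨rfl, rfl⟩
      | neg p hp =>
        have e : CStarRelations.Poly.mk T.revRelations p.neg = (-1 : ℂ) • CStarRelations.Poly.mk _ p := by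
          rw [neg_one_smul]; rfl
        rw [e, CStarRelations.Univ.ofPoly_smul, map_smul, mul_smul_comm, smul_mul_assoc, hp.1, hp.2]
        exact ⟨rfl, rfl⟩
      | smul c p hp =>
        have e : CStarRelations.Poly.mk T.revRelations (.smul c p) =
            c • CStarRelations.Poly.mk _ p := rfl
        rw [e, CStarRelations.Univ.ofPoly_smul, map_smul, mul_smul_comm, smul_mul_assoc, hp.1, hp.2]
        exact ⟨rfl, rfl⟩
      | mul p q hp hq =>
        have e : CStarRelations.Poly.mk T.revRelations (p.mul q) =
            CStarRelations.Poly.mk _ p * CStarRelations.Poly.mk _ q := rfl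
        rw [e, CStarRelations.Univ.ofPoly_mul, map_mul, ← mul_assoc, hp.1, mul_assoc, hq.2]
        exact ⟨rfl, rfl⟩
      | star p hp =>
        have e : CStarRelations.Poly.mk T.revRelations p.star = star (CStarRelations.Poly.mk _ p) := rfl
        rw [e, CStarRelations.Univ.ofPoly_star, map_star]
        have a1 := congrArg star hp.1
        have a2 := congrArg star hp.2
        rw [star_mul, hPs] at a1 a2
        exact ⟨a2, a1⟩
  have h4 : ∀ ζ : H, P ζ = ζ := by
    intro ζ
    refine dense_span_induction hψ (P := fun ζ => P ζ = ζ)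
      (isClosed_eq (by fun_prop) continuous_id) ?_ (map_zero _) ?_ ?_ ζ
    · rintro _ ⟨x, ζ, rfl⟩
      rw [← mul_apply_eq_comp, (h3 x).1]
    · intro x y hx hy; rw [map_add, hx, hy]
    · intro c x hx; rw [map_smul, hx]
  ext ζ
  exact h4 ζ

/-- The range projections V_u V_u^* over words of shape `m` add up to 1: the sum rule lowers the
shape to 0, where the p_a add up to 1. This is the totality half of the bases η_u. -/
theorem eq_zero_of_shiftOpAdj (hψ : Nondegenerate ψ) (m : Fin r → ℕ) {ζ : H}
    (h : ∀ u : T.Word, u.shape = m → shiftOpAdj ψ u.wd ζ = 0) : ζ = 0 := by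
  have hF := isRevFamily_revOp ψ
  have h' : ∀ u : T.Word, u.shape = m → revOp ψ ⟨u, u, rfl⟩ ζ = 0 := by
    intro u hu
    have e : revOp ψ ⟨u, u, rfl⟩ = shiftOp ψ u.wd * shiftOpAdj ψ u.wd := (hF.mul_eq _ _ _ _ _).symm
    rw [e, mul_apply_eq_comp, h u hu, map_zero]
  clear h
  induction m using shape_induction with
  | h0 =>
    have h1 : (∑ a, proj ψ a) ζ = 0 := by
      rw [sum_apply]
      exact Finset.sum_eq_zero fun a _ => h' (Word.letter T a) rfl
    rw [sum_proj hψ] at h1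
    exact h1
  | h j m ih =>
    refine ih fun u hu => ?_
    rw [hF.sum_eq u u rfl j, sum_apply]
    exact Finset.sum_eq_zero fun w _ => h' _ (by rw [Word.mul_shape, hu]; rfl)

/-! ## Adapted bases -/

variable {D : Type u} {δ : D → A}

variable (ψ) in
/-- An orthonormal basis `(ξ_d)` of `H` with `ξ_d ∈ H_{δ(d)}`. -/
structure IsAdaptedBasis (δ : D → A) (ξ : D → H) : Prop where
  proj_apply : ∀ d, proj ψ (δ d) (ξ d) = ξ d
  orthonormal : Orthonormal ℂ ξ
  eq_zero : ∀ ζ, (∀ d, inner ℂ (ξ d) ζ = 0) → ζ = 0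

variable (ψ) in
/-- The vector `ψ(s'_{w,o(w)}) ξ_d` for a decorated word `(d, w)`. -/
def vec (ξ : D → H) (u : T.DecoratedWord δ) : H := shiftOp ψ u.word.wd (ξ u.deco)

theorem vec_mul (ξ : D → H) (u : T.DecoratedWord δ) (w : T.Word) (h : u.t = w.o) :
    vec ψ ξ (u.mul w h) = shiftOp ψ w.wd (vec ψ ξ u) := by
  unfold vec
  rw [← mul_apply_eq_comp, ← shiftOp_mul ψ u.word w h]
  rfl

theorem proj_vec (ξ : D → H) (u : T.DecoratedWord δ) : proj ψ u.t (vec ψ ξ u) = vec ψ ξ u := by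
  unfold vec
  rw [← mul_apply_eq_comp]
  congr 1
  exact proj_mul_shiftOp ψ u.word.wd

theorem proj_vec_of_ne (ξ : D → H) (u : T.DecoratedWord δ) {a : A} (h : a ≠ u.t) :
    proj ψ a (vec ψ ξ u) = 0 := by
  rw [← proj_vec, ← mul_apply_eq_comp, proj_mul_of_ne ψ h, zero_apply]

theorem inner_proj (a : A) (x y : H) : inner ℂ (proj ψ a x) y = inner ℂ x (proj ψ a y) := by
  rw [← ContinuousLinearMap.adjoint_inner_right, ← ContinuousLinearMap.star_eq_adjoint, star_proj]

theorem inner_shiftOp {m : Fin r → ℕ} (w : Wd T.M m) (x y : H) :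
    inner ℂ (shiftOp ψ w x) y = inner ℂ x (shiftOpAdj ψ w y) := by
  rw [← ContinuousLinearMap.adjoint_inner_right, ← ContinuousLinearMap.star_eq_adjoint,
    star_shiftOp]

namespace IsAdaptedBasis

variable {ξ : D → H}

theorem inner_vec_self (hξ : IsAdaptedBasis ψ δ ξ) (u : T.DecoratedWord δ) :
    inner ℂ (vec ψ ξ u) (vec ψ ξ u) = 1 := by
  unfold vec
  rw [inner_shiftOp, ← mul_apply_eq_comp, shiftOpAdj_mul_self]
  have h1 : u.word.wd.o = δ u.deco := u.o_eq
  rw [h1, hξ.proj_apply, inner_self_eq_norm_sq_to_K, hξ.orthonormal.1]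
  simp

/-- Distinct words of one shape have orthogonal ranges. For equal words with different decorations,
V_w is isometric on H_{o(w)} and the ξ_d are orthogonal. -/
theorem inner_vec_of_ne (hξ : IsAdaptedBasis ψ δ ξ) {u v : T.DecoratedWord δ}
    (hs : u.shape = v.shape) (h : u ≠ v) : inner ℂ (vec ψ ξ u) (vec ψ ξ v) = 0 := by
  obtain ⟨d, ⟨m, w⟩, hd⟩ := u
  obtain ⟨d', ⟨m', w'⟩, hd'⟩ := v
  obtain rfl : m = m' := hs
  unfold vec
  rw [inner_shiftOp, ← mul_apply_eq_comp]
  by_cases hw : w = w'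
  · subst hw
    rw [shiftOpAdj_mul_self]
    have h1 : w.o = δ d' := hd'
    rw [h1, hξ.proj_apply]
    refine hξ.orthonormal.2 fun e => h ?_
    dsimp only at e
    subst e
    rfl
  · rw [shiftOpAdj_mul_of_ne ψ hw, zero_apply, inner_zero_right]

theorem vec_ne_zero (hξ : IsAdaptedBasis ψ δ ξ) (u : T.DecoratedWord δ) : vec ψ ξ u ≠ 0 := by
  intro h
  have := hξ.inner_vec_self u
  simp [h] at this

/-- The orthonormal basis of the vectors of the decorated words of shape `m`. -/
def basis (hξ : IsAdaptedBasis ψ δ ξ) (hψ : Nondegenerate ψ) (m : Fin r → ℕ) :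
    HilbertBasis {u : T.DecoratedWord δ // u.shape = m} ℂ H :=
  HilbertBasis.mkOfOrthogonalEqBot (v := fun u => vec ψ ξ u.1)
    (by
      classical
      rw [orthonormal_iff_ite]
      intro u v
      split_ifs with h
      · subst h; exact hξ.inner_vec_self _
      · exact hξ.inner_vec_of_ne (u.2.trans v.2.symm) fun e => h (Subtype.ext e))
    (by
      rw [Submodule.eq_bot_iff]
      intro ζ hζ
      rw [Submodule.mem_orthogonal] at hζ
      -- It suffices that V_w^* ζ is orthogonal to every ξ_d. If δ(d) = o(w) this is the hypothesis
      -- on ζ for the decorated word (d, w); otherwise V_w ξ_d = 0.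
      refine eq_zero_of_shiftOpAdj hψ m fun w hw => hξ.eq_zero _ fun d => ?_
      by_cases hd : w.o = δ d
      · rw [← inner_shiftOp]
        exact hζ _ (Submodule.subset_span ⟨⟨⟨d, w, hd⟩, hw⟩, rfl⟩)
      · rw [← inner_shiftOp, ← hξ.proj_apply, ← mul_apply_eq_comp, shiftOp_mul_proj_of_ne ψ _ hd,
          zero_apply, inner_zero_left])

@[simp] theorem basis_apply (hξ : IsAdaptedBasis ψ δ ξ) (hψ : Nondegenerate ψ) (m : Fin r → ℕ)
    (u : {u : T.DecoratedWord δ // u.shape = m}) : hξ.basis hψ m u = vec ψ ξ u.1 := by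
  simp [basis]

end IsAdaptedBasis

/-! ## Matrix units in `𝒞` -/

theorem proj_rankOne_proj (a b : A) (x y : H) :
    proj ψ a * rankOne ℂ x y * proj ψ b = rankOne ℂ (proj ψ a x) (proj ψ b y) := by
  ext z
  simp only [mul_apply_eq_comp, rankOne_apply, map_smul, inner_proj]

theorem isCompactOperator_rankOne (x y : H) : IsCompactOperator (rankOne ℂ x y : H →L[ℂ] H) := by
  have h : IsCompactOperator (ContinuousLinearMap.toSpanSingleton ℂ x ∘ (id : ℂ → ℂ)) :=
    (isCompactOperator_id (E := ℂ)).clm_comp (ContinuousLinearMap.toSpanSingleton ℂ x)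
  exact h.comp_clm (innerSL ℂ y)

variable (ψ) in
/-- The rank one operators `|η_u⟩⟨η_v|` in `𝒞`, for pairs of decorated words. -/
def theta (ξ : D → H) (i : T.CKIndex δ) : blockCompacts ψ :=
  ⟨rankOne ℂ (vec ψ ξ i.fst) (vec ψ ξ i.snd), isCompactOperator_rankOne _ _, by
    classical
    rw [Fintype.sum_eq_single i.fst.t]
    · rw [proj_rankOne_proj, proj_vec, i.t_eq, proj_vec]
    · intro a ha
      rw [proj_rankOne_proj, proj_vec_of_ne ξ _ ha]
      simp⟩

theorem star_rankOne (x y : H) : star (rankOne ℂ x y) = rankOne ℂ y x := by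
  rw [ContinuousLinearMap.star_eq_adjoint, adjoint_rankOne]

theorem rankOne_mul_rankOne (x y z w : H) :
    rankOne ℂ x y * rankOne ℂ z w = inner ℂ y z • rankOne ℂ x w := by
  ext v
  simp only [mul_apply_eq_comp, rankOne_apply, smul_apply, inner_smul_right, smul_smul, mul_comm]

theorem star_theta (ξ : D → H) (i : T.CKIndex δ) : star (theta ψ ξ i) = theta ψ ξ i.flip :=
  Subtype.ext (star_rankOne _ _)

/-- At equal inner shapes the inner product of the two middle vectors is 1 or 0 by orthonormality.
-/
theorem IsAdaptedBasis.theta_mul_theta {ξ : D → H} (hξ : IsAdaptedBasis ψ δ ξ) {i k : T.CKIndex δ}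
    (h : i.snd.shape = k.fst.shape) :
    theta ψ ξ i * theta ψ ξ k = CKIndex.compVal (theta ψ ξ) i k := by
  unfold CKIndex.compVal
  split_ifs with hc
  · refine Subtype.ext ?_
    change rankOne ℂ _ _ * rankOne ℂ _ _ = rankOne ℂ _ _
    rw [rankOne_mul_rankOne, hc, hξ.inner_vec_self, one_smul]
    rfl
  · refine Subtype.ext ?_
    change rankOne ℂ _ _ * rankOne ℂ _ _ = 0
    rw [rankOne_mul_rankOne, hξ.inner_vec_of_ne h hc, zero_smul]

theorem IsAdaptedBasis.theta_ne_zero {ξ : D → H} (hξ : IsAdaptedBasis ψ δ ξ) (i : T.CKIndex δ) :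
    theta ψ ξ i ≠ 0 := by
  intro h
  have h1 := congrArg (fun x : blockCompacts ψ => ‖(x : H →L[ℂ] H)‖) h
  change ‖rankOne ℂ _ _‖ = ‖(0 : H →L[ℂ] H)‖ at h1
  rw [norm_rankOne, norm_zero, mul_eq_zero] at h1
  rcases h1 with h1 | h1
  · exact hξ.vec_ne_zero _ (norm_eq_zero.1 h1)
  · exact hξ.vec_ne_zero _ (norm_eq_zero.1 h1)

/-- Conjugation by V_w turns |η_u⟩⟨η_v| into |η_{uw}⟩⟨η_{vw}| if w starts at t(u), and kills it
otherwise. Thus α_l is the sum rule of 𝒜 in disguise. -/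
theorem alpha_theta (ξ : D → H) (l : Fin r → ℕ) (i : T.CKIndex δ) :
    alpha ψ l (theta ψ ξ i) = ∑ w : T.From l i.t, theta ψ ξ (i.ext w.wd w.o_eq) := by
  classical
  refine Subtype.ext ?_
  have h1 : ((∑ w : T.From l i.t, theta ψ ξ (i.ext w.wd w.o_eq) : blockCompacts ψ) : H →L[ℂ] H) =
      ∑ w : T.From l i.t, shiftOp ψ w.1 * rankOne ℂ (vec ψ ξ i.fst) (vec ψ ξ i.snd) *
        shiftOpAdj ψ w.1 := by
    rw [AddSubmonoidClass.coe_finsetSum]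
    refine Finset.sum_congr rfl fun w _ => ?_
    have e1 : vec ψ ξ (i.ext w.wd w.o_eq).fst = shiftOp ψ w.1 (vec ψ ξ i.fst) := vec_mul _ _ _ _
    have e2 : vec ψ ξ (i.ext w.wd w.o_eq).snd = shiftOp ψ w.1 (vec ψ ξ i.snd) := vec_mul _ _ _ _
    change rankOne ℂ (vec ψ ξ (i.ext w.wd w.o_eq).fst) (vec ψ ξ (i.ext w.wd w.o_eq).snd) = _
    rw [e1, e2]
    ext z
    simp only [mul_apply_eq_comp, rankOne_apply, map_smul]
    congr 1
    exact inner_shiftOp _ _ _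
  rw [h1]
  change ∑ w : Wd T.M l, shiftOp ψ w * rankOne ℂ (vec ψ ξ i.fst) (vec ψ ξ i.snd) *
    shiftOpAdj ψ w = _
  rw [← Finset.sum_subtype (Finset.univ.filter fun w : Wd T.M l => i.t = (T.ofWd w).o) (by simp)
    (fun w => shiftOp ψ w * rankOne ℂ (vec ψ ξ i.fst) (vec ψ ξ i.snd) * shiftOpAdj ψ w)]
  refine (Finset.sum_filter_of_ne fun w _ hw => ?_).symm
  by_contra hne
  refine hw ?_
  ext z
  have h2 : shiftOp ψ w (vec ψ ξ i.fst) = 0 := by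
    have h3 : w.o ≠ i.fst.t := fun e => hne e.symm
    rw [← proj_vec, ← mul_apply_eq_comp, shiftOp_mul_proj_of_ne ψ w h3, zero_apply]
  simp only [mul_apply_eq_comp, rankOne_apply, map_smul, h2, smul_zero, zero_apply]

/-- The operators `|η_u⟩⟨η_v|` with `u`, `v` of given shapes span a dense subspace of `𝒞`. -/
theorem IsAdaptedBasis.dense_span_theta {ξ : D → H} (hξ : IsAdaptedBasis ψ δ ξ)
    (hψ : Nondegenerate ψ) (m n : Fin r → ℕ) :
    Dense (Submodule.span ℂ {x | ∃ i : T.CKIndex δ, i.fst.shape = m ∧ i.snd.shape = n ∧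
      x = theta ψ ξ i} : Set (blockCompacts ψ)) := by
  classical
  intro x
  have hc : IsCompactOperator ((x : H →L[ℂ] H)) := x.2.1
  -- An element of 𝒞 commutes with the p_a, so its entries between basis vectors with different
  -- termini vanish.
  have h1 := (hξ.basis hψ m).mem_closure_span_rankOne (hξ.basis hψ n)
    (R := fun u v => u.1.t = v.1.t) (x := x) hc hc.adjoint_aux (fun u v huv => by
      simp only [basis_apply]
      obtain ⟨hx, -⟩ := (blockDiagonal_iff ψ).1 x.2.2
      rw [← proj_vec, inner_proj, ← mul_apply_eq_comp, hx, mul_apply_eq_comp,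
        proj_vec_of_ne ξ _ huv, map_zero, inner_zero_right])
  rw [closure_subtype]
  convert h1 using 2
  have h2 := Submodule.map_span (blockCompacts ψ).toNonUnitalSubalgebra.toSubmodule.subtype
    {x | ∃ i : T.CKIndex δ, i.fst.shape = m ∧ i.snd.shape = n ∧ x = theta ψ ξ i}
  have h3 := congrArg (fun S : Submodule ℂ (H →L[ℂ] H) => (S : Set (H →L[ℂ] H))) h2
  refine Eq.trans ?_ (h3.trans ?_)
  · rfl
  · congr 2
    ext y
    constructor
    · rintro ⟨_, ⟨i, hm, hn, rfl⟩, rfl⟩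
      exact ⟨⟨i.fst, hm⟩, ⟨i.snd, hn⟩, i.t_eq, by simp only [basis_apply]; rfl⟩
    · rintro ⟨u, v, h, rfl⟩
      exact ⟨_, ⟨⟨u.1, v.1, h⟩, u.2, v.2, rfl⟩, by simp only [basis_apply]; rfl⟩

end TransitionSystem

namespace TransitionSystem

open InnerProductSpace CStarRelations

variable {r : ℕ} {A : Type u} [Fintype A] {T : TransitionSystem r A}
  {H : Type u} [NormedAddCommGroup H] [InnerProductSpace ℂ H] [CompleteSpace H]
  {ψ : T.RevAlgebra →⋆ₙₐ[ℂ] (H →L[ℂ] H)}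

theorem continuous_starHom {E B : Type*} [NonUnitalCStarAlgebra E] [NonUnitalCStarAlgebra B]
    (φ : E →⋆ₙₐ[ℂ] B) : Continuous φ :=
  (NonUnitalStarAlgHom.instContinuousLinearMapClassComplex (F := E →⋆ₙₐ[ℂ] B)).map_continuous φ

/-! ## Levels in `ℰ` -/

/-- A shape, as an element of `ℤ^r`. -/
def up (m : Fin r → ℕ) : Fin r → ℤ := fun k => m k

theorem up_add (m n : Fin r → ℕ) : up (m + n) = up m + up n := by
  funext k; simp [up]

theorem deg_eq {D : Type u} {δ : D → A} (i : T.CKIndex δ) :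
    i.deg = up i.fst.shape - up i.snd.shape := rfl

theorem stage_alpha (m : Fin r → ℤ) (l : Fin r → ℕ) (x : blockCompacts ψ) :
    stage ψ (m + up l) (alpha ψ l x) = stage ψ m x := by
  have hle : m ≤ m + up l := fun k => by simp [up]
  have h := CStarDirectLimit.of_comp (C := fun _ : Fin r → ℤ => blockCompacts ψ)
    (f := connecting ψ) hle x
  have e : connecting ψ m (m + up l) hle = alpha ψ l := by
    simp [connecting, up]
  rw [e] at h
  exact h

theorem act_stage (g m : Fin r → ℤ) (x : blockCompacts ψ) :
    (shiftAction ψ).act g (stage ψ m x) = stage ψ (m + g) x :=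
  Univ.lift_gen (shift_holds ψ g) ⟨m, x⟩

variable (ψ) in
/-- The elements of `ℰ` of the form `x^{(n)}` with `n ≥ 0` are dense. -/
theorem dense_stages :
    Dense {x : LimitAlgebra ψ | ∃ (n : Fin r → ℕ) (y : blockCompacts ψ), x = stage ψ (up n) y} := by
  have lev : ∀ (m : Fin r → ℤ) (n : Fin r → ℕ), m ≤ up n → ∀ x : blockCompacts ψ,
      ∃ y, stage ψ m x = stage ψ (up n) y := by
    intro m n h x
    refine ⟨alpha ψ (fun k => (n k - m k).toNat) x, ?_⟩
    rw [← stage_alpha m (fun k => (n k - m k).toNat) x]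
    refine congrArg (fun p => stage ψ p (alpha ψ (fun k => (n k - m k).toNat) x))
      (funext fun k => ?_)
    have hk : m k ≤ n k := h k
    simp only [up, Pi.add_apply]
    omega
  -- Two nonnegative stages both lie below their sum, so the elements in question already form a
  -- subspace that contains all generators.
  refine (dense_span_directLimit (fun _ : Fin r → ℤ => blockCompacts ψ) (connecting ψ)).mono ?_
  intro x hx
  induction hx using Submodule.span_induction with
  | zero => exact ⟨0, 0, (map_zero _).symm⟩
  | add x y _ _ h h' =>
    obtain ⟨n, a, rfl⟩ := h
    obtain ⟨k, b, rfl⟩ := h'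
    obtain ⟨a', ha⟩ := lev (up n) (n + k) (fun i => by simp [up]) a
    obtain ⟨b', hb⟩ := lev (up k) (n + k) (fun i => by simp [up]) b
    exact ⟨n + k, a' + b', by rw [ha, hb, map_add]⟩
  | smul c x _ h =>
    obtain ⟨n, a, rfl⟩ := h
    exact ⟨n, c • a, (map_smul _ _ _).symm⟩
  | mem x hx =>
    obtain ⟨⟨m, y⟩, rfl⟩ := hx
    obtain ⟨a, ha⟩ := lev m (fun k => (m k).toNat) (fun k => by simp [up]) y
    exact ⟨_, a, ha⟩

section

variable {D : Type u} {δ : D → A} {ξ : D → H}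

variable (ψ) in
/-- The element `|η_u⟩⟨η_v|^{(m)}` of `ℰ`, where `m` is the shape of `u`. -/
def unit (ξ : D → H) (i : T.CKIndex δ) : LimitAlgebra ψ :=
  stage ψ (up i.fst.shape) (theta ψ ξ i)

/-- In the limit an element is identified with its image under α_l placed `l` stages higher;
extending by words of shape `l` raises the stage `up i.fst.shape` by exactly this amount. -/
theorem isSummable_unit (ξ : D → H) : IsSummable (unit ψ ξ : T.CKIndex δ → _) := by
  intro i l
  unfold unit
  rw [← stage_alpha _ l, alpha_theta, map_sum, ← up_add]
  rfl

/-- The adjoint sits at the stage of the first word, whereas the element of the flipped pair sits at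
the stage of the second. The shift by the degree is the difference. -/
theorem star_unit (ξ : D → H) (i : T.CKIndex δ) :
    star (unit ψ ξ i) = (shiftAction ψ).act i.deg (unit ψ ξ i.flip) := by
  unfold unit
  rw [act_stage, ← map_star, star_theta, deg_eq]
  refine congrArg (fun p => stage ψ p (theta ψ ξ i.flip)) ?_
  change _ = up i.snd.shape + _
  exact (add_sub_cancel _ _).symm

theorem act_star_unit (ξ : D → H) (i : T.CKIndex δ) :
    (shiftAction ψ).act (-i.deg) (star (unit ψ ξ i)) = unit ψ ξ i.flip := by
  rw [star_unit, ← CStarAction.act_add, neg_add_cancel, CStarAction.act_zero]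

/-- The shift by `i.deg` moves the second factor from the shape of `i.snd`, equal to that of
`k.fst`, to the shape of `i.fst`. Both factors are then at one stage and multiply in 𝒞. -/
theorem IsAdaptedBasis.unit_mul_act (hξ : IsAdaptedBasis ψ δ ξ) {i k : T.CKIndex δ}
    (h : i.snd.shape = k.fst.shape) :
    unit ψ ξ i * (shiftAction ψ).act i.deg (unit ψ ξ k) = CKIndex.compVal (unit ψ ξ) i k := by
  have h1 : unit ψ ξ i * (shiftAction ψ).act i.deg (unit ψ ξ k) =
      stage ψ (up i.fst.shape) (theta ψ ξ i * theta ψ ξ k) := by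
    unfold unit
    rw [act_stage, deg_eq, ← h, map_mul]
    rw [show up i.snd.shape + (up i.fst.shape - up i.snd.shape) = up i.fst.shape from
      add_sub_cancel _ _]
  rw [h1, hξ.theta_mul_theta h]
  unfold CKIndex.compVal
  split_ifs with hc
  · rfl
  · exact map_zero _

theorem IsAdaptedBasis.unit_mul_act_eq_mulSum (hξ : IsAdaptedBasis ψ δ ξ) (i k : T.CKIndex δ) :
    unit ψ ξ i * (shiftAction ψ).act i.deg (unit ψ ξ k) = mulSum (unit ψ ξ) i k := by
  let μ : LimitAlgebra ψ →+ LimitAlgebra ψ →+ LimitAlgebra ψ :=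
    (AddMonoidHom.mul : LimitAlgebra ψ →+ LimitAlgebra ψ →+ LimitAlgebra ψ).compl₂
      ((shiftAction ψ).act i.deg : LimitAlgebra ψ →+ LimitAlgebra ψ)
  refine biadditive_eq_mulSum μ (unit ψ ξ) (isSummable_unit ξ) (isSummable_unit ξ) i k ?_
  intro x y hx _ h
  rw [← hξ.unit_mul_act h, hx]
  rfl

theorem IsAdaptedBasis.dense_span_unit (hξ : IsAdaptedBasis ψ δ ξ) (hψ : Nondegenerate ψ)
    (g : Fin r → ℤ) : Dense (Submodule.span ℂ (Set.range fun i : {i : T.CKIndex δ // i.deg = g} =>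
      unit ψ ξ i.1) : Set (LimitAlgebra ψ)) := by
  set V := Submodule.span ℂ (Set.range fun i : {i : T.CKIndex δ // i.deg = g} => unit ψ ξ i.1)
  refine dense_closure.1 ((dense_stages ψ).mono ?_)
  rintro _ ⟨n, y, rfl⟩
  -- Raising the stage by the positive part of `g` makes `n + n' - g` nonnegative, so that it can
  -- serve as the shape of the second word of a pair of degree `g`.
  set n' : Fin r → ℕ := fun k => (g k).toNat
  have hy : stage ψ (up n) y = stage ψ (up (n + n')) (alpha ψ n' y) := by
    rw [up_add, stage_alpha]
  rw [hy]
  refine map_mem_closure (continuous_starHom (stage ψ (up (n + n'))))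
    (hξ.dense_span_theta hψ (n + n') (fun k => ((n + n') k - g k).toNat) (alpha ψ n' y)) ?_
  intro z hz
  induction hz using Submodule.span_induction with
  | zero => rw [map_zero]; exact zero_mem V
  | add x y _ _ h h' => rw [map_add]; exact V.add_mem h h'
  | smul c x _ h => rw [map_smul]; exact V.smul_mem c h
  | mem x hx =>
    obtain ⟨i, h1, h2, rfl⟩ := hx
    refine Submodule.subset_span ⟨⟨i, ?_⟩, ?_⟩
    · rw [deg_eq, h1, h2]
      funext k
      simp only [up, Pi.sub_apply, Pi.add_apply, n']
      omega
    · simp only [unit, h1]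

/-! ## The homomorphism `𝒜 → ℰ ⋊ ℤ^r` -/

variable (ψ) in
/-- The family `|η_u⟩⟨η_v|^{(m)} U^{m - n}` in `ℰ ⋊ ℤ^r`, for `u`, `v` of shapes `m`, `n`. -/
def crossedUnit (ξ : D → H) (i : T.CKIndex δ) : CrossedProduct (shiftAction ψ) :=
  Univ.gen (unit ψ ξ i, i.deg)

/-- The generators `x U^g` of the crossed product, as a linear map in `x`. -/
def crossedGen {E : Type u} [NonUnitalCStarAlgebra E] {G : Type} [AddGroup G] (ρ : CStarAction G E)
    (g : G) : E →L[ℂ] CrossedProduct ρ :=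
  LinearMap.mkContinuous
    { toFun := fun x => Univ.gen (x, g)
      map_add' := fun x y => (isCrossedFamily_gen ρ).add x y g
      map_smul' := fun c x => (isCrossedFamily_gen ρ).smul c x g } 1
    fun x => by rw [one_mul]; exact (isCrossedFamily_gen ρ).norm_le x g

@[simp] theorem crossedGen_apply {E : Type u} [NonUnitalCStarAlgebra E] {G : Type} [AddGroup G]
    (ρ : CStarAction G E) (g : G) (x : E) : crossedGen ρ g x = Univ.gen (x, g) := rfl

theorem IsAdaptedBasis.crossedUnit_mul (hξ : IsAdaptedBasis ψ δ ξ) {i k : T.CKIndex δ}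
    (h : i.snd.shape = k.fst.shape) : crossedUnit ψ ξ i * crossedUnit ψ ξ k =
      crossedGen (shiftAction ψ) (i.deg + k.deg) (CKIndex.compVal (unit ψ ξ) i k) := by
  unfold crossedUnit
  rw [(isCrossedFamily_gen (shiftAction ψ)).mul_eq, hξ.unit_mul_act h]
  rfl

/-- The factor U^{m-n} makes the twist in the convolution product and involution compensate the
difference of the stages; the relations then reduce to those between rank one operators. -/
theorem IsAdaptedBasis.isCKFamily (hξ : IsAdaptedBasis ψ δ ξ) :
    T.IsCKFamily δ (crossedUnit ψ ξ) where
  star_eq u v h := by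
    have := (isCrossedFamily_gen (shiftAction ψ)).star_eq (unit ψ ξ ⟨u, v, h⟩)
      (CKIndex.deg ⟨u, v, h⟩)
    rw [act_star_unit] at this
    unfold crossedUnit
    rw [this, ← CKIndex.deg_flip]
    rfl
  mul_eq u v w h h' := by
    rw [hξ.crossedUnit_mul rfl, CKIndex.compVal, dif_pos rfl]
    unfold crossedUnit
    rw [crossedGen_apply]
    congr 2
    simp only [deg_eq]
    abel
  sum_eq u v h j := by
    have h1 := congrArg (crossedGen (shiftAction ψ) (CKIndex.deg ⟨u, v, h⟩))
      (isSummable_unit (ψ := ψ) ξ ⟨u, v, h⟩ (unitShape j))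
    rw [map_sum] at h1
    refine h1.trans (Finset.sum_congr rfl fun w _ => ?_)
    have h2 := CKIndex.deg_ext ⟨u, v, h⟩ w.wd w.o_eq
    rw [← h2]
    rfl
  orthogonal u v hu hv huv := by
    rw [hξ.crossedUnit_mul (hu.trans hv.symm), CKIndex.compVal, dif_neg huv, map_zero]

/-! ## Families indexed by `ℰ` in a Cuntz-Krieger algebra -/

/-- On the operators |η_u⟩⟨η_v| this is unique factorization of words of shape `l + k`; density does
the rest. -/
theorem alpha_add (hξ : IsAdaptedBasis ψ δ ξ) (hψ : Nondegenerate ψ) (k l : Fin r → ℕ)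
    (x : blockCompacts ψ) : alpha ψ k (alpha ψ l x) = alpha ψ (l + k) x := by
  have hk := continuous_starHom (alpha ψ k)
  have hl := continuous_starHom (alpha ψ l)
  have hkl := continuous_starHom (alpha ψ (l + k))
  refine dense_span_induction (hξ.dense_span_theta hψ 0 0)
    (P := fun x => alpha ψ k (alpha ψ l x) = alpha ψ (l + k) x)
    (isClosed_eq (hk.comp hl) hkl) ?_ (by simp) ?_ ?_ x
  · rintro _ ⟨i, -, -, rfl⟩
    rw [alpha_theta, alpha_theta, map_sum,
      sum_from_add l k i.t (fun w hw => theta ψ ξ (i.ext w hw))]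
    refine Finset.sum_congr rfl fun w _ => ?_
    rw [alpha_theta, sum_from_congr rfl (i.ext_t w.wd w.o_eq)
      (fun w' hw' => theta ψ ξ ((i.ext w.wd w.o_eq).ext w' hw'))]
    refine Finset.sum_congr rfl fun w' _ => ?_
    rw [CKIndex.ext_ext _ _ _ _ _ w'.o_eq]
  · intro x y hx hy; simp only [map_add, hx, hy]
  · intro c x hx; simp only [map_smul, hx]

variable {B : Type u} [NonUnitalCStarAlgebra B] {S : T.CKIndex δ → B}

/-- The elements of a family with both words of shape `n`, as a partial matrix. -/
def levelMatrix {C : Type u} [Zero C] (F : T.CKIndex δ → C) (n : Fin r → ℕ)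
    (u v : {u : T.DecoratedWord δ // u.shape = n}) : C :=
  open Classical in if h : u.1.t = v.1.t then F ⟨u.1, v.1, h⟩ else 0

theorem levelMatrix_eq {C : Type u} [Zero C] (F : T.CKIndex δ → C) (n : Fin r → ℕ)
    (u v : {u : T.DecoratedWord δ // u.shape = n}) (h : u.1.t = v.1.t) :
    levelMatrix F n u v = F ⟨u.1, v.1, h⟩ := dif_pos h

theorem isMatrixUnits_levelMatrix {C : Type u} [NonUnitalCStarAlgebra C]
    {F : T.CKIndex δ → C} (hstar : ∀ i, star (F i) = F i.flip)
    (hmul : ∀ i k, i.snd.shape = k.fst.shape → F i * F k = CKIndex.compVal F i k)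
    (n : Fin r → ℕ) : IsMatrixUnits (fun u v => u.1.t = v.1.t) (levelMatrix F n) where
  star_eq i j h := by
    rw [levelMatrix_eq F n i j h, levelMatrix_eq F n j i h.symm, hstar]; rfl
  mul_eq i j k h h' := by
    rw [levelMatrix_eq F n i j h, levelMatrix_eq F n j k h', levelMatrix_eq F n i k (h.trans h'),
      hmul _ _ rfl, CKIndex.compVal, dif_pos rfl]
    rfl
  mul_ne i j k l h h' hjk := by
    rw [levelMatrix_eq F n i j h, levelMatrix_eq F n k l h', hmul _ _ (j.2.trans k.2.symm),
      CKIndex.compVal, dif_neg fun e => hjk (Subtype.ext e)]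

theorem range_levelMatrix {C : Type u} [Zero C] (F : T.CKIndex δ → C) (n : Fin r → ℕ) :
    {x | ∃ u v : {u : T.DecoratedWord δ // u.shape = n}, u.1.t = v.1.t ∧ x = levelMatrix F n u v} =
      {x | ∃ i : T.CKIndex δ, i.fst.shape = n ∧ i.snd.shape = n ∧ x = F i} := by
  ext x
  constructor
  · rintro ⟨u, v, h, rfl⟩
    exact ⟨⟨u.1, v.1, h⟩, u.2, v.2, levelMatrix_eq F n u v h⟩
  · rintro ⟨i, h1, h2, rfl⟩
    exact ⟨⟨i.fst, h1⟩, ⟨i.snd, h2⟩, i.t_eq, (levelMatrix_eq F n ⟨i.fst, h1⟩ ⟨i.snd, h2⟩ i.t_eq).symm⟩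

/-- At one shape the |η_u⟩⟨η_v| are nonzero matrix units that span 𝒞, and the S_{u,v} satisfy the
same relations. The S_{u,v} themselves may vanish. -/
theorem exists_levelHom (hξ : IsAdaptedBasis ψ δ ξ) (hψ : Nondegenerate ψ)
    (hS : T.IsCKFamily δ S) (n : Fin r → ℕ) : ∃ J : blockCompacts ψ →⋆ₙₐ[ℂ] B,
      ∀ i : T.CKIndex δ, i.fst.shape = n → i.snd.shape = n → J (theta ψ ξ i) = S i := by
  have hR : Equivalence fun u v : {u : T.DecoratedWord δ // u.shape = n} => u.1.t = v.1.t :=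
    ⟨fun _ => rfl, fun h => h.symm, fun h h' => h.trans h'⟩
  have he := isMatrixUnits_levelMatrix (F := (theta ψ ξ : T.CKIndex δ → blockCompacts ψ))
    (star_theta ξ) (fun i k h => hξ.theta_mul_theta h) n
  have hf := isMatrixUnits_levelMatrix (F := S) hS.star_apply (fun i k h => hS.mul_eq_compVal h) n
  have hd := hξ.dense_span_theta hψ n n
  rw [← range_levelMatrix] at hd
  have h0 : ∀ u v : {u : T.DecoratedWord δ // u.shape = n}, u.1.t = v.1.t →
      levelMatrix (theta ψ ξ : T.CKIndex δ → blockCompacts ψ) n u v ≠ 0 := fun u v h => by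
    rw [levelMatrix_eq _ n u v h]; exact hξ.theta_ne_zero _
  obtain ⟨J, hJ⟩ := IsMatrixUnits.exists_starHom hR he hf h0 hd
  refine ⟨J, fun i h1 h2 => ?_⟩
  have := hJ ⟨i.fst, h1⟩ ⟨i.snd, h2⟩ i.t_eq
  rw [levelMatrix_eq _ n ⟨i.fst, h1⟩ ⟨i.snd, h2⟩ i.t_eq,
    levelMatrix_eq _ n ⟨i.fst, h1⟩ ⟨i.snd, h2⟩ i.t_eq] at this
  exact this

/-- The ⋆-homomorphism from `𝒞` given by the Cuntz-Krieger family at shape `n`. -/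
def levelHom (hξ : IsAdaptedBasis ψ δ ξ) (hψ : Nondegenerate ψ)
    (hS : T.IsCKFamily δ S) (n : Fin r → ℕ) : blockCompacts ψ →⋆ₙₐ[ℂ] B :=
  (exists_levelHom hξ hψ hS n).choose

theorem levelHom_theta (hξ : IsAdaptedBasis ψ δ ξ) (hψ : Nondegenerate ψ)
    (hS : T.IsCKFamily δ S) {n : Fin r → ℕ} {i : T.CKIndex δ} (h1 : i.fst.shape = n)
    (h2 : i.snd.shape = n) : levelHom hξ hψ hS n (theta ψ ξ i) = S i :=
  (exists_levelHom hξ hψ hS n).choose_spec i h1 h2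

/-- The sum rule for `S` is matched with `alpha_theta`. -/
theorem levelHom_alpha (hξ : IsAdaptedBasis ψ δ ξ) (hψ : Nondegenerate ψ)
    (hS : T.IsCKFamily δ S) (n l : Fin r → ℕ) (x : blockCompacts ψ) :
    levelHom hξ hψ hS (n + l) (alpha ψ l x) = levelHom hξ hψ hS n x := by
  refine dense_span_induction (hξ.dense_span_theta hψ n n)
    (P := fun x => levelHom hξ hψ hS (n + l) (alpha ψ l x) = levelHom hξ hψ hS n x)
    (isClosed_eq ((continuous_starHom _).comp (continuous_starHom _)) (continuous_starHom _))
    ?_ (by simp) ?_ ?_ x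
  · rintro _ ⟨i, h1, h2, rfl⟩
    rw [levelHom_theta hξ hψ hS h1 h2, hS.isSummable i l, alpha_theta, map_sum]
    exact Finset.sum_congr rfl fun w _ => levelHom_theta hξ hψ hS
      (by rw [CKIndex.ext_fst_shape, h1]; rfl) (by rw [CKIndex.ext_snd_shape, h2]; rfl)
  · intro x y hx hy; simp only [map_add, hx, hy]
  · intro c x hx; simp only [map_smul, hx]

/-- The homomorphisms exist only at shapes n ≥ 0. With m = m⁺ - m⁻ the element x^{(m)} equals
(α_{m⁻} x)^{(m⁺)}, which dictates the formula at every m in ℤ^r. -/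
theorem limit_holds (hξ : IsAdaptedBasis ψ δ ξ) (hψ : Nondegenerate ψ)
    (hS : T.IsCKFamily δ S) :
    (directLimitRelations (fun _ : Fin r → ℤ => blockCompacts ψ) (connecting ψ)).Holds B
      (fun p => levelHom hξ hψ hS (fun k => (p.1 k).toNat)
        (alpha ψ (fun k => (-p.1 k).toNat) p.2)) := by
  refine ⟨fun m => (levelHom hξ hψ hS (fun k => (m k).toNat)).comp
    (alpha ψ (fun k => (-m k).toNat)), fun _ _ => rfl, fun m n hmn x => ?_⟩
  change levelHom hξ hψ hS (fun k => (n k).toNat) (alpha ψ (fun k => (-n k).toNat)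
    (alpha ψ (fun k => (n k - m k).toNat) x)) = levelHom hξ hψ hS (fun k => (m k).toNat)
      (alpha ψ (fun k => (-m k).toNat) x)
  -- Compatibility amounts to n⁺ = m⁺ + d and (n - m) + n⁻ = m⁻ + d.
  set d : Fin r → ℕ := fun k => (n k).toNat - (m k).toNat
  rw [← levelHom_alpha hξ hψ hS (fun k => (m k).toNat) d, alpha_add hξ hψ, alpha_add hξ hψ]
  have e1 : (fun k => (n k).toNat) = (fun k => (m k).toNat) + d := by
    funext k
    have hk : m k ≤ n k := hmn k
    simp only [Pi.add_apply, d]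
    omega
  have e2 : ((fun k => (n k - m k).toNat) + fun k => (-n k).toNat) =
      (fun k => (-m k).toNat) + d := by
    funext k
    have hk : m k ≤ n k := hmn k
    simp only [Pi.add_apply, d]
    omega
  rw [e1, e2]

/-- The ⋆-homomorphism from `ℰ` given by a Cuntz-Krieger family. -/
def limitHom (hξ : IsAdaptedBasis ψ δ ξ) (hψ : Nondegenerate ψ)
    (hS : T.IsCKFamily δ S) : LimitAlgebra ψ →⋆ₙₐ[ℂ] B :=
  Univ.lift (limit_holds hξ hψ hS)

theorem limitHom_stage (hξ : IsAdaptedBasis ψ δ ξ) (hψ : Nondegenerate ψ)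
    (hS : T.IsCKFamily δ S) (n : Fin r → ℕ) (x : blockCompacts ψ) :
    limitHom hξ hψ hS (stage ψ (up n) x) = levelHom hξ hψ hS n x := by
  refine (Univ.lift_gen (limit_holds hξ hψ hS) ⟨up n, x⟩).trans ?_
  have e1 : (fun k => (up n k).toNat) = n := by funext k; simp [up]
  have e2 : (fun k => (-up n k).toNat) = 0 := by funext k; simp [up]
  simp only [e1, e2]
  exact levelHom_alpha hξ hψ hS n 0 x

theorem limitHom_unit (hξ : IsAdaptedBasis ψ δ ξ) (hψ : Nondegenerate ψ)
    (hS : T.IsCKFamily δ S) {i : T.CKIndex δ} (hi : i.deg = 0) :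
    limitHom hξ hψ hS (unit ψ ξ i) = S i := by
  have h : i.snd.shape = i.fst.shape := by
    funext k
    have := congrFun hi k
    simp only [CKIndex.deg, Pi.zero_apply] at this
    omega
  unfold unit
  rw [limitHom_stage, levelHom_theta hξ hψ hS rfl h]

/-- For pairs i, j of degree g, S_i S_j^* expands into terms of degree 0, and so it is the image
under `limitHom` of the product of the first unit with the adjoint of the second. This is the
hypothesis of `exists_extension_of_starHom`. -/
theorem exists_gradedMap (hξ : IsAdaptedBasis ψ δ ξ) (hψ : Nondegenerate ψ)
    (hS : T.IsCKFamily δ S) (g : Fin r → ℤ) :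
    ∃ L : LimitAlgebra ψ →L[ℂ] B, ∀ i : T.CKIndex δ, i.deg = g → L (unit ψ ξ i) = S i := by
  obtain ⟨L, hL, -⟩ := exists_extension_of_starHom
    (e := fun i : {i : T.CKIndex δ // i.deg = g} => unit ψ ξ i.1) (f := fun i => S i.1)
    (limitHom hξ hψ hS) (hξ.dense_span_unit hψ g) (fun i j => by
      have hij : j.1.deg = i.1.deg := j.2.trans i.2.symm
      rw [star_unit, hS.star_apply, hS.mul_eq_mulSum, hij, hξ.unit_mul_act_eq_mulSum]
      refine (mulSum_eq (limitHom hξ hψ hS : LimitAlgebra ψ →+ B) _ S _ _ fun x hx => ?_).symm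
      refine limitHom_unit hξ hψ hS ?_
      rw [hx, CKIndex.deg_flip, i.2, j.2, add_neg_cancel])
  exact ⟨L, fun i hi => hL ⟨i, hi⟩⟩

/-- The map `x ↦ x U^g`. -/
def gradedMap (hξ : IsAdaptedBasis ψ δ ξ) (hψ : Nondegenerate ψ)
    (hS : T.IsCKFamily δ S) (g : Fin r → ℤ) : LimitAlgebra ψ →L[ℂ] B :=
  (exists_gradedMap hξ hψ hS g).choose

theorem gradedMap_unit (hξ : IsAdaptedBasis ψ δ ξ) (hψ : Nondegenerate ψ)
    (hS : T.IsCKFamily δ S) {g : Fin r → ℤ} {i : T.CKIndex δ} (h : i.deg = g) :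
    gradedMap hξ hψ hS g (unit ψ ξ i) = S i :=
  (exists_gradedMap hξ hψ hS g).choose_spec i h

/-- By density it suffices to take units of degrees g and h. Their twisted product in ℰ and the
product of the corresponding S have the same expansion, all of whose terms have degree g + h. -/
theorem isCrossedFamily_gradedMap (hξ : IsAdaptedBasis ψ δ ξ) (hψ : Nondegenerate ψ)
    (hS : T.IsCKFamily δ S) :
    IsCrossedFamily (shiftAction ψ) fun p => gradedMap hξ hψ hS p.2 p.1 where
  add x y g := map_add _ _ _
  smul c x g := map_smul _ _ _
  mul_eq x g y h := by
    dsimp only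
    have hc := continuous_starHom ((shiftAction ψ).act g)
    refine dense_span_induction (hξ.dense_span_unit hψ g) (P := fun x =>
      gradedMap hξ hψ hS g x * gradedMap hξ hψ hS h y =
        gradedMap hξ hψ hS (g + h) (x * (shiftAction ψ).act g y))
      (isClosed_eq (by fun_prop) (by fun_prop)) ?_ (by simp) ?_ ?_ x
    · rintro _ ⟨⟨i, hi⟩, rfl⟩
      refine dense_span_induction (hξ.dense_span_unit hψ h) (P := fun y =>
        gradedMap hξ hψ hS g (unit ψ ξ i) * gradedMap hξ hψ hS h y =
          gradedMap hξ hψ hS (g + h) (unit ψ ξ i * (shiftAction ψ).act g y))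
        (isClosed_eq (by fun_prop) (by fun_prop)) ?_ (by simp) ?_ ?_ y
      · rintro _ ⟨⟨k, hk⟩, rfl⟩
        dsimp only
        rw [gradedMap_unit hξ hψ hS hi, gradedMap_unit hξ hψ hS hk, hS.mul_eq_mulSum, ← hi,
          hξ.unit_mul_act_eq_mulSum]
        refine (mulSum_eq (gradedMap hξ hψ hS (i.deg + h) : LimitAlgebra ψ →+ B) _ S _ _
          fun x hx => ?_).symm
        exact gradedMap_unit hξ hψ hS (by rw [hx, hk])
      · intro a b ha hb; simp only [map_add, mul_add, ha, hb]
      · intro c a ha; simp only [map_smul, mul_smul_comm, ha]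
    · intro a b ha hb; simp only [map_add, add_mul, ha, hb]
    · intro c a ha; simp only [map_smul, smul_mul_assoc, ha]
  star_eq x g := by
    dsimp only
    have hc := continuous_starHom ((shiftAction ψ).act (-g))
    refine dense_span_induction (hξ.dense_span_unit hψ g) (P := fun x =>
      star (gradedMap hξ hψ hS g x) =
        gradedMap hξ hψ hS (-g) ((shiftAction ψ).act (-g) (star x)))
      (isClosed_eq (by fun_prop) (by fun_prop)) ?_ (by simp) ?_ ?_ x
    · rintro _ ⟨⟨i, hi⟩, rfl⟩
      dsimp only
      subst hi
      rw [gradedMap_unit hξ hψ hS rfl, hS.star_apply, act_star_unit,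
        gradedMap_unit hξ hψ hS (i.deg_flip)]
    · intro a b ha hb; simp only [map_add, star_add, ha, hb]
    · intro c a ha; simp only [map_smul, star_smul, ha]

/-- The ⋆-homomorphism from `ℰ ⋊ ℤ^r` given by a Cuntz-Krieger family. -/
def crossedHom (hξ : IsAdaptedBasis ψ δ ξ) (hψ : Nondegenerate ψ)
    (hS : T.IsCKFamily δ S) : CrossedProduct (shiftAction ψ) →⋆ₙₐ[ℂ] B :=
  Univ.lift (R := crossedRelations (shiftAction ψ)) (isCrossedFamily_gradedMap hξ hψ hS)

theorem crossedHom_gen (hξ : IsAdaptedBasis ψ δ ξ) (hψ : Nondegenerate ψ)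
    (hS : T.IsCKFamily δ S) (x : LimitAlgebra ψ) (g : Fin r → ℤ) :
    crossedHom hξ hψ hS (Univ.gen (x, g)) = gradedMap hξ hψ hS g x :=
  Univ.lift_gen (R := crossedRelations (shiftAction ψ)) (isCrossedFamily_gradedMap hξ hψ hS) (x, g)

/-! ## The isomorphism -/

/-- The ⋆-homomorphism `𝒜 → ℰ ⋊ ℤ^r`. -/
def toCrossed (hξ : IsAdaptedBasis ψ δ ξ) : T.CKAlgebra δ →⋆ₙₐ[ℂ] CrossedProduct (shiftAction ψ) :=
  Univ.lift (R := T.ckRelations δ) hξ.isCKFamily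

theorem toCrossed_gen (hξ : IsAdaptedBasis ψ δ ξ) (i : T.CKIndex δ) :
    toCrossed hξ (Univ.gen i) = crossedUnit ψ ξ i :=
  Univ.lift_gen (R := T.ckRelations δ) hξ.isCKFamily i

theorem toCrossed_gradedMap (hξ : IsAdaptedBasis ψ δ ξ) (hψ : Nondegenerate ψ) (g : Fin r → ℤ)
    (x : LimitAlgebra ψ) : toCrossed hξ (gradedMap hξ hψ (T.isCKFamily_gen δ) g x) =
      Univ.gen (x, g) := by
  have hc := continuous_starHom (toCrossed hξ)
  refine dense_span_induction (hξ.dense_span_unit hψ g) (P := fun x =>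
    toCrossed hξ (gradedMap hξ hψ (T.isCKFamily_gen δ) g x) = crossedGen (shiftAction ψ) g x)
    (isClosed_eq (by fun_prop) (by fun_prop)) ?_ (by simp only [map_zero]) ?_ ?_ x
  · rintro _ ⟨⟨i, rfl⟩, rfl⟩
    dsimp only
    rw [gradedMap_unit hξ hψ _ rfl, toCrossed_gen]
    rfl
  · intro a b ha hb; simp only [map_add, ha, hb]
  · intro c a ha; simp only [map_smul, ha]

/-- For a decoration with an adapted basis, `𝒜 ≅ ℰ ⋊ ℤ^r`. -/
def crossedEquiv (hξ : IsAdaptedBasis ψ δ ξ) (hψ : Nondegenerate ψ) :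
    T.CKAlgebra δ ≃⋆ₐ[ℂ] CrossedProduct (shiftAction ψ) where
  toFun := toCrossed hξ
  invFun := crossedHom hξ hψ (T.isCKFamily_gen δ)
  left_inv x := by
    have h : (crossedHom hξ hψ (T.isCKFamily_gen δ)).comp (toCrossed hξ) =
        NonUnitalStarAlgHom.id ℂ _ := Univ.hom_ext fun i => by
      rw [NonUnitalStarAlgHom.comp_apply, toCrossed_gen, crossedUnit, crossedHom_gen,
        gradedMap_unit hξ hψ _ rfl]
      rfl
    exact congrArg (fun f : T.CKAlgebra δ →⋆ₙₐ[ℂ] T.CKAlgebra δ => f x) h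
  right_inv x := by
    have h : (toCrossed hξ).comp (crossedHom hξ hψ (T.isCKFamily_gen δ)) =
        NonUnitalStarAlgHom.id ℂ _ := Univ.hom_ext fun p => by
      obtain ⟨y, g⟩ := p
      rw [NonUnitalStarAlgHom.comp_apply, crossedHom_gen, toCrossed_gradedMap]
      rfl
    exact congrArg (fun f : CrossedProduct (shiftAction ψ) →⋆ₙₐ[ℂ] _ => f x) h
  map_add' := map_add _
  map_mul' := map_mul _
  map_star' := map_star _
  map_smul' := map_smul _

end

end TransitionSystem

namespace TransitionSystem

open InnerProductSpace CStarRelations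

variable {r : ℕ} {A : Type u} [Fintype A] {T : TransitionSystem r A}
  {H : Type u} [NormedAddCommGroup H] [InnerProductSpace ℂ H] [CompleteSpace H]
  {ψ : T.RevAlgebra →⋆ₙₐ[ℂ] (H →L[ℂ] H)} {D : Type u} {δ : D → A} {ξ : D → H}

/-! ## The image of the core -/

section

variable {B : Type u} [NonUnitalCStarAlgebra B] {S : T.CKIndex δ → B}

/-- Projections of decorated words with equal termini are equivalent through S_{u,v}. By
irreducibility `u` has an extension that ends where `v` ends, and its projection lies below that of
`u`. -/
theorem IsCKFamily.diag_eq_zero (hS : T.IsCKFamily δ S) {u : T.DecoratedWord δ}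
    (h0 : S (T.diag u) = 0) (v : T.DecoratedWord δ) : S (T.diag v) = 0 := by
  have same : ∀ u v : T.DecoratedWord δ, u.t = v.t → S (T.diag u) = 0 → S (T.diag v) = 0 := by
    intro u v h h0
    have h1 : S (T.diag v) = S ⟨v, u, h.symm⟩ * S (T.diag u) * S ⟨u, v, h⟩ := by
      rw [diag, hS.mul_eq, hS.mul_eq]
    rw [h1, h0, mul_zero, zero_mul]
  obtain ⟨w, ho, ht⟩ := T.exists_word u.t v.t
  refine same (u.mul w ho.symm) v ?_ ?_
  · rw [DecoratedWord.mul_t, ht]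
  · have h1 := hS.isSummable (T.diag u) w.shape
    let w' : T.From w.shape (T.diag u).t := w.toFrom rfl ho.symm
    have h2 : S (T.diag (u.mul w ho.symm)) * S (T.diag u) = S (T.diag (u.mul w ho.symm)) := by
      rw [h1, Finset.mul_sum, Finset.sum_eq_single w']
      · exact hS.mul_eq _ _ _ _ _
      · intro x _ hx
        refine hS.diag_mul_diag (u.shape + w.shape) (u.mul w ho.symm) (u.mul x.wd x.o_eq) rfl rfl
          fun e => hx ?_
        exact From.ext (DecoratedWord.mul_inj e rfl).2.symm
      · simp
    rw [← h2, h0, mul_zero]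

theorem IsCKFamily.eq_zero (hS : T.IsCKFamily δ S) {u : T.DecoratedWord δ}
    (h0 : S (T.diag u) = 0) (i : T.CKIndex δ) : S i = 0 := by
  have h1 : S (T.diag i.fst) * S i = S i := hS.mul_eq _ _ _ _ _
  rw [← h1, hS.diag_eq_zero h0, zero_mul]

/-- Compressing x by the projections onto η_u and η_v gives ⟨η_u, x η_v⟩ times the matrix unit of
(u, v), whose image S_{u,v} is nonzero. So an x in the kernel has no nonzero matrix entry. -/
theorem levelHom_injective (hξ : IsAdaptedBasis ψ δ ξ) (hψ : Nondegenerate ψ)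
    (hS : T.IsCKFamily δ S) (h0 : ∀ u, S (T.diag u) ≠ 0) (n : Fin r → ℕ) :
    Function.Injective (levelHom hξ hψ hS n) := by
  refine (injective_iff_map_eq_zero _).2 fun x hx => ?_
  have key : ∀ u v : T.DecoratedWord δ, u.shape = n → v.shape = n →
      inner ℂ (vec ψ ξ u) ((x : H →L[ℂ] H) (vec ψ ξ v)) = 0 := by
    intro u v hu hv
    by_cases h : u.t = v.t
    · by_contra hne
      have e : theta ψ ξ (T.diag u) * x * theta ψ ξ (T.diag v) =
          inner ℂ (vec ψ ξ u) ((x : H →L[ℂ] H) (vec ψ ξ v)) • theta ψ ξ ⟨u, v, h⟩ := by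
        refine Subtype.ext (ContinuousLinearMap.ext fun z => ?_)
        change rankOne ℂ (vec ψ ξ u) (vec ψ ξ u) ((x : H →L[ℂ] H)
          (rankOne ℂ (vec ψ ξ v) (vec ψ ξ v) z)) = inner ℂ (vec ψ ξ u) ((x : H →L[ℂ] H)
          (vec ψ ξ v)) • rankOne ℂ (vec ψ ξ u) (vec ψ ξ v) z
        simp only [rankOne_apply, map_smul, smul_smul]
        rw [mul_comm]
      have e' := congrArg (levelHom hξ hψ hS n) e
      rw [map_mul, map_mul, hx, mul_zero, zero_mul, map_smul,
        levelHom_theta hξ hψ hS (i := ⟨u, v, h⟩) hu hv] at e'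
      have e3 : S ⟨u, v, h⟩ = 0 := (smul_eq_zero.1 e'.symm).resolve_left hne
      have e4 : S ⟨u, v, h⟩ * S ⟨v, u, h.symm⟩ = S (T.diag u) := hS.mul_eq _ _ _ _ _
      exact h0 u (by rw [← e4, e3, zero_mul])
    · obtain ⟨hx, -⟩ := (blockDiagonal_iff ψ).1 x.2.2
      rw [← proj_vec ξ u, inner_proj, ← mul_apply_eq_comp, hx, mul_apply_eq_comp,
        proj_vec_of_ne ξ _ h, map_zero, inner_zero_right]
  have hb := (hξ.basis hψ n)
  have h1 : ∀ v : T.DecoratedWord δ, v.shape = n → (x : H →L[ℂ] H) (vec ψ ξ v) = 0 := by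
    intro v hv
    refine (hξ.basis hψ n).repr.injective ?_
    rw [map_zero]
    ext u
    rw [HilbertBasis.repr_apply_apply, IsAdaptedBasis.basis_apply, key u.1 v u.2 hv]
    rfl
  refine Subtype.ext ?_
  refine ContinuousLinearMap.ext_on (s := Set.range (hξ.basis hψ n)) ?_ ?_
  · rw [Submodule.dense_iff_topologicalClosure_eq_top]
    exact (hξ.basis hψ n).dense_span
  · rintro _ ⟨v, rfl⟩
    rw [IsAdaptedBasis.basis_apply, h1 v.1 v.2]
    rfl

theorem isometry_limitHom (hξ : IsAdaptedBasis ψ δ ξ) (hψ : Nondegenerate ψ)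
    (hS : T.IsCKFamily δ S) (h0 : ∀ u, S (T.diag u) ≠ 0) : Isometry (limitHom hξ hψ hS) := by
  refine AddMonoidHomClass.isometry_of_norm _ fun x => ?_
  have hc := continuous_starHom (limitHom hξ hψ hS)
  have hcl : IsClosed {x | ‖limitHom hξ hψ hS x‖ = ‖x‖} :=
    isClosed_eq hc.norm continuous_norm
  refine hcl.closure_subset_iff.2 ?_ (dense_stages ψ x)
  rintro _ ⟨n, y, rfl⟩
  -- An injective homomorphism is isometric, so ‖y‖ is the norm of the image of y^{(n)}, and
  -- ‖y^{(n)}‖ ≤ ‖y‖.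
  have h1 := NonUnitalStarAlgHom.norm_map _ (levelHom_injective hξ hψ hS h0 n) y
  rw [← limitHom_stage] at h1
  refine le_antisymm (NonUnitalStarAlgHom.norm_apply_le _ _) ?_
  rw [h1]
  exact NonUnitalStarAlgHom.norm_apply_le _ _

end

/-- The generators of ℱ_m are images of units of degree 0, and the range is closed because the map
is isometric. Conversely the image of stage n lies in ℱ_n, and these stages are dense in ℰ. -/
theorem core_eq_range_limitHom (hξ : IsAdaptedBasis ψ δ ξ) (hψ : Nondegenerate ψ)
    (h0 : ∀ u : T.DecoratedWord δ, (Univ.gen (T.diag u) : T.CKAlgebra δ) ≠ 0) :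
    T.core δ = Set.range (limitHom hξ hψ (T.isCKFamily_gen δ)) := by
  set J := limitHom hξ hψ (T.isCKFamily_gen δ)
  have hJ : IsClosed (Set.range J) :=
    (isometry_limitHom hξ hψ (T.isCKFamily_gen δ) h0).isClosedEmbedding.isClosed_range
  refine Set.Subset.antisymm (closure_minimal (Set.iUnion_subset fun m => ?_) hJ) ?_
  · have hle : T.coreStage δ m ≤ NonUnitalStarAlgHom.range J := by
      refine NonUnitalStarSubalgebra.topologicalClosure_minimal _
        (NonUnitalStarAlgebra.adjoin_le ?_) (by simpa using hJ)
      rintro _ ⟨u, v, h, hu, hv, rfl⟩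
      refine ⟨unit ψ ξ ⟨u, v, h⟩, limitHom_unit hξ hψ _ ?_⟩
      rw [deg_eq, hu, hv, sub_self]
    intro x hx
    exact hle hx
  · rintro _ ⟨x, rfl⟩
    refine map_mem_closure (continuous_starHom J) (dense_stages ψ x) ?_
    rintro _ ⟨n, y, rfl⟩
    refine Set.mem_iUnion.2 ⟨n, ?_⟩
    have hcl : IsClosed (T.coreStage δ n : Set (T.CKAlgebra δ)) :=
      NonUnitalStarSubalgebra.isClosed_topologicalClosure _
    rw [limitHom_stage]
    refine dense_span_induction (hξ.dense_span_theta hψ n n)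
      (P := fun y => levelHom hξ hψ (T.isCKFamily_gen δ) n y ∈ T.coreStage δ n)
      (hcl.preimage (continuous_starHom (levelHom hξ hψ (T.isCKFamily_gen δ) n))) ?_ ?_ ?_ ?_ y
    · rintro _ ⟨i, h1, h2, rfl⟩
      rw [levelHom_theta hξ hψ _ h1 h2]
      exact NonUnitalStarSubalgebra.le_topologicalClosure _
        (NonUnitalStarAlgebra.subset_adjoin ℂ _ ⟨i.fst, i.snd, i.t_eq, h1, h2, rfl⟩)
    · rw [map_zero]; exact zero_mem _
    · intro a b ha hb; rw [map_add]; exact add_mem ha hb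
    · intro c a ha; rw [map_smul]; exact SMulMemClass.smul_mem c ha

theorem toCrossed_limitHom (hξ : IsAdaptedBasis ψ δ ξ) (hψ : Nondegenerate ψ)
    (x : LimitAlgebra ψ) : toCrossed hξ (limitHom hξ hψ (T.isCKFamily_gen δ) x) =
      CrossedProduct.incl (shiftAction ψ) x := by
  rw [CrossedProduct.incl, ← toCrossed_gradedMap hξ hψ 0 x]
  congr 1
  have hc := continuous_starHom (limitHom hξ hψ (T.isCKFamily_gen δ))
  refine dense_span_induction (hξ.dense_span_unit hψ 0) (P := fun x =>
    limitHom hξ hψ (T.isCKFamily_gen δ) x = gradedMap hξ hψ (T.isCKFamily_gen δ) 0 x)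
    (isClosed_eq hc (ContinuousLinearMap.continuous _)) ?_ (by simp only [map_zero]) ?_ ?_ x
  · rintro _ ⟨⟨i, hi⟩, rfl⟩
    rw [gradedMap_unit hξ hψ _ hi, limitHom_unit hξ hψ _ hi]
  · intro a b ha hb; simp only [map_add, ha, hb]
  · intro c a ha; simp only [map_smul, ha]

/-- The isomorphism `𝒜 ≅ ℰ ⋊ ℤ^r` takes the AF core to `ℰ`. -/
theorem crossedEquiv_image_core (hξ : IsAdaptedBasis ψ δ ξ) (hψ : Nondegenerate ψ) :
    crossedEquiv hξ hψ '' T.core δ = Set.range (CrossedProduct.incl (shiftAction ψ)) := by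
  by_cases h0 : ∀ u : T.DecoratedWord δ, (Univ.gen (T.diag u) : T.CKAlgebra δ) ≠ 0
  · rw [core_eq_range_limitHom hξ hψ h0, ← Set.range_comp]
    exact congrArg Set.range (funext fun x => toCrossed_limitHom hξ hψ x)
  -- If one diagonal generator vanished, so would all generators, and both algebras would be zero.
  -- This makes it unnecessary to show that the generators are nonzero.
  · push Not at h0
    obtain ⟨u, hu⟩ := h0
    have h1 : ∀ x : T.CKAlgebra δ, x = 0 := by
      refine dense_span_induction (T.dense_span_s δ) isClosed_singleton ?_ rfl ?_ ?_
      · rintro _ ⟨i, rfl⟩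
        exact (T.isCKFamily_gen δ).eq_zero hu i
      · rintro x y rfl rfl; exact add_zero _
      · rintro c x rfl; exact smul_zero _
    have h2 : ∀ y : CrossedProduct (shiftAction ψ), y = 0 := fun y => by
      obtain ⟨x, rfl⟩ := (crossedEquiv hξ hψ).surjective y
      rw [h1 x, map_zero]
    have hz : (0 : T.CKAlgebra δ) ∈ T.core δ :=
      subset_closure (Set.mem_iUnion.2 ⟨0, zero_mem _⟩)
    ext y
    exact ⟨fun _ => ⟨0, (h2 _).trans (h2 y).symm⟩, fun _ => ⟨0, hz, (h2 _).trans (h2 y).symm⟩⟩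

/-! ## `ℰ` is an AF algebra -/

/-- The span of the matrix units for words of shape `(n, …, n)` with decorations of code at most
`n`. -/
def IsAdaptedBasis.finiteStage (hξ : IsAdaptedBasis ψ δ ξ) (c : D → ℕ) (n : ℕ) :
    NonUnitalStarSubalgebra ℂ (LimitAlgebra ψ) where
  __ := Submodule.span ℂ (unit ψ ξ '' {i : T.CKIndex δ | i.fst.shape = (fun _ => n) ∧
    i.snd.shape = (fun _ => n) ∧ c i.fst.deco ≤ n ∧ c i.snd.deco ≤ n})
  mul_mem' {x y} hx hy := by
    have hx' := hx
    change _ ∈ Submodule.span ℂ _ at hx hy ⊢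
    clear hx'
    induction hx using Submodule.span_induction with
    | zero => rw [zero_mul]; exact zero_mem _
    | add x x' _ _ h h' => rw [add_mul]; exact add_mem h h'
    | smul a x _ h => rw [smul_mul_assoc]; exact Submodule.smul_mem _ a h
    | mem x hx =>
      obtain ⟨i, ⟨h1, h2, h3, h4⟩, rfl⟩ := hx
      induction hy using Submodule.span_induction with
      | zero => rw [mul_zero]; exact zero_mem _
      | add x x' _ _ h h' => rw [mul_add]; exact add_mem h h'
      | smul a x _ h => rw [mul_smul_comm]; exact Submodule.smul_mem _ a h
      | mem y hy =>
        obtain ⟨k, ⟨h1', h2', h3', h4'⟩, rfl⟩ := hy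
        have hd : i.deg = 0 := by rw [deg_eq, h1, h2, sub_self]
        have := hξ.unit_mul_act (h2.trans h1'.symm)
        rw [hd, CStarAction.act_zero] at this
        rw [this, CKIndex.compVal]
        split_ifs with hc
        · exact Submodule.subset_span ⟨i.comp k hc, ⟨h1, h2', h3, h4'⟩, rfl⟩
        · exact zero_mem _
  star_mem' {x} hx := by
    change _ ∈ Submodule.span ℂ _ at hx ⊢
    induction hx using Submodule.span_induction with
    | zero => rw [star_zero]; exact zero_mem _
    | add x x' _ _ h h' => rw [star_add]; exact add_mem h h'
    | smul a x _ h => rw [star_smul]; exact Submodule.smul_mem _ _ h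
    | mem x hx =>
      obtain ⟨i, ⟨h1, h2, h3, h4⟩, rfl⟩ := hx
      have hd : i.deg = 0 := by rw [deg_eq, h1, h2, sub_self]
      rw [star_unit, hd, CStarAction.act_zero]
      exact Submodule.subset_span ⟨_, ⟨h2, h1, h4, h3⟩, rfl⟩

theorem finite_decoratedWord {c : D → ℕ} (hc : Function.Injective c) (m : Fin r → ℕ) (n : ℕ) :
    {u : T.DecoratedWord δ | u.shape = m ∧ c u.deco ≤ n}.Finite := by
  have hfin : ((Set.Iic n) ×ˢ Set.range (T.ofWd : Wd T.M m → T.Word)).Finite :=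
    (Set.finite_Iic n).prod (Set.finite_range _)
  refine Set.Finite.of_injOn (f := fun u => (c u.deco, u.word)) ?_ ?_ hfin
  · rintro ⟨d, ⟨k, w⟩, h⟩ ⟨h1, h2⟩
    obtain rfl : k = m := h1
    exact ⟨h2, w, rfl⟩
  · intro u _ v _ e
    exact DecoratedWord.ext_of (hc (congrArg Prod.fst e)) (congrArg Prod.snd e)

/-- The sum rule lengthens both words to shape (n, …, n) and leaves the decorations alone. This
makes the finite stages increase and exhaust the units of degree 0. -/
theorem unit_mem_finiteStage (hξ : IsAdaptedBasis ψ δ ξ) {c : D → ℕ} {n : ℕ} {i : T.CKIndex δ}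
    (hi : i.deg = 0) (h1 : i.fst.shape ≤ fun _ => n) (h3 : c i.fst.deco ≤ n)
    (h4 : c i.snd.deco ≤ n) : unit ψ ξ i ∈ hξ.finiteStage c n := by
  rw [isSummable_unit ξ i ((fun _ => n) - i.fst.shape)]
  refine sum_mem fun w _ => ?_
  have h2 : i.snd.shape = i.fst.shape := by
    funext k
    have := congrFun hi k
    simp only [CKIndex.deg, Pi.zero_apply] at this
    omega
  refine Submodule.subset_span ⟨i.ext w.wd w.o_eq, ⟨?_, ?_, h3, h4⟩, rfl⟩
  · rw [CKIndex.ext_fst_shape, w.shape_eq, add_tsub_cancel_of_le h1]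
  · rw [CKIndex.ext_snd_shape, w.shape_eq, h2, add_tsub_cancel_of_le h1]

theorem isAF_limitAlgebra [Countable D] (hξ : IsAdaptedBasis ψ δ ξ) (hψ : Nondegenerate ψ) :
    IsAF (LimitAlgebra ψ) := by
  obtain ⟨c, hc⟩ := exists_injective_nat D
  have hmono : Monotone (hξ.finiteStage c) := by
    intro m n hmn x hx
    change x ∈ Submodule.span ℂ _ at hx
    induction hx using Submodule.span_induction with
    | zero => exact zero_mem _
    | add x x' _ _ h h' => exact add_mem h h'
    | smul a x _ h => exact SMulMemClass.smul_mem a h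
    | mem x hx =>
      obtain ⟨i, ⟨h1, h2, h3, h4⟩, rfl⟩ := hx
      exact unit_mem_finiteStage hξ (by rw [deg_eq, h1, h2, sub_self])
        (by rw [h1]; exact fun _ => hmn) (h3.trans hmn) (h4.trans hmn)
  refine ⟨hξ.finiteStage c, hmono, fun n => ?_, ?_⟩
  · refine FiniteDimensional.span_of_finite ℂ (Set.Finite.image _ ?_)
    have hfin := finite_decoratedWord (T := T) (δ := δ) hc (fun _ => n) n
    refine Set.Finite.of_injOn (f := fun i => (i.fst, i.snd)) ?_ ?_ (hfin.prod hfin)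
    · rintro i ⟨h1, h2, h3, h4⟩
      exact ⟨⟨h1, h3⟩, h2, h4⟩
    · intro i _ k _ e
      exact CKIndex.ext_eq (congrArg Prod.fst e) (congrArg Prod.snd e)
  · refine (hξ.dense_span_unit hψ 0).mono ?_
    intro x hx
    induction hx using Submodule.span_induction with
    | zero => exact Set.mem_iUnion.2 ⟨0, zero_mem _⟩
    | add x x' _ _ h h' =>
      obtain ⟨m, hm⟩ := Set.mem_iUnion.1 h
      obtain ⟨n, hn⟩ := Set.mem_iUnion.1 h'
      exact Set.mem_iUnion.2 ⟨max m n, add_mem (hmono (le_max_left m n) hm)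
        (hmono (le_max_right m n) hn)⟩
    | smul a x _ h =>
      obtain ⟨m, hm⟩ := Set.mem_iUnion.1 h
      exact Set.mem_iUnion.2 ⟨m, SMulMemClass.smul_mem a hm⟩
    | mem x hx =>
      obtain ⟨⟨i, hi⟩, rfl⟩ := hx
      -- A single number above all coordinates of the shape and the codes of both decorations.
      refine Set.mem_iUnion.2 ⟨∑ k, i.fst.shape k + c i.fst.deco + c i.snd.deco,
        unit_mem_finiteStage hξ hi (fun k => ?_) (by dsimp only; omega) (by dsimp only; omega)⟩
      have : i.fst.shape k ≤ ∑ k, i.fst.shape k :=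
        Finset.single_le_sum (f := i.fst.shape) (fun _ _ => Nat.zero_le _) (Finset.mem_univ k)
      dsimp only
      omega

end TransitionSystem

namespace TransitionSystem

open InnerProductSpace CStarRelations

variable {r : ℕ} {A : Type u} [Fintype A] {T : TransitionSystem r A}

/-! ## Aperiodicity: there are arbitrarily many words with a given terminus -/

/-- If words are determined by shape and terminus, then all words are periodic. -/
theorem not_unique_words (hr : 1 ≤ r) :
    ¬ ∀ w w' : T.Word, w.shape = w'.shape → w.t = w'.t → w = w' := by
  classical
  intro huniq
  -- For each letter a there is exactly one word of shape e_j ending in a; f sends a to its origin.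
  -- Every letter is the origin of some word of shape e_j, so f is onto and, A being finite, a
  -- permutation of finite order N.
  let j : Fin r := ⟨0, hr⟩
  choose e het hes using fun a => T.exists_pred a j
  let f : A → A := fun a => (e a).o
  have hf : Function.Surjective f := fun a => by
    obtain ⟨w, ho, hs⟩ := T.exists_succ a j
    refine ⟨w.t, ?_⟩
    have : e w.t = w := huniq _ _ ((hes _).trans hs.symm) (het _)
    change (e w.t).o = a
    rw [this, ho]
  let F : Equiv.Perm A := Equiv.ofBijective f
    (Finite.injective_iff_surjective.2 hf |>.bijective_of_finite)
  obtain ⟨N, hN, hFN⟩ := isOfFinOrder_iff_pow_eq_one.1 (isOfFinOrder_of_finite F)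
  have horig : ∀ n : ℕ, ∀ v : T.Word, v.shape = n • unitShape j → v.o = (F ^ n) v.t := by
    intro n
    induction n with
    | zero => intro v hv; rw [zero_smul] at hv; exact Word.o_eq_t hv
    | succ n ih =>
      intro v hv
      obtain ⟨u, w, h, hu, hw, rfl⟩ := v.exists_mul (m := unitShape j) (n := n • unitShape j)
        (by rw [hv, succ_nsmul, add_comm])
      have hue : u = e w.o := huniq _ _ (hu.trans (hes _).symm) (h.trans (het _).symm)
      rw [Word.mul_o, Word.mul_t, pow_succ', Equiv.Perm.mul_apply, ← ih w hw, hue]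
      rfl
  -- Words of shape N e_j begin and end with the same letter, so N e_j is a period of every word.
  obtain ⟨m, w, hw⟩ := T.nonperiodic (up (N • unitShape j)) (fun h => by
    have := congrFun h j
    simp [up, unitShape] at this
    omega)
  refine hw fun x y hx hy hxy => ?_
  have hx' : x = y + N • unitShape j := funext fun i => by
    have := hxy i
    simp only [up] at this
    rw [Pi.add_apply]
    exact_mod_cast this
  -- The word is cut at `y` and at `x = y + N e_j`; the two letters to compare are the ends of the
  -- middle piece.
  obtain ⟨u, z, h, hu, -, e1⟩ := (T.ofWd w).exists_mul_of_le (m := y) hy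
  have hzs : N • unitShape j ≤ z.shape := by
    have h1 : m = y + z.shape := by
      have := congrArg Word.shape e1
      rw [Word.mul_shape, hu] at this
      exact this
    rw [h1, hx'] at hx
    exact le_of_add_le_add_left hx
  obtain ⟨v, z', h', hv, -, rfl⟩ := z.exists_mul_of_le hzs
  have ey : w.at' y hy = u.t := by
    subst hu
    have : (T.ofWd w).wd.at' u.shape hy = u.wd.at' u.shape le_rfl := by
      rw [Word.at_congr e1 rfl hy le_self_add]
      exact Word.mul_at_left _ _ _ _ _ _
    exact this
  have ex : w.at' x hx = v.t := by
    subst hu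
    have hx2 : x = u.shape + v.shape := by rw [hx', hv]
    have : (T.ofWd w).wd.at' x hx = v.wd.at' v.shape le_rfl := by
      rw [Word.at_congr e1 hx2 hx (add_le_add le_rfl le_self_add)]
      exact (Word.mul_at_right _ _ _ _ le_self_add _).trans (Word.mul_at_left _ _ _ _ _ _)
    exact this
  rw [ey, ex, h, Word.mul_o, horig N v hv, hFN]
  rfl

/-- The map takes the final piece of shape `n`. It is onto because every letter is the terminus of a
word of shape `m`, which can be put in front. -/
theorem exists_surjective_to (T : TransitionSystem r A) (m n : Fin r → ℕ) (b : A) :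
    ∃ f : T.To (m + n) b → T.To n b, Function.Surjective f ∧
      ∀ (u v : T.Word) (h : u.t = v.o) (_ : u.shape = m) (hv : v.shape = n) (hb : v.t = b)
        (h1 : (u.mul v h).shape = m + n) (h2 : (u.mul v h).t = b),
        f ((u.mul v h).toTo h1 h2) = v.toTo hv hb := by
  have key : ∀ x : T.To (m + n) b, ∃ y : T.To n b, ∀ (u v : T.Word) (h : u.t = v.o),
      v.shape = n → x.wd = u.mul v h → v = y.wd := by
    intro x
    obtain ⟨u, v, h, hu, hv, e⟩ := x.wd.exists_mul (m := m) (n := n) rfl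
    have hvt : v.t = b := by rw [← x.t_eq, e, Word.mul_t]
    refine ⟨v.toTo hv hvt, fun u' v' h' hv' e' => ?_⟩
    rw [Word.toTo_wd]
    exact (Word.mul_inj_right (e'.symm.trans e) (hv'.trans hv.symm)).2
  choose f hf using key
  have h2 : ∀ (u v : T.Word) (h : u.t = v.o) (hu : u.shape = m) (hv : v.shape = n) (hb : v.t = b)
        (h1 : (u.mul v h).shape = m + n) (h2 : (u.mul v h).t = b),
        f ((u.mul v h).toTo h1 h2) = v.toTo hv hb := fun u v h hu hv hb h1 h2 => To.ext (by
    rw [Word.toTo_wd]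
    exact (hf _ u v h hv (Word.toTo_wd _ _ _)).symm)
  refine ⟨f, fun y => ?_, h2⟩
  obtain ⟨u, hut, hus⟩ := T.exists_word_to y.wd.o m
  refine ⟨(u.mul y.wd hut).toTo (by rw [Word.mul_shape, hus, y.shape_eq])
    (by rw [Word.mul_t, y.t_eq]), ?_⟩
  rw [h2 u y.wd hut hus y.shape_eq y.t_eq]
  exact To.ext (Word.toTo_wd _ _ _)

/-- The number of words ending in `b` grows with the shape. If it were bounded, it would attain its
maximum at some l₀; beyond l₀ taking final pieces would be injective, leaving only one way to
prolong a word to the left, and this contradicts `not_unique_words`. -/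
theorem exists_card_to_ge (hr : 1 ≤ r) (b : A) (N : ℕ) : ∃ l, N ≤ Fintype.card (T.To l b) := by
  classical
  by_contra! hlt
  have hmono : ∀ m n, Fintype.card (T.To n b) ≤ Fintype.card (T.To (m + n) b) := fun m n => by
    obtain ⟨f, hf, -⟩ := T.exists_surjective_to m n b
    exact Fintype.card_le_of_surjective f hf
  obtain ⟨l₀, hl₀⟩ : ∃ l₀, ∀ l, Fintype.card (T.To l b) ≤ Fintype.card (T.To l₀ b) := by
    have hbdd : BddAbove (Set.range fun l => Fintype.card (T.To l b)) :=
      ⟨N, by rintro _ ⟨l, rfl⟩; exact (hlt l).le⟩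
    obtain ⟨l₀, h⟩ := Nat.sSup_mem (Set.range_nonempty fun l => Fintype.card (T.To l b)) hbdd
    exact ⟨l₀, fun l => by
      have h1 := le_csSup hbdd ⟨l, rfl⟩
      rwa [← h] at h1⟩
  have hpred : ∀ (m : Fin r → ℕ) (u u' v : T.Word) (h : u.t = v.o) (h' : u'.t = v.o), v.t = b →
      u.shape = m → u'.shape = m → l₀ ≤ v.shape → u = u' := by
    intro m u u' v h h' hv hu hu' hle
    obtain ⟨f, hf, hf'⟩ := T.exists_surjective_to m v.shape b
    have hcard : Fintype.card (T.To (m + v.shape) b) = Fintype.card (T.To v.shape b) := by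
      refine le_antisymm ((hl₀ _).trans ?_) (hmono _ _)
      have := hmono (v.shape - l₀) l₀
      rwa [tsub_add_cancel_of_le hle] at this
    have hinj : Function.Injective f :=
      ((Fintype.bijective_iff_surjective_and_card f).2 ⟨hf, hcard⟩).1
    have h1 : (u.mul v h).shape = m + v.shape := by rw [Word.mul_shape, hu]
    have h2 : (u'.mul v h').shape = m + v.shape := by rw [Word.mul_shape, hu']
    have h3 : (u.mul v h).t = b := by rw [Word.mul_t, hv]
    have h4 : (u'.mul v h').t = b := by rw [Word.mul_t, hv]
    have e := hinj ((hf' u v h hu rfl hv h1 h3).trans (hf' u' v h' hu' rfl hv h2 h4).symm)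
    have e' := congrArg To.wd e
    rw [Word.toTo_wd, Word.toTo_wd] at e'
    exact (Word.mul_inj e' (hu.trans hu'.symm)).1
  -- Two words of equal shape and terminus are continued by one word that is longer than l₀ and ends
  -- in `b`.
  refine not_unique_words hr (T := T) fun w w' hs ht => ?_
  obtain ⟨x, hxo, hxs⟩ := T.exists_word_from w.t l₀
  obtain ⟨y, hyo, hyt⟩ := T.exists_word x.t b
  refine hpred w.shape w w' (x.mul y hyo.symm) ?_ ?_ ?_ rfl hs.symm ?_
  · rw [Word.mul_o, hxo]
  · rw [Word.mul_o, hxo, ht]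
  · rw [Word.mul_t, hyt]
  · rw [Word.mul_shape, hxs]; exact le_self_add

/-! ## Adapted bases -/

variable {H : Type u} [NormedAddCommGroup H] [InnerProductSpace ℂ H] [CompleteSpace H]
  (ψ : T.RevAlgebra →⋆ₙₐ[ℂ] (H →L[ℂ] H))

/-- The subspace `H_a` of `H`. -/
def block (a : A) : Submodule ℂ H := LinearMap.ker (proj ψ a - 1 : H →L[ℂ] H).toLinearMap

theorem mem_block {a : A} {x : H} : x ∈ block ψ a ↔ proj ψ a x = x := by
  rw [block, LinearMap.mem_ker]
  exact sub_eq_zero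

theorem proj_mem_block (a : A) (x : H) : proj ψ a x ∈ block ψ a := by
  rw [mem_block, ← mul_apply_eq_comp, proj_mul_self]

instance (a : A) : CompleteSpace (block ψ a) :=
  (ContinuousLinearMap.isClosed_ker (proj ψ a - 1 : H →L[ℂ] H)).completeSpace_coe

variable {ψ}

/-- If H_b were zero, then V_w = 0 for every word w into b, hence p_{o(w)} = V_w^* V_w = 0. By
irreducibility every letter is such an origin, while the p_a add up to 1 ≠ 0. -/
theorem proj_ne_zero [Nontrivial H] (hψ : Nondegenerate ψ) (b : A) : proj ψ b ≠ 0 := by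
  intro h0
  have h1 : ∀ a, proj ψ a = 0 := fun a => by
    obtain ⟨w, rfl, hw⟩ := T.exists_word a b
    have h2 : shiftOp ψ w.wd = 0 := by
      have hwb : w.wd.t = b := hw
      rw [← proj_mul_shiftOp ψ w.wd, hwb, h0, zero_mul]
    have h3 := shiftOpAdj_mul_self ψ w.wd
    rw [h2, mul_zero] at h3
    exact h3.symm
  have h4 := sum_proj hψ
  simp only [h1, Finset.sum_const_zero] at h4
  exact zero_ne_one h4

/-- The words of one shape that end in b yield nonzero, mutually orthogonal vectors V_w x with x
chosen according to o(w), and by aperiodicity there are more of these words than any given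
dimension. -/
theorem not_finiteDimensional_block [Nontrivial H] (hr : 1 ≤ r) (hψ : Nondegenerate ψ) (b : A) :
    ¬ FiniteDimensional ℂ (block ψ b) := by
  classical
  intro hfin
  obtain ⟨l, hl⟩ := exists_card_to_ge (T := T) hr b (Module.finrank ℂ (block ψ b) + 1)
  have hne : ∀ a, ∃ x : H, proj ψ a x ≠ 0 := fun a => by
    by_contra! h
    exact proj_ne_zero hψ a (ContinuousLinearMap.ext h)
  choose x hx using hne
  let v : T.To l b → block ψ b := fun w => ⟨shiftOp ψ w.1 (x w.1.o), by
    rw [mem_block, ← mul_apply_eq_comp]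
    have h1 := proj_mul_shiftOp ψ w.1
    have hb : w.1.t = b := w.2
    rw [hb] at h1
    rw [h1]⟩
  have hv : LinearIndependent ℂ v := by
    refine linearIndependent_of_ne_zero_of_inner_eq_zero (fun w hw => ?_) fun w w' hww => ?_
    · have h1 : shiftOp ψ w.1 (x w.1.o) = 0 := congrArg Subtype.val hw
      have h2 := congrArg (shiftOpAdj ψ w.1) h1
      rw [← mul_apply_eq_comp, shiftOpAdj_mul_self, map_zero] at h2
      exact hx _ h2
    · change inner ℂ (shiftOp ψ w.1 (x w.1.o)) (shiftOp ψ w'.1 (x w'.1.o)) = 0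
      rw [inner_shiftOp, ← mul_apply_eq_comp, shiftOpAdj_mul_of_ne ψ fun e => hww (Subtype.ext e),
        zero_apply, inner_zero_right]
  have := hv.fintype_card_le_finrank
  omega

/-- Orthonormal vectors have distance √2, so balls of radius 1/2 around them are disjoint open sets
in a separable space. -/
theorem _root_.Orthonormal.countable {ι K : Type*} [NormedAddCommGroup K] [InnerProductSpace ℂ K]
    [TopologicalSpace.SeparableSpace K] {e : ι → K} (he : Orthonormal ℂ e) : Countable ι := by
  have hd : ∀ i j, i ≠ j → 1 ≤ dist (e i) (e j) := fun i j hij => by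
    have h1 : ‖e i - e j‖ ^ 2 = 2 := by
      rw [@norm_sub_sq ℂ, he.1 i, he.1 j, he.2 hij]
      norm_num
    rw [dist_eq_norm]
    nlinarith [norm_nonneg (e i - e j)]
  refine Pairwise.countable_of_isOpen_disjoint (s := fun i => Metric.ball (e i) (1 / 2))
    (fun i j hij => Metric.ball_disjoint_ball ?_) (fun i => Metric.isOpen_ball)
    fun i => ⟨e i, Metric.mem_ball_self (by norm_num)⟩
  have := hd i j hij
  linarith

theorem exists_block_basis [Nontrivial H] [TopologicalSpace.SeparableSpace H] (hr : 1 ≤ r)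
    (hψ : Nondegenerate ψ) (b : A) (I : Type u) [Countable I] [Infinite I] :
    Nonempty (HilbertBasis I ℂ (block ψ b)) := by
  obtain ⟨w, e, he⟩ := exists_hilbertBasis ℂ (block ψ b)
  have : TopologicalSpace.SeparableSpace (block ψ b) :=
    inferInstance
  have hc : Countable w := e.orthonormal.countable
  have hi : Infinite w := by
    by_contra hfin
    rw [not_infinite_iff_finite] at hfin
    refine not_finiteDimensional_block hr hψ b ?_
    have : Fintype w := Fintype.ofFinite w
    exact (e.toOrthonormalBasis).toBasis.finiteDimensional_of_finite
  obtain ⟨f⟩ : Nonempty (w ≃ I) := nonempty_equiv_of_countable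
  refine ⟨HilbertBasis.mk (e.orthonormal.comp f.symm f.symm.injective) ?_⟩
  rw [EquivLike.range_comp, e.dense_span]

/-- Each H_a is separable and infinite-dimensional, so it has a basis indexed by the countably
infinite fibre of δ over a. Since H is the orthogonal sum of the H_a, these bases together form a
basis of H. -/
theorem exists_isAdaptedBasis [Nontrivial H] [TopologicalSpace.SeparableSpace H] (hr : 1 ≤ r)
    (hψ : Nondegenerate ψ) {D : Type u} [Countable D] (δ : D → A)
    (hD : ∀ a, Infinite {d // δ d = a}) : ∃ ξ : D → H, IsAdaptedBasis ψ δ ξ := by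
  classical
  let e := fun a => (exists_block_basis hr hψ a {d // δ d = a}).some
  have hproj : ∀ d, proj ψ (δ d) (e (δ d) ⟨d, rfl⟩ : H) = e (δ d) ⟨d, rfl⟩ := fun d =>
    (mem_block ψ).1 (e (δ d) ⟨d, rfl⟩).2
  have heq : ∀ (a : A) (d : {d // δ d = a}), (e (δ d.1) ⟨d.1, rfl⟩ : H) = e a d := by
    rintro a ⟨d, rfl⟩; rfl
  refine ⟨fun d => e (δ d) ⟨d, rfl⟩, hproj, ?_, fun ζ hζ => ?_⟩
  · rw [orthonormal_iff_ite]
    intro d d'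
    by_cases h : δ d = δ d'
    · rw [heq (δ d') ⟨d, h⟩, heq (δ d') ⟨d', rfl⟩, ← Submodule.coe_inner,
        orthonormal_iff_ite.1 (e (δ d')).orthonormal]
      simp
    · rw [if_neg fun e => h (congrArg δ e), ← hproj d, inner_proj, ← hproj d', ← mul_apply_eq_comp,
        proj_mul_of_ne ψ h, zero_apply, inner_zero_right]
  · have h1 : ∀ a, proj ψ a ζ = 0 := fun a => by
      have h2 : (⟨proj ψ a ζ, proj_mem_block ψ a ζ⟩ : block ψ a) = 0 := by
        refine (e a).repr.injective ?_
        rw [map_zero]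
        ext d
        rw [HilbertBasis.repr_apply_apply, Submodule.coe_inner]
        have h3 : proj ψ a (e a d : H) = e a d := (mem_block ψ).1 (e a d).2
        change inner ℂ (e a d : H) (proj ψ a ζ) = 0
        rw [← inner_proj, h3, ← heq a d]
        exact hζ d.1
      exact congrArg Subtype.val h2
    have h5 := congrArg (fun x : H →L[ℂ] H => x ζ) (sum_proj hψ)
    simp only [sum_apply, h1, Finset.sum_const_zero] at h5
    exact h5.symm

end TransitionSystem

/-! ## Partial isometries given by partial bijections -/

namespace PEquiv

/-- The partial bijection with a given graph. -/
def ofRel {X Z : Type*} (R : X → Z → Prop) (h1 : ∀ x z z', R x z → R x z' → z = z')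
    (h2 : ∀ x x' z, R x z → R x' z → x = x') : X ≃. Z :=
  open Classical in
  { toFun := fun x => if h : ∃ z, R x z then some h.choose else none
    invFun := fun z => if h : ∃ x, R x z then some h.choose else none
    inv := fun x z => by
      constructor
      · intro h
        split_ifs at h with hz
        obtain rfl := Option.some_injective _ h
        have h3 : ∃ z', R hz.choose z' := ⟨z, hz.choose_spec⟩
        rw [dif_pos h3]
        exact congrArg some (h1 _ _ _ h3.choose_spec hz.choose_spec)
      · intro h
        split_ifs at h with hx
        obtain rfl := Option.some_injective _ h
        have h3 : ∃ x', R x' hx.choose := ⟨x, hx.choose_spec⟩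
        rw [dif_pos h3]
        exact congrArg some (h2 _ _ _ h3.choose_spec hx.choose_spec) }

theorem mem_ofRel {X Z : Type*} {R : X → Z → Prop} {h1 : ∀ x z z', R x z → R x z' → z = z'}
    {h2 : ∀ x x' z, R x z → R x' z → x = x'} {x : X} {z : Z} : z ∈ ofRel R h1 h2 x ↔ R x z := by
  classical
  change (if h : ∃ z, R x z then some h.choose else none) = some z ↔ _
  constructor
  · intro h
    split_ifs at h with hx
    obtain rfl := Option.some_injective _ h
    exact hx.choose_spec
  · intro h
    rw [dif_pos ⟨z, h⟩]
    exact congrArg some (h1 _ _ _ (Exists.choose_spec (p := fun z => R x z) ⟨z, h⟩) h)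

variable {X : Type u}

/-- The partial inverse is injective where it is defined, so no preimage is counted twice. This
gives the contraction bound for the operator on ℓ². -/
theorem exists_sum_elim_eq (f : X ≃. X) (g : X → ℝ) (s : Finset X) :
    ∃ s' : Finset X, (∀ x ∈ s', ∃ y ∈ s, f.symm y = some x) ∧
      ∑ y ∈ s, (f.symm y).elim 0 g = ∑ x ∈ s', g x := by
  classical
  induction s using Finset.induction_on with
  | empty => exact ⟨∅, by simp, by simp⟩
  | insert y s hy ih =>
    obtain ⟨s', h1, h2⟩ := ih
    rw [Finset.sum_insert hy, h2]
    cases hf : f.symm y with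
    | none =>
      exact ⟨s', fun x hx => let ⟨z, hz, e⟩ := h1 x hx
        ⟨z, Finset.mem_insert_of_mem hz, e⟩, by simp⟩
    | some x =>
      have hx : x ∉ s' := fun hx => by
        obtain ⟨z, hz, e⟩ := h1 x hx
        rw [f.symm.inj hf e] at hy
        exact hy hz
      refine ⟨insert x s', fun x' hx' => ?_, by rw [Finset.sum_insert hx]; rfl⟩
      rcases Finset.mem_insert.1 hx' with rfl | hx'
      · exact ⟨y, Finset.mem_insert_self _ _, hf⟩
      · obtain ⟨z, hz, e⟩ := h1 x' hx'
        exact ⟨z, Finset.mem_insert_of_mem hz, e⟩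

theorem sum_norm_elim_le (f : X ≃. X) (ξ : lp (fun _ : X => ℂ) 2) (s : Finset X) :
    ∑ y ∈ s, ‖(f.symm y).elim (0 : ℂ) ξ‖ ^ (2 : ENNReal).toReal ≤ ‖ξ‖ ^ (2 : ENNReal).toReal := by
  obtain ⟨s', -, h⟩ := f.exists_sum_elim_eq (fun x => ‖ξ x‖ ^ (2 : ENNReal).toReal) s
  refine le_trans (le_of_eq ?_) (lp.sum_rpow_le_norm_rpow (by norm_num) ξ s')
  rw [← h]
  refine Finset.sum_congr rfl fun y _ => ?_
  cases f.symm y <;> simp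

/-- The partial isometry of `ℓ²` that takes `δ_x` to `δ_{f(x)}`. -/
def lpMap (f : X ≃. X) : lp (fun _ : X => ℂ) 2 →L[ℂ] lp (fun _ : X => ℂ) 2 :=
  LinearMap.mkContinuous
    { toFun := fun ξ => ⟨fun y => (f.symm y).elim (0 : ℂ) ξ, memℓp_gen' (f.sum_norm_elim_le ξ)⟩
      map_add' := fun ξ η => by
        ext y
        change (f.symm y).elim (0 : ℂ) (ξ + η : lp (fun _ : X => ℂ) 2) =
          (f.symm y).elim (0 : ℂ) ξ + (f.symm y).elim (0 : ℂ) η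
        cases f.symm y
        · exact (add_zero (0 : ℂ)).symm
        · rfl
      map_smul' := fun c ξ => by
        ext y
        change (f.symm y).elim (0 : ℂ) (c • ξ : lp (fun _ : X => ℂ) 2) =
          c • (f.symm y).elim (0 : ℂ) ξ
        cases f.symm y
        · exact (smul_zero c).symm
        · rfl } 1
    fun ξ => by
      rw [one_mul]
      exact lp.norm_le_of_forall_sum_le (by norm_num) (norm_nonneg _) (f.sum_norm_elim_le ξ)

theorem lpMap_apply (f : X ≃. X) (ξ : lp (fun _ : X => ℂ) 2) (y : X) :
    f.lpMap ξ y = (f.symm y).elim (0 : ℂ) ξ := rfl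

theorem lpMap_trans (f g : X ≃. X) : (f.trans g).lpMap = g.lpMap * f.lpMap := by
  ext ξ y
  rw [mul_apply_eq_comp, lpMap_apply, lpMap_apply]
  change ((g.symm y).bind f.symm).elim (0 : ℂ) ξ = _
  cases g.symm y <;> rfl

/-- Both inner products are sums over the graph of the partial bijection, indexed by its two ends.
-/
theorem star_lpMap (f : X ≃. X) : star f.lpMap = f.symm.lpMap := by
  rw [ContinuousLinearMap.star_eq_adjoint, eq_comm, ContinuousLinearMap.eq_adjoint_iff]
  intro ξ η
  rw [lp.inner_eq_tsum, lp.inner_eq_tsum]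
  simp only [lpMap_apply, symm_symm]
  have hs : ∀ x : Function.support fun x => inner ℂ (ξ x) ((f.symm x).elim (0 : ℂ) η),
      (f.symm x.1).isSome := fun x => by
    by_contra h
    refine x.2 ?_
    rw [Option.not_isSome_iff_eq_none] at h
    simp only [h, Option.elim_none, inner_zero_right]
  refine tsum_eq_tsum_of_ne_zero_bij (fun x => (f.symm x.1).get (hs x)) ?_ ?_ ?_
  · intro x x' h
    have h1 : f.symm x.1 = some ((f.symm x.1).get (hs x)) := (Option.some_get _).symm
    have h2 : f.symm x'.1 = some ((f.symm x.1).get (hs x)) := by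
      have h' : (f.symm x.1).get (hs x) = (f.symm x'.1).get (hs x') := h
      rw [h']; exact (Option.some_get _).symm
    exact Subtype.ext (f.symm.inj h1 h2)
  · intro y hy
    cases hf : f y with
    | none => exact absurd (by simp only [hf, Option.elim_none, inner_zero_left]) hy
    | some x =>
      have hx : f.symm x = some y := f.eq_some_iff.2 hf
      refine ⟨⟨x, ?_⟩, ?_⟩
      · rw [Function.mem_support] at hy ⊢
        simpa only [hf, hx, Option.elim_some] using hy
      · simp only [hx, Option.get_some]
  · intro x
    obtain ⟨y, hy⟩ := Option.isSome_iff_exists.1 (hs x)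
    have hx : f y = some x.1 := f.eq_some_iff.1 hy
    simp only [hy, Option.get_some, Option.elim_some, hx]

end PEquiv

namespace TransitionSystem

open InnerProductSpace CStarRelations

variable {r : ℕ} {A : Type u} [Fintype A] (T : TransitionSystem r A)

/-! ## The extensions of the truncations of a word that is infinite to the left -/

variable (a₀ : A)

/-- A word of shape `(1, …, 1)` with terminus `a`. -/
def blockTo (a : A) : T.Word := (T.exists_word_to a fun _ => 1).choose

theorem blockTo_t (a : A) : (T.blockTo a).t = a := (T.exists_word_to a fun _ => 1).choose_spec.1

theorem blockTo_shape (a : A) : (T.blockTo a).shape = fun _ => 1 :=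
  (T.exists_word_to a fun _ => 1).choose_spec.2

/-- The letters at `0, -(1, …, 1), -(2, …, 2), …` of a word that is infinite to the left. -/
def leftLetter : ℕ → A
  | 0 => a₀
  | n + 1 => (T.blockTo (leftLetter n)).o

/-- The finite extensions of the truncations of a word that is infinite to the left. -/
structure LeftPair : Type u where
  level : ℕ
  word : T.Word
  o_eq : word.o = T.leftLetter a₀ level

variable {T a₀}

namespace LeftPair

theorem ext_of {y y' : T.LeftPair a₀} (h : y.level = y'.level) (h' : y.word = y'.word) :
    y = y' := by
  obtain ⟨n, u, hu⟩ := y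
  obtain ⟨n', u', hu'⟩ := y'
  obtain rfl : n = n' := h
  obtain rfl : u = u' := h'
  rfl

/-- The terminus. -/
def t (y : T.LeftPair a₀) : A := y.word.t

theorem blockTo_t_eq (y : T.LeftPair a₀) :
    (T.blockTo (T.leftLetter a₀ y.level)).t = y.word.o := (T.blockTo_t _).trans y.o_eq.symm

/-- Truncate one block further to the left. -/
def step (y : T.LeftPair a₀) : T.LeftPair a₀ :=
  ⟨y.level + 1, (T.blockTo (T.leftLetter a₀ y.level)).mul y.word y.blockTo_t_eq,
    Word.mul_o _ _ y.blockTo_t_eq⟩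

/-- The extension by a word to the right. -/
def mul (y : T.LeftPair a₀) (u : T.Word) (h : y.t = u.o) : T.LeftPair a₀ :=
  ⟨y.level, y.word.mul u h, (Word.mul_o _ _ h).trans y.o_eq⟩

theorem step_t (y : T.LeftPair a₀) : y.step.t = y.t := Word.mul_t _ _ y.blockTo_t_eq

theorem mul_t (y : T.LeftPair a₀) (u : T.Word) (h : y.t = u.o) : (y.mul u h).t = u.t :=
  Word.mul_t _ _ h

theorem mul_letter (y : T.LeftPair a₀) {a : A} (h : y.t = (Word.letter T a).o) :
    y.mul (Word.letter T a) h = y := ext_of rfl (Word.mul_letter _ h)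

theorem mul_mul (y : T.LeftPair a₀) {u v : T.Word} (h : y.t = u.o) (h' : u.t = v.o) :
    (y.mul u h).mul v ((mul_t _ _ _).trans h') =
      y.mul (u.mul v h') (h.trans (Word.mul_o _ _ _).symm) :=
  ext_of rfl (Word.mul_assoc' h ((mul_t y u h).trans h') h' (h.trans (Word.mul_o _ _ _).symm))

theorem iterate_t (k : ℕ) (y : T.LeftPair a₀) : (step^[k] y).t = y.t := by
  induction k with
  | zero => rfl
  | succ k ih => rw [Function.iterate_succ_apply', step_t, ih]

theorem step_mul (y : T.LeftPair a₀) (u : T.Word) (h : y.t = u.o) :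
    (y.mul u h).step = y.step.mul u (y.step_t.trans h) :=
  ext_of rfl (Word.mul_assoc' y.blockTo_t_eq (y.step_t.trans h) h (y.mul u h).blockTo_t_eq).symm

theorem mul_congr {y y' : T.LeftPair a₀} (e : y = y') (u : T.Word) (h : y.t = u.o)
    (h' : y'.t = u.o) : y.mul u h = y'.mul u h' := by
  subst e; rfl

theorem iterate_mul (k : ℕ) (y : T.LeftPair a₀) (u : T.Word) (h : y.t = u.o) :
    step^[k] (y.mul u h) = (step^[k] y).mul u ((iterate_t k y).trans h) := by
  induction k with
  | zero => rfl
  | succ k ih =>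
    rw [Function.iterate_succ_apply', ih, step_mul]
    exact mul_congr (Function.iterate_succ_apply' _ _ _).symm _ _ _

theorem mul_inj {y y' : T.LeftPair a₀} {u u' : T.Word} {h : y.t = u.o} {h' : y'.t = u'.o}
    (e : y.mul u h = y'.mul u' h') (hs : u.shape = u'.shape) : y = y' ∧ u = u' := by
  obtain ⟨e3, e4⟩ := Word.mul_inj_right (h := h) (h' := h') (congrArg LeftPair.word e) hs
  have e5 : (y.mul u h).level = (y'.mul u' h').level := congrArg LeftPair.level e
  exact ⟨ext_of e5 e3, e4⟩

theorem le_iterate_shape (k : ℕ) (y : T.LeftPair a₀) (i : Fin r) :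
    k ≤ (step^[k] y).word.shape i := by
  induction k with
  | zero => exact Nat.zero_le _
  | succ k ih =>
    rw [Function.iterate_succ_apply']
    have h1 : (step (step^[k] y)).word.shape =
        (T.blockTo (T.leftLetter a₀ (step^[k] y).level)).shape + (step^[k] y).word.shape := rfl
    rw [h1, Pi.add_apply, blockTo_shape]
    dsimp only
    omega

/-- Each step adds (1, …, 1) on the left, so after `∑ i, l i` steps the word has a final piece of
shape `l`. -/
theorem exists_iterate_eq_mul (y : T.LeftPair a₀) (l : Fin r → ℕ) :
    ∃ (k : ℕ) (y' : T.LeftPair a₀) (u : T.Word) (h : y'.t = u.o), u.shape = l ∧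
      step^[k] y = y'.mul u h := by
  have hk : l ≤ (step^[∑ i, l i] y).word.shape := fun i =>
    (Finset.single_le_sum (f := l) (fun _ _ => Nat.zero_le _) (Finset.mem_univ i)).trans
      (le_iterate_shape _ _ _)
  obtain ⟨v, u, h, -, hu, e⟩ := (step^[∑ i, l i] y).word.exists_mul (tsub_add_cancel_of_le hk).symm
  refine ⟨∑ i, l i, ⟨(step^[∑ i, l i] y).level, v, ?_⟩, u, h, hu, ?_⟩
  · rw [← (step^[∑ i, l i] y).o_eq, e, Word.mul_o]
  · exact ext_of rfl e

/-- A pair of level n stands for an infinite word cut off at position -n(1, …, 1). Two pairs stand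
for the same infinite word if they agree once both are cut off further to the left; the two numbers
of steps differ when the levels do. -/
instance setoid : Setoid (T.LeftPair a₀) where
  r y y' := ∃ k k', step^[k] y = step^[k'] y'
  iseqv := by
    refine ⟨fun y => ⟨0, 0, rfl⟩, fun ⟨k, k', h⟩ => ⟨k', k, h.symm⟩, ?_⟩
    rintro x y z ⟨k, k', h⟩ ⟨l, l', h'⟩
    refine ⟨l + k, k' + l', ?_⟩
    rw [Function.iterate_add_apply, h, ← Function.iterate_add_apply, add_comm,
      Function.iterate_add_apply, h', ← Function.iterate_add_apply]

theorem step_equiv (k : ℕ) (y : T.LeftPair a₀) : step^[k] y ≈ y := ⟨0, k, rfl⟩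

theorem t_eq_of_equiv {y y' : T.LeftPair a₀} (h : y ≈ y') : y.t = y'.t := by
  obtain ⟨k, k', h⟩ := h
  rw [← iterate_t k, h, iterate_t]

theorem mul_equiv {y y' : T.LeftPair a₀} (e : y ≈ y') (u : T.Word) (h : y.t = u.o)
    (h' : y'.t = u.o) : y.mul u h ≈ y'.mul u h' := by
  obtain ⟨k, k', e⟩ := e
  refine ⟨k, k', ?_⟩
  rw [iterate_mul, iterate_mul]
  exact mul_congr e _ _ _

theorem equiv_of_mul_equiv {y y' : T.LeftPair a₀} {u u' : T.Word} {h : y.t = u.o} {h' : y'.t = u'.o}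
    (e : y.mul u h ≈ y'.mul u' h') (hs : u.shape = u'.shape) : y ≈ y' ∧ u = u' := by
  obtain ⟨k, k', e⟩ := e
  rw [iterate_mul, iterate_mul] at e
  obtain ⟨e1, e2⟩ := mul_inj e hs
  exact ⟨⟨k, k', e1⟩, e2⟩

end LeftPair

variable (T a₀) in
/-- The words that are infinite to the left and agree with a given one far to the left. -/
def TailClass : Type u := Quotient (LeftPair.setoid (T := T) (a₀ := a₀))

/-! ### Extension to the right as a partial bijection, and the resulting representation -/

namespace TailClass

/-- The terminus. -/
def t : T.TailClass a₀ → A := Quotient.lift LeftPair.t fun _ _ h => LeftPair.t_eq_of_equiv h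

/-- The relation `z = xu`. -/
def Extends (u : T.Word) (x z : T.TailClass a₀) : Prop :=
  ∃ (y : T.LeftPair a₀) (h : y.t = u.o), x = Quotient.mk _ y ∧ z = Quotient.mk _ (y.mul u h)

theorem Extends.right_unique {u : T.Word} {x z z' : T.TailClass a₀} (h : Extends u x z)
    (h' : Extends u x z') : z = z' := by
  obtain ⟨y, hy, rfl, rfl⟩ := h
  obtain ⟨y', hy', e, rfl⟩ := h'
  exact Quotient.sound (LeftPair.mul_equiv (Quotient.exact e) u hy hy')

/-- An infinite word determines its final piece of a given shape and what precedes it; this descends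
from factorization of finite words on a common truncation. -/
theorem Extends.left_unique {u u' : T.Word} {x x' z : T.TailClass a₀} (h : Extends u x z)
    (h' : Extends u' x' z) (hs : u.shape = u'.shape) : x = x' ∧ u = u' := by
  obtain ⟨y, hy, rfl, rfl⟩ := h
  obtain ⟨y', hy', rfl, e⟩ := h'
  obtain ⟨e1, e2⟩ := LeftPair.equiv_of_mul_equiv (Quotient.exact e) hs
  exact ⟨Quotient.sound e1, e2⟩

theorem Extends.t_left {u : T.Word} {x z : T.TailClass a₀} (h : Extends u x z) : x.t = u.o := by
  obtain ⟨y, hy, rfl, rfl⟩ := h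
  exact hy

theorem Extends.t_right {u : T.Word} {x z : T.TailClass a₀} (h : Extends u x z) : z.t = u.t := by
  obtain ⟨y, hy, rfl, rfl⟩ := h
  exact LeftPair.mul_t _ _ _

theorem exists_extends {u : T.Word} {x : T.TailClass a₀} (h : x.t = u.o) : ∃ z, Extends u x z := by
  induction x using Quotient.inductionOn with | _ y => ?_
  exact ⟨_, y, h, rfl, rfl⟩

theorem exists_extends_to (z : T.TailClass a₀) (l : Fin r → ℕ) :
    ∃ (u : T.Word) (x : T.TailClass a₀), u.shape = l ∧ Extends u x z := by
  induction z using Quotient.inductionOn with | _ y => ?_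
  obtain ⟨k, y', u, h, hu, e⟩ := y.exists_iterate_eq_mul l
  refine ⟨u, Quotient.mk _ y', hu, y', h, rfl, ?_⟩
  rw [← e]
  exact Quotient.sound (Setoid.symm (LeftPair.step_equiv k y))

theorem extends_letter {a : A} {x z : T.TailClass a₀} :
    Extends (Word.letter T a) x z ↔ x = z ∧ x.t = a := by
  constructor
  · rintro ⟨y, h, rfl, rfl⟩
    exact ⟨congrArg _ (y.mul_letter h).symm, h⟩
  · rintro ⟨rfl, h⟩
    induction x using Quotient.inductionOn with | _ y => ?_
    exact ⟨y, h, rfl, congrArg _ (y.mul_letter h).symm⟩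

theorem extends_mul {u v : T.Word} (h : u.t = v.o) {x z : T.TailClass a₀} :
    Extends (u.mul v h) x z ↔ ∃ y, Extends u x y ∧ Extends v y z := by
  constructor
  · rintro ⟨y, hy, rfl, rfl⟩
    have hyu : y.t = u.o := hy.trans (Word.mul_o _ _ _)
    refine ⟨_, ⟨y, hyu, rfl, rfl⟩, y.mul u hyu, (LeftPair.mul_t _ _ _).trans h, rfl, ?_⟩
    exact congrArg _ (y.mul_mul hyu h).symm
  · rintro ⟨_, ⟨y, hy, rfl, rfl⟩, hv⟩
    have hyv : (y.mul u hy).t = v.o := (LeftPair.mul_t _ _ _).trans h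
    refine ⟨y, hy.trans (Word.mul_o _ _ _).symm, rfl,
      hv.right_unique ⟨y.mul u hy, hyv, rfl, ?_⟩⟩
    exact congrArg _ (y.mul_mul hy h).symm

/-- The partial bijection `x ↦ xu`. -/
def extend (u : T.Word) : T.TailClass a₀ ≃. T.TailClass a₀ :=
  PEquiv.ofRel (Extends u) (fun _ _ _ h h' => h.right_unique h')
    fun _ _ _ h h' => (h.left_unique h' rfl).1

theorem mem_extend {u : T.Word} {x z : T.TailClass a₀} : z ∈ extend u x ↔ Extends u x z :=
  PEquiv.mem_ofRel

theorem extend_mul {u v : T.Word} (h : u.t = v.o) :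
    (extend (u.mul v h) : T.TailClass a₀ ≃. _) = (extend u).trans (extend v) := by
  refine PEquiv.ext fun x => Option.ext fun z => ?_
  change z ∈ extend (u.mul v h) x ↔ z ∈ (extend u).trans (extend v) x
  rw [PEquiv.mem_trans]
  simp only [mem_extend, extends_mul]

theorem extend_trans_symm (u : T.Word) : (extend u : T.TailClass a₀ ≃. _).trans (extend u).symm =
    extend (Word.letter T u.o) := by
  refine PEquiv.ext fun x => Option.ext fun z => ?_
  change z ∈ (extend u).trans (extend u).symm x ↔ z ∈ extend (Word.letter T u.o) x
  rw [PEquiv.mem_trans]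
  simp only [PEquiv.mem_iff_mem, mem_extend, extends_letter]
  constructor
  · rintro ⟨y, h, h'⟩
    exact ⟨(h.left_unique h' rfl).1, h.t_left⟩
  · rintro ⟨rfl, h⟩
    obtain ⟨y, hy⟩ := exists_extends h
    exact ⟨y, hy, hy⟩

theorem extend_letter_trans (u : T.Word) :
    (extend (Word.letter T u.o) : T.TailClass a₀ ≃. _).trans (extend u) = extend u := by
  have h := extend_mul (a₀ := a₀) (u := Word.letter T u.o) (v := u) rfl
  have e : (Word.letter T u.o).mul u rfl = u := Word.letter_mul u rfl
  rw [e] at h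
  exact h.symm

theorem lpMap_letter_apply (a : A) (ξ : lp (fun _ : T.TailClass a₀ => ℂ) 2) (z : T.TailClass a₀) :
    open Classical in (extend (Word.letter T a)).lpMap ξ z = if z.t = a then ξ z else 0 := by
  classical
  rw [PEquiv.lpMap_apply]
  split_ifs with h
  · have : (extend (Word.letter T a)).symm z = some z :=
      (PEquiv.mem_iff_mem _).2 (mem_extend.2 (extends_letter.2 ⟨rfl, h⟩))
    rw [this]; rfl
  · have : (extend (Word.letter T a)).symm z = none := by
      rw [Option.eq_none_iff_forall_not_mem]
      intro x hx
      obtain ⟨rfl, h'⟩ := extends_letter.1 (mem_extend.1 ((PEquiv.mem_iff_mem _).1 hx))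
      exact h h'
    rw [this]; rfl

/-- V_w V_w^* projects onto the span of the δ_z with z ending in w, and each z with terminus a ends
in exactly one word of shape `l`. -/
theorem sum_lpMap (a : A) (l : Fin r → ℕ) : ∑ w : T.To l a,
    (extend w.wd : T.TailClass a₀ ≃. _).lpMap * (extend w.wd).symm.lpMap =
      (extend (Word.letter T a)).lpMap := by
  classical
  ext ξ z
  rw [lpMap_letter_apply, sum_apply, lp.coeFn_sum, Finset.sum_apply]
  have hterm : ∀ w : T.To l a, ((extend w.wd : T.TailClass a₀ ≃. T.TailClass a₀).lpMap *
      (extend w.wd : T.TailClass a₀ ≃. T.TailClass a₀).symm.lpMap :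
        lp (fun _ : T.TailClass a₀ => ℂ) 2 →L[ℂ] _) ξ z = if ∃ x, Extends w.wd x z then ξ z else 0 := by
    intro w
    rw [← PEquiv.lpMap_trans, PEquiv.lpMap_apply]
    split_ifs with h
    · obtain ⟨x, hx⟩ := h
      have : ((extend w.wd).symm.trans (extend w.wd)).symm z = some z := by
        rw [PEquiv.symm_trans_rev, PEquiv.symm_symm]
        exact (PEquiv.mem_trans _ _ _ _).2 ⟨x, (PEquiv.mem_iff_mem _).2 (mem_extend.2 hx),
          mem_extend.2 hx⟩
      rw [this]; rfl
    · have : ((extend w.wd).symm.trans (extend w.wd)).symm z = none := by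
        rw [PEquiv.symm_trans_rev, PEquiv.symm_symm, Option.eq_none_iff_forall_not_mem]
        intro y hy
        obtain ⟨x, hx, -⟩ := (PEquiv.mem_trans _ _ _ _).1 hy
        exact h ⟨x, mem_extend.1 ((PEquiv.mem_iff_mem _).1 hx)⟩
      rw [this]; rfl
  simp only [hterm]
  split_ifs with hz
  · obtain ⟨u, x, hu, hx⟩ := exists_extends_to z l
    have hut : u.t = a := by rw [← hx.t_right, hz]
    rw [Finset.sum_eq_single (u.toTo hu hut)]
    · rw [if_pos ⟨x, by rw [Word.toTo_wd]; exact hx⟩]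
    · intro w _ hw
      refine if_neg fun ⟨x', hx'⟩ => hw (To.ext ?_)
      rw [Word.toTo_wd]
      exact (hx'.left_unique hx (w.shape_eq.trans hu.symm)).2
    · simp
  · refine Finset.sum_eq_zero fun w _ => if_neg fun ⟨x, hx⟩ => hz ?_
    rw [hx.t_right, w.t_eq]

theorem lpMap_letter (a : A) : (extend (Word.letter T a) : T.TailClass a₀ ≃. _).lpMap *
    (extend (Word.letter T a)).symm.lpMap = (extend (Word.letter T a)).lpMap := by
  rw [← PEquiv.lpMap_trans]
  congr 1
  refine PEquiv.ext fun x => Option.ext fun z => ?_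
  change z ∈ (extend (Word.letter T a)).symm.trans _ x ↔ z ∈ extend (Word.letter T a) x
  rw [PEquiv.mem_trans]
  simp only [PEquiv.mem_iff_mem, mem_extend, extends_letter]
  constructor
  · rintro ⟨y, ⟨rfl, h⟩, rfl, -⟩
    exact ⟨rfl, h⟩
  · rintro ⟨rfl, h⟩
    exact ⟨x, ⟨rfl, h⟩, rfl, h⟩

variable (T a₀) in
-- The operator for (u, v) replaces a final piece v by u. The sum rule results from writing the
-- projection onto terminus o(u), inserted between the two factors, as the sum of the projections of
-- all final pieces of shape e_j.
theorem isRevFamily : T.IsRevFamily fun i =>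
    (extend i.fst : T.TailClass a₀ ≃. _).lpMap * (extend i.snd).symm.lpMap where
  star_eq u v h := by
    simp only [star_mul, PEquiv.star_lpMap, PEquiv.symm_symm]
  mul_eq u v w h h' := by
    have h1 : (extend u : T.TailClass a₀ ≃. _).lpMap * (extend (Word.letter T v.o)).lpMap =
        (extend u).lpMap := by
      rw [← PEquiv.lpMap_trans, ← h, extend_letter_trans]
    have h2 : (extend v : T.TailClass a₀ ≃. _).symm.lpMap * (extend v).lpMap =
        (extend (Word.letter T v.o)).lpMap := by
      rw [← PEquiv.lpMap_trans, extend_trans_symm]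
    dsimp only
    rw [mul_assoc, ← mul_assoc (extend v).symm.lpMap, h2, ← mul_assoc, h1]
  sum_eq u v h j := by
    have h1 : (extend u : T.TailClass a₀ ≃. _).lpMap * (extend (Word.letter T u.o)).lpMap =
        (extend u).lpMap := by
      rw [← PEquiv.lpMap_trans, extend_letter_trans]
    dsimp only
    rw [← h1, ← sum_lpMap u.o (unitShape j), Finset.mul_sum, Finset.sum_mul]
    refine Finset.sum_congr rfl fun w _ => ?_
    have e1 : (extend ((T.ofWd w.1).mul u w.2) : T.TailClass a₀ ≃. _) =
        (extend (T.ofWd w.1)).trans (extend u) := extend_mul w.2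
    have e2 : (extend ((T.ofWd w.1).mul v (w.2.trans h)) : T.TailClass a₀ ≃. _) =
        (extend (T.ofWd w.1)).trans (extend v) := extend_mul (w.2.trans h)
    rw [e1, e2, PEquiv.symm_trans_rev, PEquiv.lpMap_trans, PEquiv.lpMap_trans]
    simp only [mul_assoc]
    rfl
  orthogonal u v hu hv huv := by
    have key : ∀ u : T.Word, u.shape = 0 → (extend u : T.TailClass a₀ ≃. _).lpMap *
        (extend u).symm.lpMap = (extend (Word.letter T u.t)).lpMap := fun u hu => by
      rw [← lpMap_letter, ← Word.eq_letter hu]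
    dsimp only
    rw [key u hu, key v hv]
    ext ξ z
    rw [mul_apply_eq_comp, lpMap_letter_apply, lpMap_letter_apply]
    split_ifs with h1 h2
    · refine absurd ?_ huv
      rw [Word.eq_letter hu, Word.eq_letter hv, ← h1, ← h2]
    · rfl
    · rfl

end TailClass

instance : Countable T.Word := by
  have h : Function.Injective fun w : T.Word => (⟨w.shape, w.wd⟩ : Σ m, Wd T.M m) := by
    rintro ⟨m, w⟩ ⟨m', w'⟩ h
    simpa using h
  exact h.countable

/-- Finite words are countable in number, hence so are the tail classes and ℓ² is separable. Every
tail class has a terminus, so the projections of the letters add up to 1 and the representation is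
nondegenerate. -/
theorem exists_representation (T : TransitionSystem r A) (hr : 1 ≤ r) :
    ∃ (H : Type u) (_ : NormedAddCommGroup H)
    (_ : InnerProductSpace ℂ H) (_ : CompleteSpace H) (ψ : T.RevAlgebra →⋆ₙₐ[ℂ] (H →L[ℂ] H)),
    TopologicalSpace.SeparableSpace H ∧ Nontrivial H ∧ Nondegenerate ψ := by
  classical
  -- The alphabet is nonempty because `M 0 ≠ 0`; this is where `1 ≤ r` is needed.
  obtain ⟨e, -⟩ := T.exists_edge ⟨0, hr⟩
  let a₀ : A := e.o
  let x₀ : T.TailClass a₀ := Quotient.mk _ ⟨0, Word.letter T a₀, Word.letter_o _⟩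
  let ψ := Univ.lift (R := T.revRelations) (TailClass.isRevFamily T a₀)
  have : Countable (T.LeftPair a₀) := by
    have h : Function.Injective fun y : T.LeftPair a₀ => (y.level, y.word) := fun y y' h =>
      LeftPair.ext_of (congrArg Prod.fst h) (congrArg Prod.snd h)
    exact h.countable
  have : Countable (T.TailClass a₀) := Quotient.countable
  let b : HilbertBasis (T.TailClass a₀) ℂ (lp (fun _ : T.TailClass a₀ => ℂ) 2) :=
    HilbertBasis.ofRepr (LinearIsometryEquiv.refl ℂ _)
  refine ⟨lp (fun _ : T.TailClass a₀ => ℂ) 2, inferInstance, inferInstance, inferInstance, ψ,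
    ?_, ?_, ?_⟩
  · have h1 : TopologicalSpace.IsSeparable
        (Submodule.span ℂ (Set.range b) : Set (lp (fun _ : T.TailClass a₀ => ℂ) 2)) :=
      (Set.countable_range b).isSeparable.span (R := ℂ)
    have h2 := h1.closure
    have h3 : closure (Submodule.span ℂ (Set.range b) : Set (lp (fun _ : T.TailClass a₀ => ℂ) 2)) =
        Set.univ := by
      rw [← Submodule.topologicalClosure_coe, b.dense_span]; rfl
    rw [h3] at h2
    exact TopologicalSpace.isSeparable_univ_iff.1 h2
  · exact ⟨b x₀, 0, fun h => by
      have := b.orthonormal.1 x₀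
      rw [h, norm_zero] at this
      exact zero_ne_one this⟩
  · have h1 : ∀ ξ : lp (fun _ : T.TailClass a₀ => ℂ) 2,
        ∑ a, (TailClass.extend (Word.letter T a)).lpMap ξ = ξ := fun ξ => by
      ext z
      rw [lp.coeFn_sum, Finset.sum_apply]
      simp only [TailClass.lpMap_letter_apply]
      rw [Finset.sum_ite_eq]
      simp
    have h2 : ∀ a, ψ (T.s' (Word.letter T a) (Word.letter T a) rfl) =
        (TailClass.extend (Word.letter T a)).lpMap := fun a => by
      rw [← TailClass.lpMap_letter]
      exact Univ.lift_gen (R := T.revRelations) (TailClass.isRevFamily T a₀) _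
    intro ξ
    refine subset_closure ?_
    rw [← h1 ξ]
    exact sum_mem fun a _ => Submodule.subset_span ⟨_, ξ, by rw [h2 a]⟩

end TransitionSystem

open InnerProductSpace CStarRelations

/-! ## ⋆-representations of tensor products with the compact operators -/

/-- Linear maps `τ_{pq}`, to be thought of as `a ↦ a ⊗ e_{pq}`. -/
structure IsMatrixFamily {E B I : Type*} [NonUnitalCStarAlgebra E] [NonUnitalCStarAlgebra B]
    (τ : I → I → E →L[ℂ] B) : Prop where
  norm_le : ∀ p q a, ‖τ p q a‖ ≤ ‖a‖
  star_eq : ∀ p q a, star (τ p q a) = τ q p (star a)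
  mul_eq : ∀ p q s a a', τ p q a * τ q s a' = τ p s (a * a')
  mul_ne : ∀ p q q' s a a', q ≠ q' → τ p q a * τ q' s a' = 0

section

variable {H : Type u} [NormedAddCommGroup H] [InnerProductSpace ℂ H] [CompleteSpace H] {I : Type*}
  (b : HilbertBasis I ℂ H)

/-- The matrix units in the algebra of compact operators. -/
def HilbertBasis.matrixUnit (p q : I) : compactOperators H :=
  ⟨rankOne ℂ (b p) (b q), TransitionSystem.isCompactOperator_rankOne _ _⟩

theorem HilbertBasis.star_matrixUnit (p q : I) :
    star (b.matrixUnit p q) = b.matrixUnit q p :=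
  Subtype.ext (TransitionSystem.star_rankOne _ _)

theorem HilbertBasis.matrixUnit_mul (p q s : I) :
    b.matrixUnit p q * b.matrixUnit q s = b.matrixUnit p s := Subtype.ext <| by
  change rankOne ℂ _ _ * rankOne ℂ _ _ = rankOne ℂ _ _
  rw [TransitionSystem.rankOne_mul_rankOne, inner_self_eq_norm_sq_to_K, b.orthonormal.1 q]
  simp

theorem HilbertBasis.matrixUnit_mul_of_ne (p q q' s : I) (h : q ≠ q') :
    b.matrixUnit p q * b.matrixUnit q' s = 0 := Subtype.ext <| by
  change rankOne ℂ _ _ * rankOne ℂ _ _ = 0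
  rw [TransitionSystem.rankOne_mul_rankOne, b.orthonormal.2 h, zero_smul]

theorem HilbertBasis.dense_span_matrixUnit : Dense (Submodule.span ℂ
    (Set.range fun p : I × I => b.matrixUnit p.1 p.2) : Set (compactOperators H)) := by
  intro x
  have hc : IsCompactOperator ((x : H →L[ℂ] H)) := x.2
  have h1 := b.mem_closure_span_rankOne b (R := fun _ _ => True) (x := x) hc hc.adjoint_aux
    (fun u v huv => absurd trivial huv)
  rw [closure_subtype]
  convert h1 using 2
  have h2 := Submodule.map_span (compactOperators H).toNonUnitalSubalgebra.toSubmodule.subtype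
    (Set.range fun p : I × I => b.matrixUnit p.1 p.2)
  have h3 := congrArg (fun S : Submodule ℂ (H →L[ℂ] H) => (S : Set (H →L[ℂ] H))) h2
  refine Eq.trans ?_ (h3.trans ?_)
  · rfl
  · congr 2
    ext y
    constructor
    · rintro ⟨_, ⟨p, rfl⟩, rfl⟩
      exact ⟨p.1, p.2, trivial, rfl⟩
    · rintro ⟨p, q, -, rfl⟩
      exact ⟨_, ⟨(p, q), rfl⟩, rfl⟩

theorem HilbertBasis.inner_cutoff {F : Finset I} {p : I} (hp : p ∈ F) (x : H) :
    inner ℂ (b p) (b.cutoff F x) = inner ℂ (b p) x := by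
  classical
  rw [b.cutoff_apply, inner_sum]
  simp only [inner_smul_right, orthonormal_iff_ite.1 b.orthonormal]
  simp [hp]

theorem HilbertBasis.cutoff_basis {F : Finset I} {p : I} (hp : p ∈ F) :
    b.cutoff F (b p) = b p := by
  classical
  rw [b.cutoff_apply]
  simp only [orthonormal_iff_ite.1 b.orthonormal]
  simp [hp]

variable {E B : Type*} [NonUnitalCStarAlgebra E] [NonUnitalCStarAlgebra B]
  (τ : I → I → E →L[ℂ] B)

/-- The finite sum `∑_{p, q ∈ F} ⟨b_p, x b_q⟩ τ_{pq}(a)`. -/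
def finiteTensor (F : Finset I) (a : E) (x : H →L[ℂ] H) : B :=
  ∑ p ∈ F, ∑ q ∈ F, inner ℂ (b p) (x (b q)) • τ p q a

namespace IsMatrixFamily

variable {b τ}

theorem star_finiteTensor (hτ : IsMatrixFamily τ)
    (F : Finset I) (a : E) (x : H →L[ℂ] H) :
    star (finiteTensor b τ F a x) = finiteTensor b τ F (star a) (star x) := by
  unfold finiteTensor
  simp only [star_sum, star_smul, hτ.star_eq]
  rw [Finset.sum_comm]
  refine Finset.sum_congr rfl fun p _ => Finset.sum_congr rfl fun q _ => ?_
  rw [ContinuousLinearMap.star_eq_adjoint, ContinuousLinearMap.adjoint_inner_right]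
  congr 1
  exact inner_conj_symm _ _

/-- The condition x P_F = x says that columns of x outside F vanish, so the inner summation over F
produces the true entries of xy. -/
theorem finiteTensor_mul (hτ : IsMatrixFamily τ)
    {F : Finset I} (a a' : E) {x : H →L[ℂ] H} (y : H →L[ℂ] H)
    (hx : x * b.cutoff F = x) : finiteTensor b τ F a x * finiteTensor b τ F a' y =
      finiteTensor b τ F (a * a') (x * y) := by
  classical
  unfold finiteTensor
  rw [Finset.sum_mul_sum]
  refine Finset.sum_congr rfl fun p _ => ?_
  have h1 : ∀ s, inner ℂ (b p) ((x * y) (b s)) =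
      ∑ q ∈ F, inner ℂ (b p) (x (b q)) * inner ℂ (b q) (y (b s)) := fun s => by
    conv_lhs => rw [← hx]
    rw [mul_apply_eq_comp, mul_apply_eq_comp, b.cutoff_apply, map_sum, inner_sum]
    refine Finset.sum_congr rfl fun q _ => ?_
    rw [map_smul, inner_smul_right, mul_comm]
  simp only [h1, Finset.sum_smul, Finset.sum_mul_sum, smul_mul_smul_comm]
  rw [Finset.sum_comm (s := F) (t := F) (f := fun s q => (inner ℂ (b p) (x (b q)) *
    inner ℂ (b q) (y (b s))) • τ p s (a * a')), Finset.sum_comm]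
  refine Finset.sum_congr rfl fun q hq => ?_
  rw [Finset.sum_eq_single q]
  · refine Finset.sum_congr rfl fun s _ => ?_
    rw [hτ.mul_eq]
  · intro q' _ hq'
    refine Finset.sum_eq_zero fun s _ => ?_
    rw [hτ.mul_ne _ _ _ _ _ _ hq'.symm, smul_zero]
  · exact fun h => absurd hq h

theorem norm_finiteTensor_le_mul (hτ : IsMatrixFamily τ)
    (F : Finset I) (a : E) (x : H →L[ℂ] H) :
    ‖finiteTensor b τ F a x‖ ≤ (F.card * F.card : ℝ) * (‖a‖ * ‖x‖) := by
  unfold finiteTensor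
  have h1 : ∀ p q, ‖inner ℂ (b p) (x (b q)) • τ p q a‖ ≤ ‖a‖ * ‖x‖ := fun p q => by
    rw [norm_smul, mul_comm]
    refine mul_le_mul (hτ.norm_le p q a) ?_ (norm_nonneg _) (norm_nonneg _)
    refine (norm_inner_le_norm _ _).trans ?_
    rw [b.orthonormal.1 p, one_mul]
    refine (x.le_opNorm _).trans ?_
    rw [b.orthonormal.1 q, mul_one]
  refine (norm_sum_le_of_le F (n := fun _ => F.card * (‖a‖ * ‖x‖)) fun p _ => ?_).trans ?_
  · refine (norm_sum_le_of_le F fun q _ => h1 p q).trans ?_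
    rw [Finset.sum_const, nsmul_eq_mul]
  · rw [Finset.sum_const, nsmul_eq_mul, mul_assoc]

/-- Each entry gives the crude bound with constant |F|². For selfadjoint a and x supported on F,
squaring the sum replaces (a, x) by (a², x²) and squares ‖a‖‖x‖ exactly, so the constant improves to
1. -/
theorem norm_finiteTensor_le (hτ : IsMatrixFamily τ)
    (F : Finset I) (a : E) (x : H →L[ℂ] H) :
    ‖finiteTensor b τ F a x‖ ≤ ‖a‖ * ‖x‖ := by
  have hsa : ∀ (a : E) (x : H →L[ℂ] H), star a = a → star x = x → x * b.cutoff F = x →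
      ‖finiteTensor b τ F a x‖ ≤ ‖a‖ * ‖x‖ := by
    intro a x ha hx hF
    refine norm_le_of_stable_under_squaring (C := F.card * F.card) (P := fun k h =>
      ∃ (a : E) (x : H →L[ℂ] H), star a = a ∧ star x = x ∧ x * b.cutoff F = x ∧
        k = finiteTensor b τ F a x ∧ h = ‖a‖ * ‖x‖) ?_ ?_ ?_ ⟨a, x, ha, hx, hF, rfl, rfl⟩
      (by positivity)
    · rintro _ _ ⟨a, x, ha, hx, hF, rfl, rfl⟩
      change star _ = _
      rw [hτ.star_finiteTensor, ha, hx]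
    · rintro _ _ ⟨a, x, ha, hx, hF, rfl, rfl⟩
      refine ⟨a * a, x * x, by rw [star_mul, ha], by rw [star_mul, hx], by rw [mul_assoc, hF],
        hτ.finiteTensor_mul a a x hF, ?_⟩
      have h1 : ‖a * a‖ = ‖a‖ * ‖a‖ := by
        nth_rewrite 1 [← ha]; exact CStarRing.norm_star_mul_self
      have h2 : ‖x * x‖ = ‖x‖ * ‖x‖ := by
        nth_rewrite 1 [← hx]; exact CStarRing.norm_star_mul_self
      rw [h1, h2]; ring
    · rintro _ _ ⟨a, x, ha, hx, hF, rfl, rfl⟩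
      exact hτ.norm_finiteTensor_le_mul F a x
  -- For general a and x, the sum sees only the compression of x to F, and the C⋆-identity reduces
  -- to the selfadjoint elements a^*a and y^*y.
  set P := b.cutoff F
  have hP : P * P = P := b.cutoff_mul_self F
  have hP' : star P = P := b.star_cutoff F
  set y := P * x * P with hy
  have e1 : finiteTensor b τ F a x = finiteTensor b τ F a y := by
    unfold finiteTensor
    refine Finset.sum_congr rfl fun p hp => Finset.sum_congr rfl fun q hq => ?_
    rw [hy, mul_apply_eq_comp, mul_apply_eq_comp, b.inner_cutoff hp, b.cutoff_basis hq]
  have hyF : y * P = y := by rw [hy, mul_assoc, hP]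
  have hyF' : star y * P = star y := by
    rw [hy, star_mul, star_mul, hP', ← mul_assoc, mul_assoc, hP]
  have h2 : ‖finiteTensor b τ F a y‖ ≤ ‖a‖ * ‖y‖ := by
    refine abs_le_of_sq_le_sq' ?_ (by positivity) |>.2
    rw [sq, sq, ← CStarRing.norm_star_mul_self, hτ.star_finiteTensor, hτ.finiteTensor_mul _ _ _ hyF']
    refine (hsa _ _ (by rw [star_mul, star_star]) (by rw [star_mul, star_star])
      (by rw [mul_assoc, hyF])).trans (le_of_eq ?_)
    rw [CStarRing.norm_star_mul_self, CStarRing.norm_star_mul_self]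
    ring
  rw [e1]
  refine h2.trans (mul_le_mul_of_nonneg_left ?_ (norm_nonneg _))
  have h3 := b.norm_cutoff_le F
  calc ‖y‖ ≤ ‖P‖ * ‖x‖ * ‖P‖ := (norm_mul_le _ _).trans
        (mul_le_mul_of_nonneg_right (norm_mul_le _ _) (norm_nonneg _))
    _ ≤ 1 * ‖x‖ * 1 := by gcongr
    _ = ‖x‖ := by ring

/-- On a finite matrix the map is `finiteTensor` for any finite set containing its row and column
indices, so it is bounded by ‖a‖ and extends to all compact operators. -/
theorem exists_tensorMap (hτ : IsMatrixFamily τ)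
    (b : HilbertBasis I ℂ H) (a : E) :
    ∃ L : compactOperators H →L[ℂ] B, (∀ p q, L (b.matrixUnit p q) = τ p q a) ∧
      ∀ x, ‖L x‖ ≤ ‖a‖ * ‖x‖ := by
  classical
  let e' := Finsupp.linearCombination ℂ fun p : I × I => b.matrixUnit p.1 p.2
  let f' := Finsupp.linearCombination ℂ fun p : I × I => τ p.1 p.2 a
  have hn : ∀ c, ‖f' c‖ ≤ ‖a‖ * ‖e' c‖ := by
    intro c
    let F := c.support.image Prod.fst ∪ c.support.image Prod.snd
    have h1 : finiteTensor b τ F a (e' c : H →L[ℂ] H) = f' c := by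
      have h2 : ∀ p q, inner ℂ (b p) ((e' c : H →L[ℂ] H) (b q)) = c (p, q) := by
        intro p q
        have h3 : (e' c : H →L[ℂ] H) = ∑ s ∈ c.support, c s • rankOne ℂ (b s.1) (b s.2) := by
          simp only [e', Finsupp.linearCombination_apply, Finsupp.sum]
          rw [AddSubmonoidClass.coe_finsetSum]
          rfl
        rw [h3, sum_apply, inner_sum]
        have h4 : ∀ s ∈ c.support, inner ℂ (b p) ((c s • rankOne ℂ (b s.1) (b s.2)) (b q)) =
            if s = (p, q) then c s else 0 := by
          rintro ⟨s, t⟩ -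
          simp only [smul_apply, rankOne_apply, inner_smul_right,
            orthonormal_iff_ite.1 b.orthonormal, Prod.mk.injEq, eq_comm (a := p)]
          split_ifs <;> simp_all
        rw [Finset.sum_congr rfl h4, Finset.sum_ite_eq']
        split_ifs with h
        · rfl
        · exact (Finsupp.notMem_support_iff.1 h).symm
      unfold finiteTensor
      simp only [h2, f', Finsupp.linearCombination_apply, Finsupp.sum]
      rw [← Finset.sum_product']
      refine (Finset.sum_subset (fun s hs => ?_) fun s _ hs => ?_).symm
      · exact Finset.mem_product.2 ⟨Finset.mem_union_left _ (Finset.mem_image_of_mem _ hs),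
          Finset.mem_union_right _ (Finset.mem_image_of_mem _ hs)⟩
      · rw [Finsupp.notMem_support_iff.1 hs, zero_smul]
    rw [← h1]
    exact hτ.norm_finiteTensor_le F a _
  have hd := dense_range_linearCombination b.dense_span_matrixUnit
  refine ⟨f'.extendOfNorm e', fun p q => ?_, fun x =>
    LinearMap.norm_extendOfNorm_apply_le hd _ hn x⟩
  have := LinearMap.extendOfNorm_eq hd ⟨_, hn⟩ (Finsupp.single (p, q) 1)
  simpa [e', f'] using this

end IsMatrixFamily

end

/-- Matrix families of linear maps extend to ⋆-representations of the tensor product. -/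
theorem IsMatrixFamily.exists_isTensorFamily {H : Type u} [NormedAddCommGroup H]
    [InnerProductSpace ℂ H] [CompleteSpace H] {I : Type*} (b : HilbertBasis I ℂ H) {E B : Type u}
    [NonUnitalCStarAlgebra E] [NonUnitalCStarAlgebra B] {τ : I → I → E →L[ℂ] B}
    (hτ : IsMatrixFamily τ) : ∃ S : E × compactOperators H → B, IsTensorFamily S ∧
      ∀ a p q, S (a, b.matrixUnit p q) = τ p q a := by
  choose L hL hn using fun a => hτ.exists_tensorMap b a
  have ext : ∀ {F : Type u} [NormedAddCommGroup F] [NormedSpace ℂ F]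
      (f g : compactOperators H →L[ℂ] F),
      (∀ p q, f (b.matrixUnit p q) = g (b.matrixUnit p q)) → ∀ x, f x = g x := by
    intro F _ _ f g h x
    refine dense_span_induction b.dense_span_matrixUnit (P := fun x => f x = g x)
      (isClosed_eq f.continuous g.continuous) ?_ (by simp only [map_zero]) ?_ ?_ x
    · rintro _ ⟨p, rfl⟩
      exact h p.1 p.2
    · intro x y hx hy; simp only [map_add, hx, hy]
    · intro c x hx; simp only [map_smul, hx]
  refine ⟨fun p => L p.1 p.2, ⟨?_, ?_, ?_, ?_, ?_, ?_, ?_⟩, fun a p q => hL a p q⟩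
  · intro a a' x
    exact ext (L (a + a')) (L a + L a') (fun p q => by
      rw [add_apply, hL, hL, hL, map_add]) x
  · intro a x y
    exact map_add _ _ _
  · intro c a x
    exact ext (L (c • a)) (c • L a) (fun p q => by rw [smul_apply, hL, hL, map_smul]) x
  · intro c a x
    exact map_smul _ _ _
  · intro a x a' y
    dsimp only
    refine dense_span_induction b.dense_span_matrixUnit
      (P := fun x => L a x * L a' y = L (a * a') (x * y))
      (isClosed_eq (by fun_prop) (by fun_prop)) ?_ (by simp) ?_ ?_ x
    · rintro _ ⟨⟨p, q⟩, rfl⟩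
      refine dense_span_induction b.dense_span_matrixUnit
        (P := fun y => L a (b.matrixUnit p q) * L a' y = L (a * a') (b.matrixUnit p q * y))
        (isClosed_eq (by fun_prop) (by fun_prop)) ?_ (by simp) ?_ ?_ y
      · rintro _ ⟨⟨p', q'⟩, rfl⟩
        dsimp only
        rw [hL, hL]
        by_cases h : q = p'
        · subst h
          rw [b.matrixUnit_mul, hL, hτ.mul_eq]
        · rw [b.matrixUnit_mul_of_ne _ _ _ _ h, map_zero, hτ.mul_ne _ _ _ _ _ _ h]
      · intro x y hx hy; simp only [map_add, mul_add, hx, hy]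
      · intro c x hx; simp only [map_smul, mul_smul_comm, hx]
    · intro x y hx hy; simp only [map_add, add_mul, hx, hy]
    · intro c x hx; simp only [map_smul, smul_mul_assoc, hx]
  · intro a x
    dsimp only
    refine dense_span_induction b.dense_span_matrixUnit
      (P := fun x => star (L a x) = L (star a) (star x))
      (isClosed_eq (by fun_prop) (by fun_prop)) ?_ (by simp) ?_ ?_ x
    · rintro _ ⟨⟨p, q⟩, rfl⟩
      dsimp only
      rw [hL, b.star_matrixUnit, hL, hτ.star_eq]
    · intro x y hx hy; simp only [map_add, star_add, hx, hy]
    · intro c x hx; simp only [map_smul, star_smul, hx]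
  · intro a x
    exact hn a x

namespace TransitionSystem

variable {r : ℕ} {A : Type u} [Fintype A] {T : TransitionSystem r A} {D : Type u} {δ : D → A}
  {I : Type u}

/-! ## Stabilization -/

/-- Decorations with an additional index. -/
abbrev indexed (δ : D → A) (I : Type u) : D × I → A := fun d => δ d.1

/-- Add an index to the decoration. -/
def DecoratedWord.withIndex (u : T.DecoratedWord δ) (p : I) : T.DecoratedWord (indexed δ I) :=
  ⟨(u.deco, p), u.word, u.o_eq⟩

/-- Forget the index. -/
def DecoratedWord.base (u : T.DecoratedWord (indexed δ I)) : T.DecoratedWord δ :=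
  ⟨u.deco.1, u.word, u.o_eq⟩

theorem DecoratedWord.withIndex_inj {u v : T.DecoratedWord δ} {p q : I}
    (h : u.withIndex p = v.withIndex q) : u = v ∧ p = q := by
  have h1 : (u.withIndex p).deco = (v.withIndex q).deco := congrArg DecoratedWord.deco h
  have h2 : (u.withIndex p).word = (v.withIndex q).word := congrArg DecoratedWord.word h
  exact ⟨DecoratedWord.ext_of (congrArg Prod.fst h1) h2, congrArg Prod.snd h1⟩

/-- Add indices to a pair of decorated words. -/
def CKIndex.withIndex (i : T.CKIndex δ) (p q : I) : T.CKIndex (indexed δ I) :=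
  ⟨i.fst.withIndex p, i.snd.withIndex q, i.t_eq⟩

/-- Forget the indices. -/
def CKIndex.base (i : T.CKIndex (indexed δ I)) : T.CKIndex δ := ⟨i.fst.base, i.snd.base, i.t_eq⟩

open scoped Classical in
-- Extending words leaves the added indices alone, so the expansion of the product vanishes termwise
-- unless the inner indices agree, and otherwise copies the expansion without indices.
theorem gen_withIndex_mul (i k : T.CKIndex δ) (p q q' s : I) :
    (Univ.gen (i.withIndex p q) * Univ.gen (k.withIndex q' s) : T.CKAlgebra (indexed δ I)) =
      if q = q' then mulSum (fun x => (Univ.gen (x.withIndex p s) : T.CKAlgebra (indexed δ I))) i k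
      else 0 := by
  rw [(T.isCKFamily_gen (indexed δ I)).mul_eq_mulSum]
  have h : ∀ x y : T.CKIndex δ, CKIndex.compVal (Univ.gen : _ → T.CKAlgebra (indexed δ I))
      (x.withIndex p q) (y.withIndex q' s) = if q = q' then CKIndex.compVal (fun x =>
        (Univ.gen (x.withIndex p s) : T.CKAlgebra (indexed δ I))) x y else 0 := by
    intro x y
    unfold CKIndex.compVal
    by_cases hq : q = q'
    · subst hq
      rw [if_pos rfl]
      by_cases hc : x.snd = y.fst
      · have e : (x.withIndex p q).snd = (y.withIndex q s).fst :=
          congrArg (fun u => DecoratedWord.withIndex u q) hc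
        rw [dif_pos hc, dif_pos e]
        rfl
      · have e : ¬ (x.withIndex p q).snd = (y.withIndex q s).fst :=
          fun e => hc (DecoratedWord.withIndex_inj e).1
        rw [dif_neg hc, dif_neg e]
    · have e : ¬ (x.withIndex p q).snd = (y.withIndex q' s).fst :=
        fun e => hq (DecoratedWord.withIndex_inj e).2
      rw [if_neg hq, dif_neg e]
  have h2 : mulSum (Univ.gen : _ → T.CKAlgebra (indexed δ I)) (i.withIndex p q)
      (k.withIndex q' s) = ∑ w : T.From k.fst.shape i.t, ∑ w' : T.From i.snd.shape k.t,
        CKIndex.compVal (Univ.gen : _ → T.CKAlgebra (indexed δ I))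
          ((i.ext w.wd w.o_eq).withIndex p q) ((k.ext w'.wd w'.o_eq).withIndex q' s) := rfl
  rw [h2]
  simp only [h]
  split_ifs with hq
  · rfl
  · simp

theorem isCKFamily_diagIndex (p : I) : T.IsCKFamily δ
    fun i => (Univ.gen (i.withIndex p p) : T.CKAlgebra (indexed δ I)) where
  star_eq u v h := (T.isCKFamily_gen (indexed δ I)).star_eq _ _ _
  mul_eq u v w h h' := (T.isCKFamily_gen (indexed δ I)).mul_eq _ _ _ _ _
  sum_eq u v h j := (T.isCKFamily_gen (indexed δ I)).sum_eq _ _ _ _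
  orthogonal u v hu hv huv := (T.isCKFamily_gen (indexed δ I)).orthogonal _ _ hu hv
    fun e => huv (DecoratedWord.withIndex_inj e).1

variable (T δ) in
-- For p ≠ q the map is not multiplicative, but L_{pq}(x) L_{pq}(y)^* = J(xy^*) for the homomorphism
-- J given by the indices (p, p), so `exists_extension_of_starHom` applies.
theorem exists_indexMap (p q : I) : ∃ L : T.CKAlgebra δ →L[ℂ] T.CKAlgebra (indexed δ I),
    (∀ i, L (Univ.gen i) = Univ.gen (i.withIndex p q)) ∧ ∀ x, ‖L x‖ ≤ ‖x‖ := by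
  let J : T.CKAlgebra δ →⋆ₙₐ[ℂ] T.CKAlgebra (indexed δ I) :=
    Univ.lift (R := T.ckRelations δ) (isCKFamily_diagIndex p)
  have hJ : ∀ i, J (Univ.gen i) = Univ.gen (i.withIndex p p) := fun i =>
    Univ.lift_gen (R := T.ckRelations δ) (isCKFamily_diagIndex p) i
  refine exists_extension_of_starHom J (T.dense_span_s δ) fun i j => ?_
  have h1 : star (Univ.gen (j.withIndex p q) : T.CKAlgebra (indexed δ I)) =
      Univ.gen (j.flip.withIndex q p) := (T.isCKFamily_gen (indexed δ I)).star_apply _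
  rw [h1, gen_withIndex_mul, if_pos rfl, (T.isCKFamily_gen δ).star_apply,
    (T.isCKFamily_gen δ).mul_eq_mulSum]
  exact (mulSum_eq (J : T.CKAlgebra δ →+ T.CKAlgebra (indexed δ I)) Univ.gen
    (fun x => Univ.gen (x.withIndex p p)) _ _ fun x _ => hJ x).symm

variable (T δ) in
theorem exists_isMatrixFamily (I : Type u) :
    ∃ τ : I → I → T.CKAlgebra δ →L[ℂ] T.CKAlgebra (indexed δ I), IsMatrixFamily τ ∧
      ∀ p q i, τ p q (Univ.gen i) = Univ.gen (i.withIndex p q) := by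
  classical
  choose τ hτ hn using fun p q : I => exists_indexMap T δ p q
  -- One identity with a case distinction, so that a single density argument gives both product
  -- rules.
  have hmul : ∀ p q q' s a a', τ p q a * τ q' s a' = if q = q' then τ p s (a * a') else 0 := by
    intro p q q' s a a'
    refine dense_span_induction (T.dense_span_s δ)
      (P := fun a => τ p q a * τ q' s a' = if q = q' then τ p s (a * a') else 0)
      (isClosed_eq (by fun_prop) (by split_ifs <;> fun_prop)) ?_ (by simp) ?_ ?_ a
    · rintro _ ⟨i, rfl⟩
      refine dense_span_induction (T.dense_span_s δ)
        (P := fun a' => τ p q (Univ.gen i) * τ q' s a' =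
          if q = q' then τ p s (Univ.gen i * a') else 0)
        (isClosed_eq (by fun_prop) (by split_ifs <;> fun_prop)) ?_ (by simp) ?_ ?_ a'
      · rintro _ ⟨k, rfl⟩
        rw [hτ, hτ, gen_withIndex_mul, (T.isCKFamily_gen δ).mul_eq_mulSum]
        refine if_congr Iff.rfl ?_ rfl
        exact (mulSum_eq (τ p s : T.CKAlgebra δ →+ T.CKAlgebra (indexed δ I)) Univ.gen
          (fun x => Univ.gen (x.withIndex p s)) _ _ fun x _ => hτ p s x).symm
      · intro x y hx hy
        rw [map_add, mul_add, hx, hy, mul_add, map_add]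
        split_ifs
        · rfl
        · exact add_zero 0
      · intro c x hx
        rw [map_smul, mul_smul_comm, hx, mul_smul_comm, map_smul]
        split_ifs
        · rfl
        · exact smul_zero c
    · intro x y hx hy
      rw [map_add, add_mul, hx, hy, add_mul, map_add]
      split_ifs
      · rfl
      · exact add_zero 0
    · intro c x hx
      rw [map_smul, smul_mul_assoc, hx, smul_mul_assoc, map_smul]
      split_ifs
      · rfl
      · exact smul_zero c
  refine ⟨τ, ⟨hn, fun p q a => ?_, fun p q s a a' => ?_, fun p q q' s a a' h => ?_⟩, hτ⟩
  · refine dense_span_induction (T.dense_span_s δ) (P := fun a => star (τ p q a) = τ q p (star a))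
      (isClosed_eq (by fun_prop) (by fun_prop)) ?_ (by simp) ?_ ?_ a
    · rintro _ ⟨i, rfl⟩
      rw [hτ, (T.isCKFamily_gen δ).star_apply, hτ, (T.isCKFamily_gen (indexed δ I)).star_apply]
      rfl
    · intro x y hx hy; simp only [map_add, star_add, hx, hy]
    · intro c x hx; simp only [map_smul, star_smul, hx]
  · rw [hmul, if_pos rfl]
  · rw [hmul, if_neg h]

section

variable {H : Type u} [NormedAddCommGroup H] [InnerProductSpace ℂ H] [CompleteSpace H]
  (b : HilbertBasis I ℂ H)

variable (T δ) in
-- The generator for the pair with indices p, q is sent to s_{u,v} ⊗ e_{pq}. Distinct words of shape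
-- 0 differ either in the index, where the matrix units are orthogonal, or in the base, where the
-- generators of 𝒜 are.
theorem isCKFamily_tensor : T.IsCKFamily (indexed δ I) fun i =>
    (Univ.gen (Univ.gen i.base, b.matrixUnit i.fst.deco.2 i.snd.deco.2) :
      CStarTensor (T.CKAlgebra δ) (compactOperators H)) := by
  have hS := T.isCKFamily_gen δ
  have hT := isTensorFamily_gen (T.CKAlgebra δ) (compactOperators H)
  have hmul : ∀ i k : T.CKIndex (indexed δ I),
      (Univ.gen (Univ.gen i.base, b.matrixUnit i.fst.deco.2 i.snd.deco.2) *
        Univ.gen (Univ.gen k.base, b.matrixUnit k.fst.deco.2 k.snd.deco.2) :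
          CStarTensor (T.CKAlgebra δ) (compactOperators H)) =
      Univ.gen (Univ.gen i.base * Univ.gen k.base,
        b.matrixUnit i.fst.deco.2 i.snd.deco.2 * b.matrixUnit k.fst.deco.2 k.snd.deco.2) :=
    fun i k => hT.mul_eq _ _ _ _
  refine ⟨fun u v h => ?_, fun u v w h h' => ?_, fun u v h j => ?_, fun u v hu hv huv => ?_⟩
  · rw [hT.star_eq, hS.star_apply, b.star_matrixUnit]
    rfl
  · rw [hmul]
    dsimp only
    rw [b.matrixUnit_mul]
    have h1 : (Univ.gen (CKIndex.base ⟨u, v, h⟩) * Univ.gen (CKIndex.base ⟨v, w, h'⟩) :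
        T.CKAlgebra δ) = Univ.gen (CKIndex.base ⟨u, w, h.trans h'⟩) := hS.mul_eq _ _ _ _ _
    rw [h1]
  · have h1 : (Univ.gen (CKIndex.base ⟨u, v, h⟩) : T.CKAlgebra δ) = _ :=
      hS.sum_eq u.base v.base h j
    dsimp only
    rw [h1]
    let L : T.CKAlgebra δ →+ CStarTensor (T.CKAlgebra δ) (compactOperators H) :=
      AddMonoidHom.mk' (fun a => Univ.gen (a, b.matrixUnit u.deco.2 v.deco.2))
        fun a a' => hT.add_left a a' _
    exact map_sum L _ _
  · rw [hmul]
    dsimp only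
    by_cases h : u.deco.2 = v.deco.2
    · have h1 : u.base ≠ v.base := fun e => huv (DecoratedWord.ext_of
        (Prod.ext (congrArg DecoratedWord.deco e) h)
        (by have h2 : u.base.word = v.base.word := congrArg DecoratedWord.word e
            exact h2))
      have h3 : (Univ.gen (CKIndex.base ⟨u, u, rfl⟩) * Univ.gen (CKIndex.base ⟨v, v, rfl⟩) :
        T.CKAlgebra δ) = 0 := hS.orthogonal u.base v.base hu hv h1
      rw [h3]
      have := hT.smul_left 0 0 (b.matrixUnit u.deco.2 u.deco.2 * b.matrixUnit v.deco.2 v.deco.2)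
      rwa [zero_smul, zero_smul] at this
    · rw [b.matrixUnit_mul_of_ne _ _ _ _ h]
      have := hT.smul_right 0 (Univ.gen (CKIndex.base ⟨u, u, rfl⟩) *
        Univ.gen (CKIndex.base ⟨v, v, rfl⟩)) 0
      rwa [zero_smul, zero_smul] at this

variable (T δ) in
/-- `𝒜_D ⊗ 𝒦 ≅ 𝒜_{D × I}`. -/
theorem nonempty_tensorEquiv (b : HilbertBasis I ℂ H) :
    Nonempty (CStarTensor (T.CKAlgebra δ) (compactOperators H) ≃⋆ₐ[ℂ]
      T.CKAlgebra (indexed δ I)) := by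
  obtain ⟨τ, hτ, hgen⟩ := exists_isMatrixFamily T δ I
  obtain ⟨S, hS, hSτ⟩ := hτ.exists_isTensorFamily b
  have hT := isTensorFamily_gen (T.CKAlgebra δ) (compactOperators H)
  let Φ : T.CKAlgebra (indexed δ I) →⋆ₙₐ[ℂ] CStarTensor (T.CKAlgebra δ) (compactOperators H) :=
    Univ.lift (R := T.ckRelations (indexed δ I)) (isCKFamily_tensor T δ b)
  let Ψ : CStarTensor (T.CKAlgebra δ) (compactOperators H) →⋆ₙₐ[ℂ] T.CKAlgebra (indexed δ I) :=
    Univ.lift (R := tensorRelations _ _) hS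
  have hΦ : ∀ i, Φ (Univ.gen i) =
      Univ.gen (Univ.gen i.base, b.matrixUnit i.fst.deco.2 i.snd.deco.2) := fun i =>
    Univ.lift_gen (R := T.ckRelations (indexed δ I)) (isCKFamily_tensor T δ b) i
  have hΨ : ∀ p, Ψ (Univ.gen p) = S p := fun p => Univ.lift_gen (R := tensorRelations _ _) hS p
  have h1 : ∀ y, Ψ (Φ y) = y := by
    have h : Ψ.comp Φ = NonUnitalStarAlgHom.id ℂ _ := Univ.hom_ext fun i => by
      rw [NonUnitalStarAlgHom.comp_apply, hΦ, hΨ, hSτ, hgen]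
      rfl
    exact fun y => congrArg (fun f : T.CKAlgebra (indexed δ I) →⋆ₙₐ[ℂ] _ => f y) h
  -- Density in `x` reduces to matrix units, where `S` is τ_{pq}; density in `a` then reduces to
  -- generators of 𝒜.
  have h2 : ∀ a x, Φ (S (a, x)) = Univ.gen (a, x) := by
    intro a x
    let g : compactOperators H →L[ℂ] CStarTensor (T.CKAlgebra δ) (compactOperators H) :=
      LinearMap.mkContinuous { toFun := fun x => Univ.gen (a, x)
                               map_add' := hT.add_right a
                               map_smul' := fun c x => hT.smul_right c a x } ‖a‖ (hT.norm_le a)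
    let s : compactOperators H →L[ℂ] T.CKAlgebra (indexed δ I) :=
      LinearMap.mkContinuous { toFun := fun x => S (a, x)
                               map_add' := hS.add_right a
                               map_smul' := fun c x => hS.smul_right c a x } ‖a‖ (hS.norm_le a)
    have hc := continuous_starHom Φ
    refine dense_span_induction b.dense_span_matrixUnit (P := fun x => Φ (s x) = g x)
      (isClosed_eq (by fun_prop) (by fun_prop)) ?_ (by simp only [map_zero]) ?_ ?_ x
    · rintro _ ⟨⟨p, q⟩, rfl⟩
      change Φ (S (a, b.matrixUnit p q)) = Univ.gen (a, b.matrixUnit p q)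
      rw [hSτ]
      let g' : T.CKAlgebra δ →L[ℂ] CStarTensor (T.CKAlgebra δ) (compactOperators H) :=
        LinearMap.mkContinuous { toFun := fun a => Univ.gen (a, b.matrixUnit p q)
                                 map_add' := fun a a' => hT.add_left a a' _
                                 map_smul' := fun c a => hT.smul_left c a _ }
          ‖b.matrixUnit p q‖ (fun a => (hT.norm_le a _).trans (mul_comm _ _).le)
      refine dense_span_induction (T.dense_span_s δ) (P := fun a => Φ (τ p q a) = g' a)
        (isClosed_eq (by fun_prop) (by fun_prop)) ?_ (by simp only [map_zero]) ?_ ?_ a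
      · rintro _ ⟨i, rfl⟩
        rw [hgen, hΦ]
        rfl
      · intro x y hx hy; simp only [map_add, hx, hy]
      · intro c x hx; simp only [map_smul, hx]
    · intro x y hx hy; simp only [map_add, hx, hy]
    · intro c x hx; simp only [map_smul, hx]
  have h3 : ∀ y, Φ (Ψ y) = y := by
    have h : Φ.comp Ψ = NonUnitalStarAlgHom.id ℂ _ := Univ.hom_ext fun p => by
      rw [NonUnitalStarAlgHom.comp_apply, hΨ, h2]
      rfl
    exact fun y => congrArg (fun f : CStarTensor (T.CKAlgebra δ) (compactOperators H) →⋆ₙₐ[ℂ] _ =>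
      f y) h
  exact ⟨{ toFun := Ψ, invFun := Φ, left_inv := h3, right_inv := h1, map_add' := map_add Ψ,
           map_mul' := map_mul Ψ, map_star' := map_star Ψ, map_smul' := map_smul Ψ }⟩

end

end TransitionSystem

open CStarRelations

namespace TransitionSystem

variable {r : ℕ} {A : Type u} {T : TransitionSystem r A} {D : Type u} {δ : D → A}

/-! ## Replacing decorations by decorated words -/

variable (T δ) in
/-- The decorated words whose shape is prescribed by the decoration. -/
abbrev Refined (m : D → Fin r → ℕ) : Type u := {u : T.DecoratedWord δ // u.shape = m u.deco}

variable (T δ) in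
/-- The decorations by words of prescribed shape. -/
abbrev refinedDecoration (m : D → Fin r → ℕ) : T.Refined δ m → A := fun u => u.1.t

variable {m : D → Fin r → ℕ}

namespace DecoratedWord

/-- The word that decorates, followed by the word that is decorated. -/
def join (x : T.DecoratedWord (T.refinedDecoration δ m)) : T.DecoratedWord δ :=
  x.deco.1.mul x.word x.o_eq.symm

theorem join_t (x : T.DecoratedWord (T.refinedDecoration δ m)) : x.join.t = x.t := mul_t _ _ _

theorem join_shape (x : T.DecoratedWord (T.refinedDecoration δ m)) :
    x.join.shape = m x.join.deco + x.shape :=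
  congrArg (· + x.shape) x.deco.2

theorem join_mul (x : T.DecoratedWord (T.refinedDecoration δ m)) (w : T.Word) (h : x.t = w.o) :
    (x.mul w h).join = x.join.mul w (x.join_t.trans h) :=
  (mul_assoc' _ _ h _).symm

/-- The decoration of the joined word prescribes the shape of its first piece, hence where to cut.
-/
theorem join_injective : Function.Injective (join : T.DecoratedWord (T.refinedDecoration δ m) → _) := by
  intro x y h
  have hd : x.join.deco = y.join.deco := congrArg DecoratedWord.deco h
  obtain ⟨h1, h2⟩ := mul_inj h (x.deco.2.trans ((congrArg m hd).trans y.deco.2.symm))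
  exact ext_of (Subtype.ext h1) h2

theorem exists_join {u : T.DecoratedWord δ} (h : m u.deco ≤ u.shape) :
    ∃ x : T.DecoratedWord (T.refinedDecoration δ m), x.join = u := by
  obtain ⟨v, w, hvw, hv, -, rfl⟩ := u.exists_mul (add_tsub_cancel_of_le h).symm
  exact ⟨⟨⟨v, hv⟩, w, hvw.symm⟩, rfl⟩

end DecoratedWord

namespace CKIndex

/-- The pair of joined words. -/
def join (i : T.CKIndex (T.refinedDecoration δ m)) : T.CKIndex δ :=
  ⟨i.fst.join, i.snd.join, by rw [DecoratedWord.join_t, DecoratedWord.join_t, i.t_eq]⟩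

theorem join_t (i : T.CKIndex (T.refinedDecoration δ m)) : i.join.t = i.t :=
  DecoratedWord.join_t _

theorem join_ext (i : T.CKIndex (T.refinedDecoration δ m)) (w : T.Word) (h : i.t = w.o) :
    (i.ext w h).join = i.join.ext w (i.join_t.trans h) :=
  ext_eq (DecoratedWord.join_mul _ _ _) (DecoratedWord.join_mul _ _ _)

theorem join_injective : Function.Injective (join : T.CKIndex (T.refinedDecoration δ m) → _) :=
  fun _ _ h => ext_eq (DecoratedWord.join_injective (congrArg CKIndex.fst h))
    (DecoratedWord.join_injective (congrArg CKIndex.snd h))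

/-- Both words of the pair are at least as long as prescribed by their decorations. -/
def IsLong (m : D → Fin r → ℕ) (i : T.CKIndex δ) : Prop :=
  m i.fst.deco ≤ i.fst.shape ∧ m i.snd.deco ≤ i.snd.shape

theorem isLong_join (i : T.CKIndex (T.refinedDecoration δ m)) : i.join.IsLong m :=
  ⟨le_self_add.trans i.fst.join_shape.ge, le_self_add.trans i.snd.join_shape.ge⟩

theorem IsLong.exists_join {i : T.CKIndex δ} (h : i.IsLong m) :
    ∃ x : T.CKIndex (T.refinedDecoration δ m), x.join = i := by
  obtain ⟨u, hu⟩ := DecoratedWord.exists_join h.1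
  obtain ⟨v, hv⟩ := DecoratedWord.exists_join h.2
  exact ⟨⟨u, v, by rw [← u.join_t, ← v.join_t, hu, hv, i.t_eq]⟩, ext_eq hu hv⟩

theorem isLong_ext {K : Fin r → ℕ} (hK : ∀ d, m d ≤ K) (i : T.CKIndex δ) (w : T.Word)
    (h : i.t = w.o) (hw : w.shape = K) : (i.ext w h).IsLong m :=
  ⟨(hK _).trans (hw ▸ le_add_self), (hK _).trans (hw ▸ le_add_self)⟩

/-- The sum of the values of a family at the extensions of a pair by words of shape `l`. -/
def extSum [Finite A] {M : Type*} [AddCommMonoid M] (l : Fin r → ℕ) (F : T.CKIndex δ → M)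
    (i : T.CKIndex δ) : M := ∑ w : T.From l i.t, F (i.ext w.wd w.o_eq)

theorem extSum_eq [Finite A] {M : Type*} [AddCommMonoid M] (l : Fin r → ℕ) (F : T.CKIndex δ → M)
    (i : T.CKIndex δ) {a : A} (h : i.t = a) :
    extSum l F i = ∑ w : T.From l a, F (i.ext w.wd (h.trans w.o_eq)) := by
  subst h; rfl

theorem extSum_extSum [Finite A] {M : Type*} [AddCommMonoid M] (l n : Fin r → ℕ)
    (F : T.CKIndex δ → M) (i : T.CKIndex δ) : extSum l (extSum n F) i = extSum (l + n) F i := by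
  unfold extSum
  rw [sum_from_add l n i.t (fun w hw => F (i.ext w hw))]
  refine Finset.sum_congr rfl fun w _ => ?_
  rw [sum_from_congr rfl (i.ext_t w.wd w.o_eq)
    (fun w' hw' => F ((i.ext w.wd w.o_eq).ext w' hw'))]
  refine Finset.sum_congr rfl fun w' _ => ?_
  rw [CKIndex.ext_ext _ _ _ _ _ w'.o_eq]

open scoped Classical in
/-- A family on the joined pairs, extended by `0`. -/
def unjoin {M : Type*} [Zero M] (G : T.CKIndex (T.refinedDecoration δ m) → M) (i : T.CKIndex δ) :
    M :=
  if h : ∃ x : T.CKIndex (T.refinedDecoration δ m), x.join = i then G h.choose else 0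

theorem unjoin_join {M : Type*} [Zero M] (G : T.CKIndex (T.refinedDecoration δ m) → M)
    (x : T.CKIndex (T.refinedDecoration δ m)) : unjoin G x.join = G x := by
  have h : ∃ y : T.CKIndex (T.refinedDecoration δ m), y.join = x.join := ⟨x, rfl⟩
  rw [unjoin, dif_pos h, join_injective h.choose_spec]

end CKIndex

variable [Finite A] {B : Type u} [NonUnitalCStarAlgebra B]

open CKIndex

namespace IsCKFamily

/-- Extension does not change decorations, so no term of the expansion is composable. This replaces
the comparison of shapes where prescribed shapes differ. -/
theorem mul_eq_zero_of_deco_ne {S : T.CKIndex δ → B} (hS : T.IsCKFamily δ S) {i k : T.CKIndex δ}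
    (h : i.snd.deco ≠ k.fst.deco) : S i * S k = 0 := by
  rw [hS.mul_eq_mulSum]
  refine Finset.sum_eq_zero fun w _ => Finset.sum_eq_zero fun w' _ => ?_
  have e : ¬ (i.ext w.wd w.o_eq).snd = (k.ext w'.wd w'.o_eq).fst :=
    fun e => h (by
      have e' : (i.ext w.wd w.o_eq).snd.deco = (k.ext w'.wd w'.o_eq).fst.deco :=
        congrArg DecoratedWord.deco e
      exact e')
  rw [compVal, dif_neg e]

theorem comp_join {S : T.CKIndex δ → B} (hS : T.IsCKFamily δ S) :
    T.IsCKFamily (T.refinedDecoration δ m) fun i => S i.join where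
  star_eq _ _ _ := hS.star_eq _ _ _
  mul_eq _ _ _ _ _ := hS.mul_eq _ _ _ _ _
  sum_eq u v h j := by
    rw [hS.isSummable (CKIndex.join ⟨u, v, h⟩) (unitShape j),
      sum_from_congr rfl (CKIndex.join_t ⟨u, v, h⟩) (fun w hw => S ((CKIndex.join ⟨u, v, h⟩).ext w hw))]
    exact Finset.sum_congr rfl fun w _ => congrArg S (CKIndex.join_ext ⟨u, v, h⟩ w.wd w.o_eq).symm
  orthogonal u v hu hv huv := by
    by_cases hd : u.join.deco = v.join.deco
    · exact hS.diag_mul_diag _ _ _ rfl (by rw [u.join_shape, v.join_shape, hd, hu, hv])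
        fun e => huv (DecoratedWord.join_injective e)
    · exact hS.mul_eq_zero_of_deco_ne hd

variable {G : T.CKIndex (T.refinedDecoration δ m) → B}

theorem unjoin_eq_extSum (hG : T.IsCKFamily (T.refinedDecoration δ m) G)
    {i : T.CKIndex δ} (hi : i.IsLong m) (l : Fin r → ℕ) :
    unjoin G i = extSum l (unjoin G) i := by
  obtain ⟨x, rfl⟩ := hi.exists_join
  rw [unjoin_join, hG.isSummable x l, extSum,
    sum_from_congr rfl x.join_t (fun w hw => unjoin G (x.join.ext w hw))]
  refine Finset.sum_congr rfl fun w _ => ?_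
  rw [← x.join_ext w.wd w.o_eq, unjoin_join]

theorem star_unjoin (hG : T.IsCKFamily (T.refinedDecoration δ m) G)
    {i : T.CKIndex δ} (hi : i.IsLong m) : star (unjoin G i) = unjoin G i.flip := by
  obtain ⟨x, rfl⟩ := hi.exists_join
  have h : x.join.flip = x.flip.join := rfl
  rw [h, unjoin_join, unjoin_join, hG.star_apply]

theorem unjoin_mul (hG : T.IsCKFamily (T.refinedDecoration δ m) G)
    {i k : T.CKIndex δ} (hi : i.IsLong m) (hk : k.IsLong m)
    (h : i.snd.shape = k.fst.shape) : unjoin G i * unjoin G k = compVal (unjoin G) i k := by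
  obtain ⟨x, rfl⟩ := hi.exists_join
  obtain ⟨y, rfl⟩ := hk.exists_join
  rw [unjoin_join, unjoin_join]
  unfold compVal
  split_ifs with hc
  · have e : x.snd = y.fst := DecoratedWord.join_injective hc
    have e1 : x.join.comp y.join hc = (x.comp y e).join := rfl
    have hs : x.snd.shape = y.fst.shape := congrArg DecoratedWord.shape e
    rw [e1, unjoin_join, hG.mul_eq_compVal hs, compVal, dif_pos e]
  · have e : ¬ x.snd = y.fst := fun e => hc (congrArg DecoratedWord.join e)
    -- With equal original decorations the prescribed shapes agree, so equal joined shapes force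
    -- equal inner shapes; with different ones the product vanishes by the decorations alone.
    by_cases hd : x.snd.join.deco = y.fst.join.deco
    · have hs : x.snd.shape = y.fst.shape := by
        have h' : x.snd.join.shape = y.fst.join.shape := h
        rw [x.snd.join_shape, y.fst.join_shape, hd] at h'
        exact add_left_cancel h'
      rw [hG.mul_eq_compVal hs, compVal, dif_neg e]
    · exact hG.mul_eq_zero_of_deco_ne fun e =>
        hd (congrArg (fun z : T.Refined δ m => z.1.deco) e)

/-- A pair of short words cannot be cut at the prescribed shapes. After extension by any word of
shape `K` it can, and the sum rule leaves only this formula; boundedness of the prescribed shapes is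
what makes one `K` suffice. -/
theorem extSum_unjoin (hG : T.IsCKFamily (T.refinedDecoration δ m) G)
    {K : Fin r → ℕ} (hK : ∀ d, m d ≤ K) :
    T.IsCKFamily δ (extSum K (unjoin G)) where
  star_eq u v h := by
    rw [extSum_eq K _ ⟨v, u, h.symm⟩ h.symm, extSum, star_sum]
    exact Finset.sum_congr rfl fun w _ => hG.star_unjoin (isLong_ext hK _ _ _ w.shape_eq)
  mul_eq u v w h h' := by
    rw [extSum_eq K _ ⟨v, w, h'⟩ h.symm, extSum, extSum, Finset.sum_mul]
    refine Finset.sum_congr rfl fun x _ => ?_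
    have key : ∀ y : T.From K u.t, unjoin G ((⟨u, v, h⟩ : T.CKIndex δ).ext x.wd x.o_eq) *
        unjoin G ((⟨v, w, h'⟩ : T.CKIndex δ).ext y.wd (h.symm.trans y.o_eq)) =
        compVal (unjoin G) ((⟨u, v, h⟩ : T.CKIndex δ).ext x.wd x.o_eq)
          ((⟨v, w, h'⟩ : T.CKIndex δ).ext y.wd (h.symm.trans y.o_eq)) := fun y =>
      hG.unjoin_mul (isLong_ext hK _ _ _ x.shape_eq) (isLong_ext hK _ _ _ y.shape_eq) rfl
    rw [Finset.mul_sum]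
    refine (Fintype.sum_eq_single x fun y hy => ?_).trans ?_
    · have e : ¬ ((⟨u, v, h⟩ : T.CKIndex δ).ext x.wd x.o_eq).snd =
          ((⟨v, w, h'⟩ : T.CKIndex δ).ext y.wd (h.symm.trans y.o_eq)).fst :=
        fun e => hy (From.ext (DecoratedWord.mul_inj e rfl).2).symm
      exact (key y).trans (dif_neg e)
    · have e : ((⟨u, v, h⟩ : T.CKIndex δ).ext x.wd x.o_eq).snd =
          ((⟨v, w, h'⟩ : T.CKIndex δ).ext x.wd (h.symm.trans x.o_eq)).fst := rfl
      exact (key x).trans (dif_pos e)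
  sum_eq u v h j := by
    change extSum K (unjoin G) ⟨u, v, h⟩ =
      extSum (unitShape j) (extSum K (unjoin G)) ⟨u, v, h⟩
    rw [extSum_extSum, add_comm, ← extSum_extSum]
    exact Finset.sum_congr rfl fun w _ =>
      hG.unjoin_eq_extSum (isLong_ext hK _ _ _ w.shape_eq) _
  orthogonal u v hu hv huv := by
    change extSum K (unjoin G) (T.diag u) * extSum K (unjoin G) (T.diag v) = 0
    unfold extSum
    rw [Finset.sum_mul]
    refine Finset.sum_eq_zero fun x _ => ?_
    rw [Finset.mul_sum]
    refine Finset.sum_eq_zero fun y _ => ?_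
    have hs : ((T.diag u).ext x.wd x.o_eq).snd.shape = ((T.diag v).ext y.wd y.o_eq).fst.shape :=
      congrArg (· + K) (hu.trans hv.symm)
    have e : ¬ ((T.diag u).ext x.wd x.o_eq).snd = ((T.diag v).ext y.wd y.o_eq).fst :=
      fun e => huv (DecoratedWord.mul_inj e (hu.trans hv.symm)).1
    rw [hG.unjoin_mul (isLong_ext hK _ _ _ x.shape_eq) (isLong_ext hK _ _ _ y.shape_eq) hs,
      compVal, dif_neg e]

end IsCKFamily

variable (T δ) in
/-- The algebra `𝒜` does not change if the decorations are replaced by decorated words. -/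
theorem nonempty_refinedEquiv {K : Fin r → ℕ} (hK : ∀ d, m d ≤ K) :
    Nonempty (T.CKAlgebra δ ≃⋆ₐ[ℂ] T.CKAlgebra (T.refinedDecoration δ m)) := by
  have hS := T.isCKFamily_gen δ
  have hG := T.isCKFamily_gen (T.refinedDecoration δ m)
  have hΦ' := hG.extSum_unjoin hK
  have hΨ' := hS.comp_join (m := m)
  let Φ : T.CKAlgebra δ →⋆ₙₐ[ℂ] T.CKAlgebra (T.refinedDecoration δ m) :=
    Univ.lift (R := T.ckRelations δ) hΦ'
  let Ψ : T.CKAlgebra (T.refinedDecoration δ m) →⋆ₙₐ[ℂ] T.CKAlgebra δ :=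
    Univ.lift (R := T.ckRelations _) hΨ'
  have hΦ : ∀ i, Φ (Univ.gen i) = extSum K (unjoin Univ.gen) i := fun i =>
    Univ.lift_gen (R := T.ckRelations δ) hΦ' i
  have hΨ : ∀ i, Ψ (Univ.gen i) = Univ.gen i.join := fun i =>
    Univ.lift_gen (R := T.ckRelations _) hΨ' i
  have h1 : Φ.comp Ψ = NonUnitalStarAlgHom.id ℂ _ := Univ.hom_ext fun i => by
    -- A joined pair is already long enough, so the sum over its extensions collapses by the sum
    -- rule.
    rw [NonUnitalStarAlgHom.comp_apply, hΨ, hΦ, ← hG.unjoin_eq_extSum i.isLong_join, unjoin_join]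
    rfl
  have h2 : Ψ.comp Φ = NonUnitalStarAlgHom.id ℂ _ := Univ.hom_ext fun i => by
    rw [NonUnitalStarAlgHom.comp_apply, hΦ, extSum, map_sum]
    refine Eq.trans ?_ (hS.isSummable i K).symm
    refine Finset.sum_congr rfl fun w _ => ?_
    obtain ⟨x, hx⟩ := (isLong_ext hK i w.wd w.o_eq w.shape_eq).exists_join
    rw [← hx, unjoin_join, hΨ]
  exact ⟨{ toFun := Φ, invFun := Ψ
           left_inv := fun x => congrArg (fun f : T.CKAlgebra δ →⋆ₙₐ[ℂ] T.CKAlgebra δ => f x) h2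
           right_inv := fun y => congrArg
            (fun f : T.CKAlgebra (T.refinedDecoration δ m) →⋆ₙₐ[ℂ] _ => f y) h1
           map_add' := map_add Φ, map_mul' := map_mul Φ, map_star' := map_star Φ
           map_smul' := map_smul Φ }⟩

end TransitionSystem

open CStarRelations

/-! ### Arbitrary decorations -/

namespace TransitionSystem

variable {r : ℕ} {A : Type u} [Fintype A] {T : TransitionSystem r A}

instance {D : Type u} [Countable D] (δ : D → A) : Countable (T.DecoratedWord δ) := by
  have h : Function.Injective fun w : T.DecoratedWord δ => (w.deco, w.word) := fun w w' h =>
    DecoratedWord.ext_of (congrArg Prod.fst h) (congrArg Prod.snd h)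
  exact h.countable

/-- After stabilization, the decorations can be chosen such that every letter decorates infinitely
often. -/
theorem exists_refinement (T : TransitionSystem r A) {D : Type u} [Nonempty D] (δ : D → A) :
    ∃ (m : D × ULift.{u} ℕ → Fin r → ℕ) (K : Fin r → ℕ), (∀ d, m d ≤ K) ∧
      ∀ a, Infinite {u // T.refinedDecoration (indexed δ (ULift.{u} ℕ)) m u = a} := by
  obtain ⟨d₀⟩ := ‹Nonempty D›
  have : Nonempty A := ⟨δ d₀⟩
  choose w ho ht using T.exists_word
  -- The index n in ℕ designates the letter `(c n).1`, and (d, n) prescribes the shape of a word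
  -- from δ(d) to that letter. Every letter is designated infinitely often, and only finitely many
  -- shapes occur.
  obtain ⟨c, hc⟩ : ∃ c : ℕ → A × ℕ, Function.Surjective c := exists_surjective_nat _
  refine ⟨fun d => (w (δ d.1) (c d.2.down).1).shape,
    Finset.univ.sup fun p : A × A => (w p.1 p.2).shape, fun d =>
    Finset.le_sup (f := fun p : A × A => (w p.1 p.2).shape)
      (Finset.mem_univ (δ d.1, (c d.2.down).1)), fun a => ?_⟩
  -- With one decoration d₀ fixed, the indices designating `a` already give infinitely many
  -- decorated words that end in `a`.
  choose g hg using fun n => hc (a, n)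
  let f : ℕ → {u // T.refinedDecoration (indexed δ (ULift.{u} ℕ))
      (fun d => (w (δ d.1) (c d.2.down).1).shape) u = a} := fun n =>
    ⟨⟨⟨(d₀, ⟨g n⟩), w (δ d₀) a, ho _ _⟩, by
      change (w (δ d₀) a).shape = (w (δ d₀) (c (g n)).1).shape
      rw [hg]⟩, ht _ _⟩
  refine Infinite.of_injective f fun n n' h => ?_
  have h1 : (f n).1.1.deco = (f n').1.1.deco := congrArg (fun x => x.1.1.deco) h
  have h2 : g n = g n' := congrArg (fun d : D × ULift.{u} ℕ => d.2.down) h1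
  have h3 := (hg n).symm.trans ((congrArg c h2).trans (hg n'))
  exact congrArg Prod.snd h3

variable {H : Type u} [NormedAddCommGroup H] [InnerProductSpace ℂ H] [CompleteSpace H]
  [TopologicalSpace.SeparableSpace H] [Nontrivial H]
  {ψ : T.RevAlgebra →⋆ₙₐ[ℂ] (H →L[ℂ] H)}

/-- `𝒜_D ⊗ 𝒦` is the crossed product, whatever the decorations are. -/
theorem nonempty_stableEquiv (hr : 1 ≤ r) (hψ : Nondegenerate ψ) {D : Type u} [Nonempty D]
    [Countable D] (δ : D → A) :
    Nonempty (CStarTensor (T.CKAlgebra δ) (compactOperators EllTwo.{u}) ≃⋆ₐ[ℂ]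
      CrossedProduct (shiftAction ψ)) := by
  obtain ⟨m, K, hK, hm⟩ := exists_refinement T δ
  obtain ⟨e₁⟩ := nonempty_tensorEquiv T δ
    (HilbertBasis.ofRepr (LinearIsometryEquiv.refl ℂ _) : HilbertBasis (ULift.{u} ℕ) ℂ EllTwo.{u})
  obtain ⟨e₂⟩ := nonempty_refinedEquiv T (indexed δ (ULift.{u} ℕ)) hK
  obtain ⟨ξ, hξ⟩ := exists_isAdaptedBasis hr hψ
    (T.refinedDecoration (indexed δ (ULift.{u} ℕ)) m) hm
  exact ⟨(e₁.trans e₂).trans (crossedEquiv hξ hψ)⟩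

theorem exists_isAdaptedBasis_std (hr : 1 ≤ r) (hψ : Nondegenerate ψ) :
    ∃ ξ : A × ℕ → H, IsAdaptedBasis ψ (stdDecoration A) ξ := by
  refine exists_isAdaptedBasis hr hψ (stdDecoration A) fun a => ?_
  exact Infinite.of_injective (fun n : ℕ => (⟨(a, n), rfl⟩ : {d // stdDecoration A d = a}))
    fun n n' h => congrArg (fun x => x.1.2) h

end TransitionSystem

end

theorem theorem6p2 {r : ℕ} (hr : 1 ≤ r) {A : Type u} [Fintype A] (T : TransitionSystem r A) :
    -- there are nondegenerate representations `ψ` of `𝒜'` on nonzero separable Hilbert spaces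
    (∃ (H : Type u) (_ : NormedAddCommGroup H) (_ : InnerProductSpace ℂ H) (_ : CompleteSpace H)
      (ψ : T.RevAlgebra →⋆ₙₐ[ℂ] (H →L[ℂ] H)),
      TopologicalSpace.SeparableSpace H ∧ Nontrivial H ∧ TransitionSystem.Nondegenerate ψ) ∧
    -- and for each of them:
    ∀ (H : Type u) [NormedAddCommGroup H] [InnerProductSpace ℂ H] [CompleteSpace H]
      [TopologicalSpace.SeparableSpace H] [Nontrivial H]
      (ψ : T.RevAlgebra →⋆ₙₐ[ℂ] (H →L[ℂ] H)), TransitionSystem.Nondegenerate ψ →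
      IsAF (TransitionSystem.LimitAlgebra ψ) ∧
      (∃ φ : T.CKAlgebra (TransitionSystem.stdDecoration A) ≃⋆ₐ[ℂ]
          CrossedProduct (TransitionSystem.shiftAction ψ),
        φ '' T.core (TransitionSystem.stdDecoration A) =
          Set.range (CrossedProduct.incl (TransitionSystem.shiftAction ψ))) ∧
      ∀ (D : Type u) [Nonempty D] [Countable D] (δ : D → A),
        Nonempty (CStarTensor (T.CKAlgebra δ) (compactOperators EllTwo.{u}) ≃⋆ₐ[ℂ]
          CrossedProduct (TransitionSystem.shiftAction ψ)) := by
  refine ⟨TransitionSystem.exists_representation T hr, fun H _ _ _ _ _ ψ hψ => ?_⟩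
  obtain ⟨ξ, hξ⟩ := TransitionSystem.exists_isAdaptedBasis_std hr hψ
  exact ⟨TransitionSystem.isAF_limitAlgebra hξ hψ,
    ⟨TransitionSystem.crossedEquiv hξ hψ, TransitionSystem.crossedEquiv_image_core hξ hψ⟩,
    fun D _ _ δ => TransitionSystem.nonempty_stableEquiv hr hψ δ⟩
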